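/- Let $(M,g)$ be a closed smooth Riemannian surface of constant Gauss curvature $K$ (sign convention $R(X,Y)Z=\nabla_X\nabla_YZ-\nabla_Y\nabla_XZ-\nabla_{[X,Y]}Z$). For $p>0$ and a smooth curve $\gamma\colon I=[a,b]\to M$, $a<b$, put $\tau(\gamma)=\nabla_{\gamma'}\gamma'$ and $$E_{2,p}(\gamma)=\frac1p\int_I|\tau(\gamma)|^p\,ds .$$ Let $\gamma$ be a non-geodesic $p$-biharmonic curve parametrized by arclength: its geodesic curvature $k=|\tau(\gamma)|$ is positive on $I$ and $$\nabla_{\gamma'}\nabla_{\gamma'}\big(|\tau(\gamma)|^{p-2}\tau(\gamma)\big)=|\tau(\gamma)|^{p-2}R(\gamma',\tau(\gamma))\gamma' .$$ Let $N=\tau(\gamma)/k$ be its unit normal. For a vector field $\eta$ along $\gamma$ let $$\operatorname{Hess}(E_{2,p}(\gamma))(\eta,\eta)=\frac{d^2}{dt^2}\Big|_{t=0}E_{2,p}(\gamma_t),$$ where $\gamma_t$ is a smooth variation of $\gamma$ with $\partial_t\gamma_t|_{t=0}=\eta$. Here either $\gamma$ is a closed curve of period $|I|=b-a$ and all $\gamma_t$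 are closed with the same period, or $\gamma$ is an arc and the acceleration field $A=\frac{\nabla}{\partial t}\partial_t\gamma_t|_{t=0}$ satisfies $A=0$ and $\nabla_{\gamma'}A=0$ at both endpoints of $I$ (for instance $\gamma_t=\exp_\gamma(t\eta)$). Then, for both kinds of curves, variations with $\eta=N$ exist, and for all of them the second derivative exists and has the same value $$\operatorname{Hess}(E_{2,p}(\gamma))(N,N)=\int_I\Big((p-1)k^{p+2}+k'^2k^{p-2}+(p-1)K^2k^{p-2}-(2p+2)Kk^p\Big)ds .$$ Moreover: 1. If $p\neq\frac12$, then $k$ is constant and $$\operatorname{Hess}(E_{2,p}(\gamma))(N,N)=-4K|I|k^p .$$ In particular, if in addition $K>0$, then $\gamma$ is unstable, that is, $\operatorname{Hess}(E_{2,p}(\gamma))(\eta,\eta)<0$ for some vector field $\eta$ along $\gamma$. 2. If $p=\frac12$, then $$\operatorname{Hess}(E_{2,p}(\gamma))(N,N)=\int_I\Big(-\tfrac12k^{5/2}+k'^2k^{-3/2}-\tfrac12K^2k^{-3/2}-3Kk^{1/2}\Big)ds .$$ -/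

import Mathlib

open Set Filter Topology MeasureTheory
open scoped Manifold ContDiff

noncomputable section

namespace PBiharmonic

/-- The model plane for the charts of a surface. -/
abbrev Plane : Type := EuclideanSpace ℝ (Fin 2)

/-- The standard basis vectors of the model plane. -/
def stdVec (i : Fin 2) : Plane := EuclideanSpace.single i 1

/-- The `i`-th partial derivative of a function on the model plane. -/
def partialDeriv (i : Fin 2) (f : Plane → ℝ) (u : Plane) : ℝ := fderiv ℝ f u (stdVec i)

section Surface

variable {M : Type*} [TopologicalSpace M] [ChartedSpace Plane M]

/-- The coordinates, in the preferred chart around `x₀`, of a tangent vector `v` at `y`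
(for `y` in the domain of that chart). -/
def coords (x₀ y : M) (v : TangentSpace (𝓡 2) y) : Plane :=
  mfderiv (𝓡 2) 𝓘(ℝ, Plane) (extChartAt (𝓡 2) x₀) y v

/-- The tangent vector at `y` with coordinates `w` in the preferred chart around `x₀`. -/
def ofCoords (x₀ y : M) (w : Plane) : TangentSpace (𝓡 2) y :=
  (mfderiv (𝓡 2) 𝓘(ℝ, Plane) (extChartAt (𝓡 2) x₀) y).inverse w

/-- The velocity `γ'(s)` of a curve. -/
def velocity (γ : ℝ → M) (s : ℝ) : TangentSpace (𝓡 2) (γ s) :=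
  mfderiv 𝓘(ℝ, ℝ) (𝓡 2) γ s (1 : ℝ)

variable [IsManifold (𝓡 2) ∞ M]

/-- A smooth Riemannian metric on the surface `M`. -/
abbrev SmoothMetric (M : Type*) [TopologicalSpace M] [ChartedSpace Plane M]
    [IsManifold (𝓡 2) ∞ M] : Type _ :=
  Bundle.ContMDiffRiemannianMetric (𝓡 2) ∞ Plane (fun x : M ↦ TangentSpace (𝓡 2) x)

variable (g : SmoothMetric M)

/-- The length `|v|` of a tangent vector. -/
def length {x : M} (v : TangentSpace (𝓡 2) x) : ℝ := √(g.inner x v v)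

/-- The coefficient matrix `(g_{ij})` of the metric in the chart around `x₀`, as a function of
the point `u` of the model plane. -/
def metricCoeff (x₀ : M) (u : Plane) : Matrix (Fin 2) (Fin 2) ℝ :=
  Matrix.of fun i j ↦
    g.inner ((extChartAt (𝓡 2) x₀).symm u)
      (ofCoords x₀ ((extChartAt (𝓡 2) x₀).symm u) (stdVec i))
      (ofCoords x₀ ((extChartAt (𝓡 2) x₀).symm u) (stdVec j))

/-- The Christoffel symbols
`Γ^k_{ij} = ½ ∑_l g^{kl} (∂_i g_{jl} + ∂_j g_{il} - ∂_l g_{ij})` of the Levi-Civita connection in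
the chart around `x₀`. -/
def christoffel (x₀ : M) (k i j : Fin 2) (u : Plane) : ℝ :=
  (1 / 2 : ℝ) * ∑ l, (metricCoeff g x₀ u)⁻¹ k l *
    (partialDeriv i (fun w ↦ metricCoeff g x₀ w j l) u
      + partialDeriv j (fun w ↦ metricCoeff g x₀ w i l) u
      - partialDeriv l (fun w ↦ metricCoeff g x₀ w i j) u)

/-- The components `R^l_{ijk}` of the curvature tensor in the chart around `x₀`, defined by
`R(∂_i, ∂_j) ∂_k = ∑_l R^l_{ijk} ∂_l` with
`R(X, Y) Z = ∇_X ∇_Y Z - ∇_Y ∇_X Z - ∇_{[X, Y]} Z`. -/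
def curvatureCoeff (x₀ : M) (l i j k : Fin 2) (u : Plane) : ℝ :=
  partialDeriv i (christoffel g x₀ l j k) u - partialDeriv j (christoffel g x₀ l i k) u
    + ∑ m, (christoffel g x₀ l i m u * christoffel g x₀ m j k u
      - christoffel g x₀ l j m u * christoffel g x₀ m i k u)

/-- The Riemannian curvature tensor `R(X, Y) Z` at the point `x`. -/
def curvatureTensor {x : M} (X Y Z : TangentSpace (𝓡 2) x) : TangentSpace (𝓡 2) x :=
  ofCoords x x (WithLp.toLp 2 fun l ↦ ∑ i, ∑ j, ∑ k,
    curvatureCoeff g x l i j k (extChartAt (𝓡 2) x x)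
      * coords x x X i * coords x x Y j * coords x x Z k)

/-- The metric has constant (Gauss, that is sectional) curvature `K`. -/
def HasConstantCurvature (K : ℝ) : Prop :=
  ∀ (x : M) (X Y : TangentSpace (𝓡 2) x),
    g.inner x (curvatureTensor g X Y Y) X
      = K * (g.inner x X X * g.inner x Y Y - g.inner x X Y ^ 2)

/-- The covariant derivative `∇_{γ'} V` along the curve `γ` of a vector field `V` along `γ`:
in coordinates `(∇_{γ'} V)^k = (V^k)' + ∑_{i,j} Γ^k_{ij} (γ^i)' V^j`. At the parameter `s`
the chart around `γ s` is used. -/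
def covDeriv (γ : ℝ → M) (V : (s : ℝ) → TangentSpace (𝓡 2) (γ s)) (s : ℝ) :
    TangentSpace (𝓡 2) (γ s) :=
  ofCoords (γ s) (γ s) (WithLp.toLp 2 fun k ↦
    deriv (fun r ↦ coords (γ s) (γ r) (V r) k) s
      + ∑ i, ∑ j, christoffel g (γ s) k i j (extChartAt (𝓡 2) (γ s) (γ s))
        * deriv (fun r ↦ extChartAt (𝓡 2) (γ s) (γ r) i) s * coords (γ s) (γ s) (V s) j)

/-- The tension field `τ(γ) = ∇_{γ'} γ'`. -/
def tension (γ : ℝ → M) : (s : ℝ) → TangentSpace (𝓡 2) (γ s) :=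
  covDeriv g γ (velocity γ)

/-- The energy `E_{2,p}(γ) = (1/p) ∫_a^b |τ(γ)|^p ds`. -/
def energy (p a b : ℝ) (γ : ℝ → M) : ℝ :=
  (1 / p) * ∫ s in a..b, length g (tension g γ s) ^ p

/-- The geodesic curvature `k = |τ(γ)|` of a curve parametrized by arclength. -/
def geodesicCurvature (γ : ℝ → M) (s : ℝ) : ℝ := length g (tension g γ s)

/-- The unit normal `N = τ(γ) / k` of the Frenet frame, `∇_T T = k N`. -/
def unitNormal (γ : ℝ → M) (s : ℝ) : TangentSpace (𝓡 2) (γ s) :=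
  (geodesicCurvature g γ s)⁻¹ • tension g γ s

/-- The equation for `p`-biharmonic curves at the parameter `s`:
`∇_{γ'} ∇_{γ'} (|τ|^{p-2} τ) = |τ|^{p-2} R(γ', τ) γ'`. -/
def PBiharmonicEquationAt (p : ℝ) (γ : ℝ → M) (s : ℝ) : Prop :=
  covDeriv g γ (covDeriv g γ fun r ↦ (length g (tension g γ r) ^ (p - 2)) • tension g γ r) s
    = (length g (tension g γ s) ^ (p - 2)) •
        curvatureTensor g (velocity γ s) (tension g γ s) (velocity γ s)

/-- The two kinds of curves with parameter interval `[a, b]`. -/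
inductive CurveKind
  /-- smoothly closed curves, of period `b - a` -/
  | closed
  /-- arcs, with no condition relating the two endpoints -/
  | arc

/-- A non-geodesic `p`-biharmonic curve parametrized by arclength, with parameter interval `[a, b]`
and nowhere vanishing geodesic curvature. A smooth curve on the compact interval `[a, b]` is given
as the restriction of a smooth curve on `ℝ`. -/
structure IsPBiharmonicCurve (c : CurveKind) (p a b : ℝ) (γ : ℝ → M) : Prop where
  smooth : ContMDiff 𝓘(ℝ, ℝ) (𝓡 2) ∞ γ
  closed : c = .closed → Function.Periodic γ (b - a)
  arclength : ∀ s ∈ Icc a b, g.inner (γ s) (velocity γ s) (velocity γ s) = 1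
  curvature_pos : ∀ s ∈ Icc a b, 0 < geodesicCurvature g γ s
  equation : ∀ s ∈ Icc a b, PBiharmonicEquationAt g p γ s

/-- The variational vector field `∂γ_t/∂t` at `t = 0`. -/
def variationField (Γ : ℝ → ℝ → M) (s : ℝ) : TangentSpace (𝓡 2) (Γ 0 s) :=
  velocity (fun t ↦ Γ t s) 0

/-- The acceleration `∇/∂t ∂γ_t/∂t` at `t = 0`. -/
def variationAccel (Γ : ℝ → ℝ → M) (s : ℝ) : TangentSpace (𝓡 2) (Γ 0 s) :=
  covDeriv g (fun t ↦ Γ t s) (velocity fun t ↦ Γ t s) 0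

/-- `Γ` (where `Γ t` is the curve `γ_t`) is a variation of `γ` with variational vector field `η`.
A variation of a closed curve is through closed curves with the same period. A variation of an arc
has acceleration vanishing to first order at the two endpoints (like `γ_t = exp (t η)`), so
that its second-order part makes no boundary contribution to the second derivative of the
energy. -/
structure IsVariation (c : CurveKind) (a b : ℝ) (γ : ℝ → M)
    (η : (s : ℝ) → TangentSpace (𝓡 2) (γ s)) (Γ : ℝ → ℝ → M) : Prop where
  smooth : ∃ ε > 0, ContMDiffOn 𝓘(ℝ, ℝ × ℝ) (𝓡 2) ∞ (fun q : ℝ × ℝ ↦ Γ q.1 q.2)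
    (Ioo (-ε) ε ×ˢ univ)
  zero : Γ 0 = γ
  field : ∀ s ∈ Icc a b,
    (⟨Γ 0 s, variationField Γ s⟩ : TangentBundle (𝓡 2) M) = ⟨γ s, η s⟩
  closed : c = .closed → ∀ᶠ t in 𝓝 (0 : ℝ), Function.Periodic (Γ t) (b - a)
  arc : c = .arc → ∀ s ∈ ({a, b} : Set ℝ),
    variationAccel g Γ s = 0 ∧ covDeriv g (Γ 0) (variationAccel g Γ) s = 0

/-- `f` is differentiable near `0` and twice differentiable at `0` with `f''(0) = h`. -/
def HasSecondDerivAtZero (f : ℝ → ℝ) (h : ℝ) : Prop :=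
  (∀ᶠ t in 𝓝 (0 : ℝ), DifferentiableAt ℝ f t) ∧ HasDerivAt (deriv f) h 0

/-- `Hess(E_{2,p}(γ))(η, η)` exists and equals `h`: there are variations of `γ` with
variational vector field `η`, and for each of them the second derivative of `t ↦ E_{2,p}(γ_t)` at
`t = 0` exists and equals `h`. -/
def HasHessian (c : CurveKind) (p a b : ℝ) (γ : ℝ → M)
    (η : (s : ℝ) → TangentSpace (𝓡 2) (γ s)) (h : ℝ) : Prop :=
  (∃ Γ, IsVariation g c a b γ η Γ) ∧
    ∀ Γ, IsVariation g c a b γ η Γ → HasSecondDerivAtZero (fun t ↦ energy g p a b (Γ t)) h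

/-- The curve is unstable: the Hessian is negative in some direction. -/
def IsUnstable (c : CurveKind) (p a b : ℝ) (γ : ℝ → M) : Prop :=
  ∃ (η : (s : ℝ) → TangentSpace (𝓡 2) (γ s)) (h : ℝ), HasHessian g c p a b γ η h ∧ h < 0

end Surface

end PBiharmonic

end

open PBiharmonic

/-!
The Hessian is computed in local coordinates and then integrated along the curve.

*Coordinates.* On a coordinate domain the metric and the Christoffel symbols are an instance of
`LeviCivitaOn`: a metric on an open set of a normed space with a torsion free metric connection, for
which the covariant derivative `cov` along maps is computed without reference to the surface. The
covariant derivative of the statement uses at each parameter the chart around the current point;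
that it may be computed in any chart (`coords_covDeriv`) follows from the transformation law of
the Christoffel symbols, which holds because isometries preserve the properties that
characterize the Levi-Civita connection (`LeviCivitaOn.christoffel_transform`).

*Second variation.* Write `T` for the velocity and `A` for the acceleration field of a variation
with variational field `N`, and let `W = |τ|^{p-2} τ`. Commuting covariant derivatives gives
`∇_t τ` and `∇_t ∇_t τ` at `t = 0` in terms of the Frenet frame and of
`∇_s ∇_s A + K (A - ⟨A, T⟩ T)`. Pairing the latter with `W` and moving both derivatives onto `W`
makes `A` drop out by the `p`-biharmonic equation, up to the derivative of the boundary term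
`⟨∇_s A, W⟩ - ⟨A, ∇_s W⟩`. What remains is the integrand of the Hessian
(`NormalVariation.second_variation`). The boundary term does not depend on charts; its values at the
endpoints agree for closed curves by periodicity, and vanish for arcs by the condition on `A`. Since
`k > 0` on the compact parameter interval, `|τ|^p` is smooth near `t = 0` and differentiation under
the integral sign is allowed (`IsPBiharmonicCurve.hasSecondDerivAtZero`).

*Existence of variations.* Instead of the exponential map, finitely many displacements in charts
are composed: displacing by `t w` in a chart, cut off by a bump function, adds a multiple of `w`
to the variational field, and displacing by `t² w` adds one to the acceleration only, so that the
acceleration can be made to vanish near an arc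
(`exists_family_of_periodic`, `exists_family_of_compact`).

*Constant curvature.* The tangential part of the `p`-biharmonic equation is
`(2p - 1) k^{p-1} k' = 0`, so `k` is constant for `p ≠ 1/2`; its normal part then gives `k² = K`,
and the integrand becomes `-4 K k^p` (`IsPBiharmonicCurve.exists_curvature_eq`).
-/

noncomputable section

namespace PBiharmonic

/-! ### Covariant derivatives along maps into a normed space -/

section Planar

variable {E P Q : Type*} [NormedAddCommGroup E] [NormedSpace ℝ E]
  [NormedAddCommGroup P] [NormedSpace ℝ P] [NormedAddCommGroup Q] [NormedSpace ℝ Q]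

/-- A smooth metric `G` on an open set `U` of a vector space together with its Levi-Civita
connection, given by the Christoffel map `C`: `(∇_X Y)(u) = D_X Y (u) + C u X Y`. -/
structure LeviCivitaOn (U : Set E) (G : E → E →L[ℝ] E →L[ℝ] ℝ) (C : E → E →L[ℝ] E →L[ℝ] E) :
    Prop where
  isOpen : IsOpen U
  contDiffOn_metric : ContDiffOn ℝ ∞ G U
  contDiffOn_christoffel : ContDiffOn ℝ ∞ C U
  metric_symm : ∀ u ∈ U, ∀ X Y, G u X Y = G u Y X
  metric_pos : ∀ u ∈ U, ∀ X, X ≠ 0 → 0 < G u X X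
  christoffel_symm : ∀ u ∈ U, ∀ X Y, C u X Y = C u Y X
  compat : ∀ u ∈ U, ∀ X Y Z, fderiv ℝ G u X Y Z = G u (C u X Y) Z + G u Y (C u X Z)

/-- The covariant derivative at `q` in direction `v` of a vector field `ξ` along a map `x` into the
model space. -/
def cov (C : E → E →L[ℝ] E →L[ℝ] E) (x ξ : P → E) (v q : P) : E :=
  fderiv ℝ ξ q v + C (x q) (fderiv ℝ x q v) (ξ q)

/-- The curvature `R(X, Y) Z` at `u` of the connection with Christoffel map `C`. -/
def curv (C : E → E →L[ℝ] E →L[ℝ] E) (u X Y Z : E) : E :=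
  fderiv ℝ C u X Y Z - fderiv ℝ C u Y X Z + C u X (C u Y Z) - C u Y (C u X Z)

variable {U : Set E} {G : E → E →L[ℝ] E →L[ℝ] ℝ} {C : E → E →L[ℝ] E →L[ℝ] E}
  {O : Set P} {x ξ ζ : P → E} {q v w : P}

lemma contDiffOn_fderiv_apply {F : Type*} [NormedAddCommGroup F] [NormedSpace ℝ F]
    {ξ : P → F} (hO : IsOpen O) (hξ : ContDiffOn ℝ ∞ ξ O) (v : P) :
    ContDiffOn ℝ ∞ (fun q ↦ fderiv ℝ ξ q v) O :=
  (hξ.fderiv_of_isOpen hO (by simp)).clm_apply contDiffOn_const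

lemma differentiableAt_of_contDiffOn {F : Type*} [NormedAddCommGroup F] [NormedSpace ℝ F]
    {ξ : P → F} (hO : IsOpen O) (hξ : ContDiffOn ℝ ∞ ξ O) (hq : q ∈ O) :
    DifferentiableAt ℝ ξ q :=
  (hξ.contDiffAt (hO.mem_nhds hq)).differentiableAt (by simp)

lemma isSymmSndFDerivAt_of_contDiffOn {F : Type*} [NormedAddCommGroup F] [NormedSpace ℝ F]
    {ξ : P → F} (hO : IsOpen O) (hξ : ContDiffOn ℝ ∞ ξ O) (hq : q ∈ O) :
    IsSymmSndFDerivAt ℝ ξ q := by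
  refine (hξ.contDiffAt (hO.mem_nhds hq)).isSymmSndFDerivAt ?_
  rw [minSmoothness_of_isRCLikeNormedField]
  exact WithTop.coe_le_coe.2 (le_top : (2 : ℕ∞) ≤ ⊤)

lemma LeviCivitaOn.contDiffOn_cov (h : LeviCivitaOn U G C) (hO : IsOpen O)
    (hx : ContDiffOn ℝ ∞ x O) (hU : MapsTo x O U) (hξ : ContDiffOn ℝ ∞ ξ O) (v : P) :
    ContDiffOn ℝ ∞ (cov C x ξ v) O :=
  (contDiffOn_fderiv_apply hO hξ v).add
    (((h.contDiffOn_christoffel.comp hx hU).clm_apply (contDiffOn_fderiv_apply hO hx v)).clm_apply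
      hξ)

lemma LeviCivitaOn.contDiffOn_inner (h : LeviCivitaOn U G C)
    (hx : ContDiffOn ℝ ∞ x O) (hU : MapsTo x O U) (hξ : ContDiffOn ℝ ∞ ξ O)
    (hζ : ContDiffOn ℝ ∞ ζ O) : ContDiffOn ℝ ∞ (fun q ↦ G (x q) (ξ q) (ζ q)) O :=
  ((h.contDiffOn_metric.comp hx hU).clm_apply hξ).clm_apply hζ

lemma LeviCivitaOn.differentiableAt_metric (h : LeviCivitaOn U G C) {u : E} (hu : u ∈ U) :
    DifferentiableAt ℝ G u :=
  differentiableAt_of_contDiffOn h.isOpen h.contDiffOn_metric hu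

lemma LeviCivitaOn.differentiableAt_christoffel (h : LeviCivitaOn U G C) {u : E} (hu : u ∈ U) :
    DifferentiableAt ℝ C u :=
  differentiableAt_of_contDiffOn h.isOpen h.contDiffOn_christoffel hu

/-- Metric compatibility of the covariant derivative along a map. -/
lemma LeviCivitaOn.fderiv_inner (h : LeviCivitaOn U G C) (hU : x q ∈ U)
    (hx : DifferentiableAt ℝ x q) (hξ : DifferentiableAt ℝ ξ q) (hζ : DifferentiableAt ℝ ζ q)
    (v : P) :
    fderiv ℝ (fun q ↦ G (x q) (ξ q) (ζ q)) q v
      = G (x q) (cov C x ξ v q) (ζ q) + G (x q) (ξ q) (cov C x ζ v q) := by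
  have hG : HasFDerivAt (fun q ↦ G (x q)) ((fderiv ℝ G (x q)).comp (fderiv ℝ x q)) q :=
    HasFDerivAt.comp (g := G) (f := x) q (h.differentiableAt_metric hU).hasFDerivAt hx.hasFDerivAt
  have := (hG.clm_apply hξ.hasFDerivAt).clm_apply hζ.hasFDerivAt
  rw [this.fderiv]
  have hc := h.compat (x q) hU (fderiv ℝ x q v) (ξ q) (ζ q)
  simp [cov, hc]
  ring

/-- The connection is torsion free. -/
lemma LeviCivitaOn.cov_fderiv_comm (h : LeviCivitaOn U G C) (hO : IsOpen O) (hq : q ∈ O)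
    (hx : ContDiffOn ℝ ∞ x O) (hU : MapsTo x O U) (v w : P) :
    cov C x (fun q ↦ fderiv ℝ x q w) v q = cov C x (fun q ↦ fderiv ℝ x q v) w q := by
  have hd : DifferentiableAt ℝ (fderiv ℝ x) q :=
    differentiableAt_of_contDiffOn hO (hx.fderiv_of_isOpen hO (by simp)) hq
  have hs : IsSymmSndFDerivAt ℝ x q := isSymmSndFDerivAt_of_contDiffOn hO hx hq
  simp only [cov]
  rw [h.christoffel_symm _ (hU hq), fderiv_clm_apply hd (by fun_prop),
    fderiv_clm_apply hd (by fun_prop)]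
  simpa using hs v w

/-- The curvature is the commutator of covariant derivatives along a map. -/
lemma LeviCivitaOn.cov_cov_sub (h : LeviCivitaOn U G C) (hO : IsOpen O) (hq : q ∈ O)
    (hx : ContDiffOn ℝ ∞ x O) (hU : MapsTo x O U) (hξ : ContDiffOn ℝ ∞ ξ O) (v w : P) :
    cov C x (cov C x ξ w) v q - cov C x (cov C x ξ v) w q
      = curv C (x q) (fderiv ℝ x q v) (fderiv ℝ x q w) (ξ q) := by
  have hdx : DifferentiableAt ℝ x q := differentiableAt_of_contDiffOn hO hx hq
  have hdξ : DifferentiableAt ℝ ξ q := differentiableAt_of_contDiffOn hO hξ hq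
  have hd2 : DifferentiableAt ℝ (fderiv ℝ x) q :=
    differentiableAt_of_contDiffOn hO (hx.fderiv_of_isOpen hO (by simp)) hq
  have hd3 : DifferentiableAt ℝ (fderiv ℝ ξ) q :=
    differentiableAt_of_contDiffOn hO (hξ.fderiv_of_isOpen hO (by simp)) hq
  have hs : IsSymmSndFDerivAt ℝ x q := isSymmSndFDerivAt_of_contDiffOn hO hx hq
  have hs' : IsSymmSndFDerivAt ℝ ξ q :=
    isSymmSndFDerivAt_of_contDiffOn hO hξ hq
  have hC : HasFDerivAt (fun q ↦ C (x q)) ((fderiv ℝ C (x q)).comp (fderiv ℝ x q)) q :=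
    HasFDerivAt.comp (g := C) (f := x) q (h.differentiableAt_christoffel (hU hq)).hasFDerivAt
      hdx.hasFDerivAt
  have key : ∀ a b : P, fderiv ℝ (cov C x ξ a) q b
      = fderiv ℝ (fderiv ℝ ξ) q b a + (fderiv ℝ C (x q) (fderiv ℝ x q b) (fderiv ℝ x q a) (ξ q)
        + C (x q) (fderiv ℝ (fderiv ℝ x) q b a) (ξ q)
        + C (x q) (fderiv ℝ x q a) (fderiv ℝ ξ q b)) := by
    intro a b
    have h1 := hd3.hasFDerivAt.clm_apply (hasFDerivAt_const a q)
    have h2 := hd2.hasFDerivAt.clm_apply (hasFDerivAt_const a q)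
    have := h1.add ((hC.clm_apply h2).clm_apply hdξ.hasFDerivAt)
    have h4 : fderiv ℝ (cov C x ξ a) q = _ := this.fderiv
    rw [h4]
    simp
    abel
  have unfold : ∀ a b : P, cov C x (cov C x ξ a) b q = fderiv ℝ (cov C x ξ a) q b
      + C (x q) (fderiv ℝ x q b) (cov C x ξ a q) := fun _ _ ↦ rfl
  rw [unfold, unfold, key, key, hs' v w, hs v w]
  simp only [cov, curv, map_add]
  abel

lemma cov_add (hξ : DifferentiableAt ℝ ξ q) (hζ : DifferentiableAt ℝ ζ q) (v : P) :
    cov C x (fun q ↦ ξ q + ζ q) v q = cov C x ξ v q + cov C x ζ v q := by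
  simp only [cov]
  rw [fderiv_fun_add hξ hζ]
  simp only [add_apply, map_add]
  abel

lemma cov_sub (hξ : DifferentiableAt ℝ ξ q) (hζ : DifferentiableAt ℝ ζ q) (v : P) :
    cov C x (fun q ↦ ξ q - ζ q) v q = cov C x ξ v q - cov C x ζ v q := by
  simp only [cov]
  rw [fderiv_fun_sub hξ hζ]
  simp only [sub_apply, map_sub]
  abel

lemma cov_smul {f : P → ℝ} (hf : DifferentiableAt ℝ f q) (hξ : DifferentiableAt ℝ ξ q) (v : P) :
    cov C x (fun q ↦ f q • ξ q) v q = fderiv ℝ f q v • ξ q + f q • cov C x ξ v q := by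
  simp only [cov]
  rw [fderiv_fun_smul hf hξ]
  simp only [add_apply, map_smul, smul_add,
    smul_apply, ContinuousLinearMap.smulRight_apply]
  abel

lemma cov_comp {ι : Q → P} {r v : Q} (hx : DifferentiableAt ℝ x (ι r))
    (hξ : DifferentiableAt ℝ ξ (ι r)) (hι : DifferentiableAt ℝ ι r) :
    cov C (x ∘ ι) (ξ ∘ ι) v r = cov C x ξ (fderiv ℝ ι r v) (ι r) := by
  simp only [cov]
  rw [fderiv_comp _ hx hι, fderiv_comp _ hξ hι]
  rfl

lemma cov_congr {ξ' : P → E} (h : ξ =ᶠ[𝓝 q] ξ') (v : P) :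
    cov C x ξ v q = cov C x ξ' v q := by
  simp only [cov, h.fderiv_eq, h.eq_of_nhds]

/-- The curvature operator of a metric connection is skew-symmetric: apply `[∂_X, ∂_Y] = 0` to
the inner product of two constant fields. -/
lemma LeviCivitaOn.curv_skew [FiniteDimensional ℝ E] (h : LeviCivitaOn U G C) {u : E} (hu : u ∈ U)
    (X Y Z W : E) :
    G u (curv C u X Y Z) W + G u Z (curv C u X Y W) = 0 := by
  have hx : ContDiffOn ℝ ∞ (fun q : E ↦ q) U := contDiffOn_id
  have hU : MapsTo (fun q : E ↦ q) U U := fun _ h ↦ h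
  have hc : ∀ V : E, ContDiffOn ℝ ∞ (fun _ : E ↦ V) U := fun V ↦ contDiffOn_const
  have dc : ∀ V A, ContDiffOn ℝ ∞ (cov C (fun q : E ↦ q) (fun _ ↦ V) A) U :=
    fun V A ↦ h.contDiffOn_cov h.isOpen hx hU (hc V) A
  have da : ∀ {F : E → E} {r}, ContDiffOn ℝ ∞ F U → r ∈ U → DifferentiableAt ℝ F r :=
    fun hF hr ↦ differentiableAt_of_contDiffOn h.isOpen hF hr
  have first : ∀ A, (fun r ↦ fderiv ℝ (fun q : E ↦ G q Z W) r A) =ᶠ[𝓝 u]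
      fun r ↦ G r (cov C (fun q : E ↦ q) (fun _ ↦ Z) A r) W
        + G r Z (cov C (fun q : E ↦ q) (fun _ ↦ W) A r) := by
    intro A
    filter_upwards [h.isOpen.mem_nhds hu] with r hr
    exact h.fderiv_inner (x := fun q ↦ q) hr (da hx hr) (da (hc Z) hr) (da (hc W) hr) A
  have second : ∀ A B, fderiv ℝ (fderiv ℝ (fun q : E ↦ G q Z W)) u B A
      = G u (cov C (fun q : E ↦ q) (cov C (fun q : E ↦ q) (fun _ ↦ Z) A) B u) W
        + G u (cov C (fun q : E ↦ q) (fun _ ↦ Z) A u) (cov C (fun q : E ↦ q) (fun _ ↦ W) B u)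
        + (G u (cov C (fun q : E ↦ q) (fun _ ↦ Z) B u) (cov C (fun q : E ↦ q) (fun _ ↦ W) A u)
          + G u Z (cov C (fun q : E ↦ q) (cov C (fun q : E ↦ q) (fun _ ↦ W) A) B u)) := by
    intro A B
    have hGZW : ContDiffOn ℝ ∞ (fun q : E ↦ G q Z W) U :=
      h.contDiffOn_inner hx hU (hc Z) (hc W)
    have h1 : fderiv ℝ (fderiv ℝ (fun q : E ↦ G q Z W)) u B A
        = fderiv ℝ (fun r ↦ fderiv ℝ (fun q : E ↦ G q Z W) r A) u B := by
      rw [fderiv_clm_apply]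
      · simp
      · exact differentiableAt_of_contDiffOn h.isOpen (hGZW.fderiv_of_isOpen h.isOpen (by simp)) hu
      · fun_prop
    rw [h1, (first A).fderiv_eq, fderiv_fun_add, add_apply]
    · rw [h.fderiv_inner (x := fun q ↦ q) hu (da hx hu) (da (dc Z A) hu) (da (hc W) hu),
        h.fderiv_inner (x := fun q ↦ q) hu (da hx hu) (da (hc Z) hu) (da (dc W A) hu)]
    · exact differentiableAt_of_contDiffOn h.isOpen (h.contDiffOn_inner hx hU (dc Z A) (hc W)) hu
    · exact differentiableAt_of_contDiffOn h.isOpen (h.contDiffOn_inner hx hU (hc Z) (dc W A)) hu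
  have hsym : IsSymmSndFDerivAt ℝ (fun q : E ↦ G q Z W) u :=
    isSymmSndFDerivAt_of_contDiffOn h.isOpen (h.contDiffOn_inner hx hU (hc Z) (hc W)) hu
  have e1 := h.cov_cov_sub h.isOpen hu hx hU (hc Z) X Y
  have e2 := h.cov_cov_sub h.isOpen hu hx hU (hc W) X Y
  have e3 := hsym X Y
  rw [second, second] at e3
  simp only [fderiv_fun_id, ContinuousLinearMap.id_apply] at e1 e2
  rw [← e1, ← e2]
  simp only [map_sub, sub_apply]
  linarith

/-- The transformation law of the Christoffel map: a connection is determined by being torsion free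
and compatible with the metric. -/
lemma LeviCivitaOn.christoffel_transform {F : Type*} [NormedAddCommGroup F] [NormedSpace ℝ F]
    {U' : Set F} {G' : F → F →L[ℝ] F →L[ℝ] ℝ} {C' : F → F →L[ℝ] F →L[ℝ] F}
    (h : LeviCivitaOn U G C) (h' : LeviCivitaOn U' G' C') {V : Set E} (hV : IsOpen V) (hVU : V ⊆ U)
    {ψ : E → F} (hψ : ContDiffOn ℝ ∞ ψ V) (hmap : MapsTo ψ V U')
    (hiso : ∀ u ∈ V, ∀ X Y, G u X Y = G' (ψ u) (fderiv ℝ ψ u X) (fderiv ℝ ψ u Y))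
    {u : E} (hu : u ∈ V) (hsurj : Function.Surjective (fderiv ℝ ψ u)) (X Y : E) :
    fderiv ℝ ψ u (C u X Y) = fderiv ℝ (fderiv ℝ ψ) u X Y
      + C' (ψ u) (fderiv ℝ ψ u X) (fderiv ℝ ψ u Y) := by
  -- the defect `B` is symmetric, and `⟨B X Y, Dψ Z⟩` is skew-symmetric in `Y` and `Z`
  set B : E → E → F := fun X Y ↦ fderiv ℝ ψ u (C u X Y) - fderiv ℝ (fderiv ℝ ψ) u X Y
      - C' (ψ u) (fderiv ℝ ψ u X) (fderiv ℝ ψ u Y) with hB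
  have hψd : DifferentiableAt ℝ ψ u := differentiableAt_of_contDiffOn hV hψ hu
  have hψd2 : DifferentiableAt ℝ (fderiv ℝ ψ) u :=
    differentiableAt_of_contDiffOn hV (hψ.fderiv_of_isOpen hV (by simp)) hu
  have hs : IsSymmSndFDerivAt ℝ ψ u := isSymmSndFDerivAt_of_contDiffOn hV hψ hu
  have Bsymm : ∀ X Y, B X Y = B Y X := by
    intro X Y
    simp only [hB]
    rw [h.christoffel_symm u (hVU hu) X Y, hs X Y, h'.christoffel_symm _ (hmap hu)]
  have anti : ∀ X Y Z, G' (ψ u) (B X Y) (fderiv ℝ ψ u Z)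
      + G' (ψ u) (fderiv ℝ ψ u Y) (B X Z) = 0 := by
    intro X Y Z
    have e0 : (fun r ↦ G r Y Z) =ᶠ[𝓝 u] fun r ↦ G' (ψ r) (fderiv ℝ ψ r Y) (fderiv ℝ ψ r Z) := by
      filter_upwards [hV.mem_nhds hu] with r hr using hiso r hr Y Z
    have hdY : ∀ Y, DifferentiableAt ℝ (fun r ↦ fderiv ℝ ψ r Y) u := fun Y ↦
      hψd2.clm_apply (differentiableAt_const _)
    have e1 := h'.fderiv_inner (hmap hu) hψd (hdY Y) (hdY Z) X
    rw [← e0.fderiv_eq] at e1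
    have e2 := h.fderiv_inner (x := fun q ↦ q) (ξ := fun _ ↦ Y) (ζ := fun _ ↦ Z) (hVU hu)
      differentiableAt_id (differentiableAt_const _) (differentiableAt_const _) X
    rw [e1] at e2
    have e3 : ∀ Y, fderiv ℝ (fun r ↦ fderiv ℝ ψ r Y) u X = fderiv ℝ (fderiv ℝ ψ) u X Y := by
      intro Y
      rw [fderiv_clm_apply hψd2 (differentiableAt_const _)]
      simp
    simp only [cov, e3, fderiv_fun_id, ContinuousLinearMap.id_apply, hiso u hu] at e2
    simp only [hB, map_sub, map_add, sub_apply, fderiv_fun_const,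
      add_apply, Pi.zero_apply, zero_apply, zero_add] at e2 ⊢
    linarith
  -- a trilinear form with both symmetries vanishes
  have zero : ∀ Z, G' (ψ u) (B X Y) (fderiv ℝ ψ u Z) = 0 := by
    intro Z
    have sy := h'.metric_symm (ψ u) (hmap hu)
    have a1 := anti X Y Z
    have a2 := anti Y Z X
    have a3 := anti Z X Y
    rw [sy (fderiv ℝ ψ u Y)] at a1
    rw [sy (fderiv ℝ ψ u Z)] at a2
    rw [sy (fderiv ℝ ψ u X)] at a3
    rw [Bsymm Y X] at a2
    rw [Bsymm Z X, Bsymm Z Y] at a3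
    linarith
  have hB0 : B X Y = 0 := by
    by_contra hne
    obtain ⟨Z, hZ⟩ := hsurj (B X Y)
    have := h'.metric_pos (ψ u) (hmap hu) _ hne
    have hz := zero Z
    rw [hZ] at hz
    exact this.ne' hz
  have := hB0
  simp only [hB, sub_sub, sub_eq_zero] at this
  exact this

/-- Covariant derivatives along a map are transported by a map obeying the transformation law. -/
lemma cov_transform {F : Type*} [NormedAddCommGroup F] [NormedSpace ℝ F]
    {C' : F → F →L[ℝ] F →L[ℝ] F} {ψ : E → F}
    (hψ : DifferentiableAt ℝ ψ (x q)) (hψ' : DifferentiableAt ℝ (fderiv ℝ ψ) (x q))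
    (htr : ∀ X Y : E, fderiv ℝ ψ (x q) (C (x q) X Y) = fderiv ℝ (fderiv ℝ ψ) (x q) X Y
      + C' (ψ (x q)) (fderiv ℝ ψ (x q) X) (fderiv ℝ ψ (x q) Y))
    (hx : DifferentiableAt ℝ x q) (hξ : DifferentiableAt ℝ ξ q) (v : P) :
    cov C' (fun q ↦ ψ (x q)) (fun q ↦ fderiv ℝ ψ (x q) (ξ q)) v q
      = fderiv ℝ ψ (x q) (cov C x ξ v q) := by
  have h1 := (hψ'.hasFDerivAt.comp q hx.hasFDerivAt).clm_apply hξ.hasFDerivAt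
  have h2 : fderiv ℝ (fun q ↦ fderiv ℝ ψ (x q) (ξ q)) q = _ := h1.fderiv
  have h3 : fderiv ℝ (fun q ↦ ψ (x q)) q = _ := (hψ.hasFDerivAt.comp q hx.hasFDerivAt).fderiv
  simp only [cov, h2, h3, map_add, htr]
  simp
  abel

end Planar

/-! ### Variations of a curve in a coordinate domain -/

section PlanarVariation

variable {E : Type*} [NormedAddCommGroup E] [NormedSpace ℝ E]
  {U : Set E} {G : E → E →L[ℝ] E →L[ℝ] ℝ} {C : E → E →L[ℝ] E →L[ℝ] E}

/-- The connection `C` has constant curvature `K` on `U`. -/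
def ConstCurvOn (U : Set E) (G : E → E →L[ℝ] E →L[ℝ] ℝ) (C : E → E →L[ℝ] E →L[ℝ] E) (K : ℝ) :
    Prop :=
  ∀ u ∈ U, ∀ X Y Z, curv C u X Y Z = K • (G u Y Z • X - G u X Z • Y)

/-- The parameter direction `∂/∂t` of a variation `(t, s) ↦ γ_t(s)`. -/
def dirT : ℝ × ℝ := (1, 0)

/-- The parameter direction `∂/∂s` of a variation `(t, s) ↦ γ_t(s)`. -/
def dirS : ℝ × ℝ := (0, 1)

/-- The velocity field `∂x/∂s` of a variation. -/
def velS (x : ℝ × ℝ → E) (q : ℝ × ℝ) : E := fderiv ℝ x q dirS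

/-- The variational field `∂x/∂t` of a variation. -/
def velT (x : ℝ × ℝ → E) (q : ℝ × ℝ) : E := fderiv ℝ x q dirT

/-- The tension field `∇_s ∂x/∂s` of a variation. -/
def tens (C : E → E →L[ℝ] E →L[ℝ] E) (x : ℝ × ℝ → E) : ℝ × ℝ → E := cov C x (velS x) dirS

/-- The acceleration field `∇_t ∂x/∂t` of a variation. -/
def accel (C : E → E →L[ℝ] E →L[ℝ] E) (x : ℝ × ℝ → E) : ℝ × ℝ → E := cov C x (velT x) dirT

/-- The length of the tension field of a variation. -/
def tensNorm (G : E → E →L[ℝ] E →L[ℝ] ℝ) (C : E → E →L[ℝ] E →L[ℝ] E) (x : ℝ × ℝ → E)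
    (q : ℝ × ℝ) : ℝ := √(G (x q) (tens C x q) (tens C x q))

/-- A smooth variation in a coordinate domain. -/
structure PlanarVariation (U : Set E) (G : E → E →L[ℝ] E →L[ℝ] ℝ) (C : E → E →L[ℝ] E →L[ℝ] E)
    (O : Set (ℝ × ℝ)) (x : ℝ × ℝ → E) : Prop extends LeviCivitaOn U G C where
  isOpen_dom : IsOpen O
  smooth : ContDiffOn ℝ ∞ x O
  mapsTo : MapsTo x O U

namespace PlanarVariation

variable {O : Set (ℝ × ℝ)} {x ξ ζ : ℝ × ℝ → E} {q : ℝ × ℝ} {K p : ℝ}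

lemma smooth_velS (h : PlanarVariation U G C O x) : ContDiffOn ℝ ∞ (velS x) O :=
  contDiffOn_fderiv_apply h.isOpen_dom h.smooth dirS

lemma smooth_velT (h : PlanarVariation U G C O x) : ContDiffOn ℝ ∞ (velT x) O :=
  contDiffOn_fderiv_apply h.isOpen_dom h.smooth dirT

lemma smooth_cov (h : PlanarVariation U G C O x) (hξ : ContDiffOn ℝ ∞ ξ O) (v : ℝ × ℝ) :
    ContDiffOn ℝ ∞ (cov C x ξ v) O :=
  h.contDiffOn_cov h.isOpen_dom h.smooth h.mapsTo hξ v

lemma smooth_inner (h : PlanarVariation U G C O x) (hξ : ContDiffOn ℝ ∞ ξ O)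
    (hζ : ContDiffOn ℝ ∞ ζ O) : ContDiffOn ℝ ∞ (fun q ↦ G (x q) (ξ q) (ζ q)) O :=
  h.contDiffOn_inner h.smooth h.mapsTo hξ hζ

lemma smooth_tens (h : PlanarVariation U G C O x) : ContDiffOn ℝ ∞ (tens C x) O :=
  h.smooth_cov h.smooth_velS _

lemma smooth_accel (h : PlanarVariation U G C O x) : ContDiffOn ℝ ∞ (accel C x) O :=
  h.smooth_cov h.smooth_velT _

lemma da {F : Type*} [NormedAddCommGroup F] [NormedSpace ℝ F] {f : ℝ × ℝ → F}
    (h : PlanarVariation U G C O x) (hf : ContDiffOn ℝ ∞ f O) (hq : q ∈ O) :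
    DifferentiableAt ℝ f q :=
  differentiableAt_of_contDiffOn h.isOpen_dom hf hq

lemma fderiv_inner' (h : PlanarVariation U G C O x) (hξ : ContDiffOn ℝ ∞ ξ O)
    (hζ : ContDiffOn ℝ ∞ ζ O) (hq : q ∈ O) (v : ℝ × ℝ) :
    fderiv ℝ (fun q ↦ G (x q) (ξ q) (ζ q)) q v
      = G (x q) (cov C x ξ v q) (ζ q) + G (x q) (ξ q) (cov C x ζ v q) :=
  h.fderiv_inner (h.mapsTo hq) (h.da h.smooth hq) (h.da hξ hq) (h.da hζ hq) v

lemma cov_comm (h : PlanarVariation U G C O x) (hK : ConstCurvOn U G C K)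
    (hξ : ContDiffOn ℝ ∞ ξ O) (hq : q ∈ O) :
    cov C x (cov C x ξ dirS) dirT q = cov C x (cov C x ξ dirT) dirS q
      + K • (G (x q) (velS x q) (ξ q) • velT x q - G (x q) (velT x q) (ξ q) • velS x q) := by
  rw [← hK _ (h.mapsTo hq), ← sub_eq_iff_eq_add']
  exact h.cov_cov_sub h.isOpen_dom hq h.smooth h.mapsTo hξ dirT dirS

lemma cov_velS_dirT (h : PlanarVariation U G C O x) (hq : q ∈ O) :
    cov C x (velS x) dirT q = cov C x (velT x) dirS q :=
  h.cov_fderiv_comm h.isOpen_dom hq h.smooth h.mapsTo dirT dirS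

lemma cov_congr_on (h : PlanarVariation U G C O x) (hq : q ∈ O) (hξ : ∀ r ∈ O, ξ r = ζ r)
    (v : ℝ × ℝ) : cov C x ξ v q = cov C x ζ v q :=
  cov_congr (by filter_upwards [h.isOpen_dom.mem_nhds hq] using hξ) v

/-- The first variation of the tension field. -/
lemma cov_tens (h : PlanarVariation U G C O x) (hK : ConstCurvOn U G C K) (hq : q ∈ O) :
    cov C x (tens C x) dirT q = cov C x (cov C x (velT x) dirS) dirS q
      + K • (G (x q) (velS x q) (velS x q) • velT x q
        - G (x q) (velT x q) (velS x q) • velS x q) := by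
  rw [tens, h.cov_comm hK h.smooth_velS hq,
    h.cov_congr_on hq (fun r hr ↦ h.cov_velS_dirT hr) dirS]

/-- The second variation of the tension field. -/
lemma cov_cov_tens (h : PlanarVariation U G C O x) (hK : ConstCurvOn U G C K) (hq : q ∈ O) :
    cov C x (cov C x (tens C x) dirT) dirT q = cov C x (cov C x (accel C x) dirS) dirS q
      + K • (G (x q) (velS x q) (velS x q) • accel C x q
        - G (x q) (accel C x q) (velS x q) • velS x q)
      + K • (G (x q) (tens C x q) (velT x q) • velT x q
        + (4 * G (x q) (velS x q) (cov C x (velT x) dirS q)) • velT x q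
        - (4 * G (x q) (velT x q) (cov C x (velT x) dirS q)) • velS x q
        - G (x q) (velT x q) (velT x q) • tens C x q) := by
  set T := velS x with hT
  set η := velT x with hη
  have sT : ContDiffOn ℝ ∞ T O := h.smooth_velS
  have sη : ContDiffOn ℝ ∞ η O := h.smooth_velT
  have sd : ContDiffOn ℝ ∞ (cov C x η dirS) O := h.smooth_cov sη _
  have sy : ∀ r ∈ O, ∀ X Y, G (x r) X Y = G (x r) Y X := fun r hr ↦ h.metric_symm _ (h.mapsTo hr)
  have sG : ∀ {ξ ζ : ℝ × ℝ → E}, ContDiffOn ℝ ∞ ξ O → ContDiffOn ℝ ∞ ζ O →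
    ContDiffOn ℝ ∞ (fun q ↦ G (x q) (ξ q) (ζ q)) O := fun a b ↦ h.smooth_inner a b
  -- curvature terms are differentiated in the form `K • (⟨ξ, ζ⟩ θ - ⟨θ, ζ⟩ ξ)`
  have expand : ∀ {ξ ζ θ : ℝ × ℝ → E}, ContDiffOn ℝ ∞ ξ O → ContDiffOn ℝ ∞ ζ O →
      ContDiffOn ℝ ∞ θ O → ∀ v, cov C x (fun r ↦ K • (G (x r) (ξ r) (ζ r) • θ r
          - G (x r) (θ r) (ζ r) • ξ r)) v q
        = K • ((G (x q) (cov C x ξ v q) (ζ q) + G (x q) (ξ q) (cov C x ζ v q)) • θ q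
          + G (x q) (ξ q) (ζ q) • cov C x θ v q
          - (G (x q) (cov C x θ v q) (ζ q) + G (x q) (θ q) (cov C x ζ v q)) • ξ q
          - G (x q) (θ q) (ζ q) • cov C x ξ v q) := by
    intro ξ ζ θ hξ hζ hθ v
    have e1 := cov_smul (C := C) (x := x) (f := fun _ ↦ K) (by fun_prop)
      (h.da (((sG hξ hζ).smul hθ).sub ((sG hθ hζ).smul hξ)) hq) v
    have e2 := cov_sub (C := C) (x := x) (h.da ((sG hξ hζ).smul hθ) hq)
      (h.da ((sG hθ hζ).smul hξ) hq) v
    have e3 := cov_smul (C := C) (x := x) (h.da (sG hξ hζ) hq) (h.da hθ hq) v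
    have e4 := cov_smul (C := C) (x := x) (h.da (sG hθ hζ) hq) (h.da hξ hq) v
    rw [h.fderiv_inner' hξ hζ hq] at e3
    rw [h.fderiv_inner' hθ hζ hq] at e4
    simp only [fderiv_fun_const, Pi.zero_apply, zero_apply, zero_smul, zero_add] at e1
    refine e1.trans (congrArg (K • ·) ?_)
    refine e2.trans ?_
    refine (congrArg₂ (· - ·) e3 e4).trans ?_
    abel
  have sR : ∀ {ξ ζ θ : ℝ × ℝ → E}, ContDiffOn ℝ ∞ ξ O → ContDiffOn ℝ ∞ ζ O →
      ContDiffOn ℝ ∞ θ O → ContDiffOn ℝ ∞ (fun r ↦ K • (G (x r) (ξ r) (ζ r) • θ r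
          - G (x r) (θ r) (ζ r) • ξ r)) O := fun hξ hζ hθ ↦
    contDiffOn_const.smul (((sG hξ hζ).smul hθ).sub ((sG hθ hζ).smul hξ))
  have sA : ContDiffOn ℝ ∞ (accel C x) O := h.smooth_accel
  have e1 : cov C x η dirT q = accel C x q := rfl
  have e2 : cov C x T dirS q = tens C x q := rfl
  have f1 := cov_add (C := C) (x := x) (h.da (h.smooth_cov sd dirS) hq)
    (h.da (sR sT sT sη) hq) dirT
  have f2 := cov_add (C := C) (x := x) (h.da (h.smooth_cov sA dirS) hq)
    (h.da (sR sT sη sη) hq) dirS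
  have f3 := h.cov_congr_on hq (fun r hr ↦ h.cov_tens hK hr) dirT
  have f4 := h.cov_congr_on hq (fun r hr ↦ h.cov_comm hK sη hr) dirS
  rw [expand sT sT sη] at f1
  rw [expand sT sη sη] at f2
  rw [f3.trans f1, h.cov_comm hK sd hq, f4.trans f2, h.cov_velS_dirT hq]
  rw [e1, e2, sy q hq (cov C x η dirS q) (T q), sy q hq (η q) (T q),
    sy q hq (cov C x η dirS q) (η q)]
  module

end PlanarVariation
end PlanarVariation

/-! ### The second variation in the Frenet frame -/

section Frenet

variable {E : Type*} [NormedAddCommGroup E] [NormedSpace ℝ E]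
  {U : Set E} {G : E → E →L[ℝ] E →L[ℝ] ℝ} {C : E → E →L[ℝ] E →L[ℝ] E}

lemma exists_eq_smul_add_smul_of_linearIndependent (hE : Module.finrank ℝ E = 2) {X Y : E}
    (h : LinearIndependent ℝ ![X, Y]) (Z : E) : ∃ a b : ℝ, Z = a • X + b • Y := by
  have : FiniteDimensional ℝ E := FiniteDimensional.of_finrank_pos (by omega)
  have hs := h.span_eq_top_of_card_eq_finrank' (by simp [hE])
  have hZ : Z ∈ Submodule.span ℝ (Set.range ![X, Y]) := hs ▸ Submodule.mem_top
  rw [Matrix.range_cons, Matrix.range_cons, Matrix.range_empty, union_empty,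
    ← Set.insert_eq, Submodule.mem_span_pair] at hZ
  obtain ⟨a, b, hab⟩ := hZ
  exact ⟨a, b, hab.symm⟩

/-- In dimension two a curvature operator with constant sectional curvature is determined, since it
is skew-symmetric. -/
lemma LeviCivitaOn.curv_eq_of_sectional (hE : Module.finrank ℝ E = 2) (h : LeviCivitaOn U G C)
    {u : E} (hu : u ∈ U) {K : ℝ}
    (hK : ∀ X Y, G u (curv C u X Y Y) X = K * (G u X X * G u Y Y - G u X Y ^ 2)) (X Y Z : E) :
    curv C u X Y Z = K • (G u Y Z • X - G u X Z • Y) := by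
  have : FiniteDimensional ℝ E := FiniteDimensional.of_finrank_pos (by omega)
  have sy := h.metric_symm u hu
  by_cases hXY : LinearIndependent ℝ ![X, Y]
  · have nondeg : ∀ V, G u V X = 0 → G u V Y = 0 → V = 0 := by
      intro V h1 h2
      by_contra hV
      obtain ⟨a, b, hab⟩ := exists_eq_smul_add_smul_of_linearIndependent hE hXY V
      have h0 : G u V (a • X + b • Y) = 0 := by simp [h1, h2]
      rw [← hab] at h0
      exact (h.metric_pos u hu V hV).ne' h0
    have hY : curv C u X Y Y = K • (G u Y Y • X - G u X Y • Y) := by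
      rw [← sub_eq_zero]
      have h1 := h.curv_skew hu X Y Y Y
      rw [sy Y] at h1
      refine nondeg _ ?_ ?_
      · simp only [map_sub, map_smul, sub_apply, smul_apply, smul_eq_mul, hK]
        rw [sy Y X]
        ring
      · simp only [map_sub, map_smul, sub_apply, smul_apply, smul_eq_mul]
        linear_combination (1 / 2) * h1
    have hX : curv C u X Y X = K • (G u Y X • X - G u X X • Y) := by
      rw [← sub_eq_zero]
      have h1 := h.curv_skew hu X Y X X
      rw [sy X] at h1
      have h2 : curv C u X Y X = - curv C u Y X X := by simp only [curv]; abel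
      have h3 := hK Y X
      refine nondeg _ ?_ ?_
      · simp only [map_sub, map_smul, sub_apply, smul_apply, smul_eq_mul]
        rw [sy Y X]
        linear_combination (1 / 2) * h1
      · simp only [map_sub, map_smul, sub_apply, smul_apply, smul_eq_mul, h2,
          map_neg, neg_apply, h3]
        rw [sy Y X]
        ring
    obtain ⟨a, b, rfl⟩ := exists_eq_smul_add_smul_of_linearIndependent hE hXY Z
    have hlin : curv C u X Y (a • X + b • Y) = a • curv C u X Y X + b • curv C u X Y Y := by
      simp only [curv, map_add, map_smul]
      module
    rw [hlin, hX, hY]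
    simp only [map_add, map_smul, smul_eq_mul]
    module
  · rw [LinearIndependent.pair_iff] at hXY
    push Not at hXY
    obtain ⟨a, b, hab, hne⟩ := hXY
    have anti : ∀ A B, curv C u A A B = 0 := fun A B ↦ by simp [curv]
    by_cases ha : a = 0
    · have hb := hne ha
      have hY : Y = 0 := by simpa [ha, hb] using hab
      simp [hY, curv]
    · obtain ⟨c, rfl⟩ : ∃ c : ℝ, X = c • Y := ⟨-(a⁻¹ * b), by
        have : a⁻¹ • (a • X + b • Y) = 0 := by rw [hab, smul_zero]
        rw [smul_add, smul_smul, inv_mul_cancel₀ ha, one_smul, smul_smul] at this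
        rw [eq_neg_of_add_eq_zero_left this, neg_smul]⟩
      have : curv C u (c • Y) Y Z = c • curv C u Y Y Z := by
        simp only [curv, map_smul, smul_apply]
        module
      rw [this, anti]
      simp only [map_smul, smul_apply, smul_eq_mul]
      module

/-- A vector of a plane in terms of an orthogonal basis. -/
lemma LeviCivitaOn.eq_of_orthogonal (hE : Module.finrank ℝ E = 2) (h : LeviCivitaOn U G C)
    {u : E} (hu : u ∈ U) {X Y : E} (hX : G u X X = 1) (hXY : G u X Y = 0) (hY : G u Y Y ≠ 0)
    (Z : E) : Z = G u Z X • X + (G u Z Y / G u Y Y) • Y := by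
  have sy := h.metric_symm u hu
  have hli : LinearIndependent ℝ ![X, Y] := by
    rw [LinearIndependent.pair_iff]
    intro a b hab
    have h1 : G u (a • X + b • Y) X = 0 := by simp [hab]
    have h2 : G u (a • X + b • Y) Y = 0 := by simp [hab]
    simp only [map_add, map_smul, add_apply, smul_apply, smul_eq_mul, sy Y X, hX, hXY] at h1 h2
    constructor
    · simpa using h1
    · simpa [hY] using h2
  obtain ⟨a, b, rfl⟩ := exists_eq_smul_add_smul_of_linearIndependent hE hli Z
  simp only [map_add, map_smul, add_apply, smul_apply, smul_eq_mul, sy Y X, hX, hXY]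
  congr 2
  · simp
  · field_simp
    simp

/-- A variation in a coordinate domain whose middle curve has unit speed for parameters in `J`, and
whose variational field there is the unit normal. -/
structure NormalVariation (U : Set E) (G : E → E →L[ℝ] E →L[ℝ] ℝ) (C : E → E →L[ℝ] E →L[ℝ] E)
    (O : Set (ℝ × ℝ)) (x : ℝ × ℝ → E) (J : Set ℝ) : Prop extends PlanarVariation U G C O x where
  isOpen_line : IsOpen J
  line_mem : ∀ s ∈ J, ((0 : ℝ), s) ∈ O
  tens_pos : ∀ q ∈ O, 0 < G (x q) (tens C x q) (tens C x q)
  unit_speed : ∀ s ∈ J, G (x (0, s)) (velS x (0, s)) (velS x (0, s)) = 1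
  velT_eq : ∀ s ∈ J, velT x (0, s) = (tensNorm G C x (0, s))⁻¹ • tens C x (0, s)

lemma hasDerivAt_line {F : Type*} [NormedAddCommGroup F] [NormedSpace ℝ F] {f : ℝ × ℝ → F}
    {t s : ℝ} (hf : DifferentiableAt ℝ f (t, s)) :
    HasDerivAt (fun r ↦ f (t, r)) (fderiv ℝ f (t, s) dirS) s :=
  hf.hasFDerivAt.comp_hasDerivAt s ((hasDerivAt_const s t).prodMk (hasDerivAt_id s))

lemma hasDerivAt_column {F : Type*} [NormedAddCommGroup F] [NormedSpace ℝ F] {f : ℝ × ℝ → F}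
    {t s : ℝ} (hf : DifferentiableAt ℝ f (t, s)) :
    HasDerivAt (fun r ↦ f (r, s)) (fderiv ℝ f (t, s) dirT) t :=
  hf.hasFDerivAt.comp_hasDerivAt t ((hasDerivAt_id t).prodMk (hasDerivAt_const t s))

namespace NormalVariation

variable {O : Set (ℝ × ℝ)} {x : ℝ × ℝ → E} {J : Set ℝ} {K p s : ℝ} {q : ℝ × ℝ} {ξ ζ : ℝ × ℝ → E}

lemma fderiv_congr {F : Type*} [NormedAddCommGroup F] [NormedSpace ℝ F] {f f' : ℝ × ℝ → F}
    (h : NormalVariation U G C O x J) (hf : ContDiffOn ℝ ∞ f O) (hf' : ContDiffOn ℝ ∞ f' O)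
    (he : ∀ r ∈ J, f (0, r) = f' (0, r)) (hs : s ∈ J) :
    fderiv ℝ f (0, s) dirS = fderiv ℝ f' (0, s) dirS := by
  have h1 := hasDerivAt_line (h.da hf (h.line_mem s hs))
  have h2 := hasDerivAt_line (h.da hf' (h.line_mem s hs))
  refine (h1.congr_of_eventuallyEq ?_).unique h2
  filter_upwards [h.isOpen_line.mem_nhds hs] with r hr using (he r hr).symm

lemma cov_congr_line (h : NormalVariation U G C O x J) (hf : ContDiffOn ℝ ∞ ξ O)
    (hf' : ContDiffOn ℝ ∞ ζ O) (he : ∀ r ∈ J, ξ (0, r) = ζ (0, r)) (hs : s ∈ J) :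
    cov C x ξ dirS (0, s) = cov C x ζ dirS (0, s) := by
  rw [cov, cov, h.fderiv_congr hf hf' he hs, he s hs]

lemma tensNorm_pos (h : NormalVariation U G C O x J) (hq : q ∈ O) : 0 < tensNorm G C x q :=
  Real.sqrt_pos.2 (h.tens_pos q hq)

lemma tensNorm_sq (h : NormalVariation U G C O x J) (hq : q ∈ O) :
    G (x q) (tens C x q) (tens C x q) = tensNorm G C x q ^ 2 :=
  (Real.sq_sqrt (h.tens_pos q hq).le).symm

lemma smooth_tensNorm (h : NormalVariation U G C O x J) : ContDiffOn ℝ ∞ (tensNorm G C x) O :=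
  (h.smooth_inner h.smooth_tens h.smooth_tens).sqrt fun q hq ↦ (h.tens_pos q hq).ne'

lemma smooth_rpow (h : NormalVariation U G C O x J) (p : ℝ) :
    ContDiffOn ℝ ∞ (fun q ↦ tensNorm G C x q ^ p) O :=
  h.smooth_tensNorm.rpow_const_of_ne fun _ hq ↦ (h.tensNorm_pos hq).ne'

lemma fderiv_tensNorm (h : NormalVariation U G C O x J) (hq : q ∈ O) (v : ℝ × ℝ) :
    G (x q) (cov C x (tens C x) v q) (tens C x q)
      = tensNorm G C x q * fderiv ℝ (tensNorm G C x) q v := by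
  have h1 := h.fderiv_inner' h.smooth_tens h.smooth_tens hq v
  have h2 : (fun q ↦ G (x q) (tens C x q) (tens C x q)) =ᶠ[𝓝 q] fun q ↦ tensNorm G C x q ^ 2 := by
    filter_upwards [h.isOpen_dom.mem_nhds hq] with r hr using h.tensNorm_sq hr
  have h3 := ((h.da h.smooth_tensNorm hq).hasFDerivAt.pow 2).fderiv
  have h4 : fderiv ℝ (fun q ↦ tensNorm G C x q ^ 2) q = _ := h3
  rw [h2.fderiv_eq, h4, h.metric_symm _ (h.mapsTo hq) (tens C x q)] at h1
  simp at h1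
  linarith

lemma fderiv_rpow (h : NormalVariation U G C O x J) (hq : q ∈ O) (p : ℝ) (v : ℝ × ℝ) :
    fderiv ℝ (fun q ↦ tensNorm G C x q ^ p) q v
      = p * tensNorm G C x q ^ (p - 1) * fderiv ℝ (tensNorm G C x) q v := by
  have := (h.da h.smooth_tensNorm hq).hasFDerivAt.rpow_const (p := p)
    (Or.inl (h.tensNorm_pos hq).ne')
  rw [this.fderiv]
  simp

lemma inner_tens_velS (h : NormalVariation U G C O x J) (hs : s ∈ J) :
    G (x (0, s)) (tens C x (0, s)) (velS x (0, s)) = 0 := by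
  have h1 := h.fderiv_inner' h.smooth_velS h.smooth_velS (h.line_mem s hs) dirS
  rw [h.fderiv_congr (f' := fun _ ↦ (1 : ℝ)) (h.smooth_inner h.smooth_velS h.smooth_velS)
    contDiffOn_const (fun r hr ↦ h.unit_speed r hr) hs] at h1
  simp only [fderiv_fun_const, Pi.zero_apply, zero_apply] at h1
  rw [h.metric_symm _ (h.mapsTo (h.line_mem s hs)) (velS x (0, s))] at h1
  have h2 : cov C x (velS x) dirS (0, s) = tens C x (0, s) := rfl
  rw [h2] at h1
  linarith

/-- Frenet's equation for `∇_s τ`. -/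
lemma cov_tens_line (hE : Module.finrank ℝ E = 2) (h : NormalVariation U G C O x J) (hs : s ∈ J) :
    cov C x (tens C x) dirS (0, s)
      = (-tensNorm G C x (0, s) ^ 2) • velS x (0, s)
        + ((tensNorm G C x (0, s))⁻¹ * fderiv ℝ (tensNorm G C x) (0, s) dirS)
          • tens C x (0, s) := by
  have hq := h.line_mem s hs
  have sy := h.metric_symm _ (h.mapsTo hq)
  have hk := (h.tensNorm_pos hq).ne'
  have h1 := h.fderiv_inner' h.smooth_tens h.smooth_velS hq dirS
  rw [h.fderiv_congr (f' := fun _ ↦ (0 : ℝ)) (h.smooth_inner h.smooth_tens h.smooth_velS)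
    contDiffOn_const (fun r hr ↦ h.inner_tens_velS hr) hs] at h1
  simp only [fderiv_fun_const, Pi.zero_apply, zero_apply] at h1
  have h2 : cov C x (velS x) dirS (0, s) = tens C x (0, s) := rfl
  rw [h2, h.tensNorm_sq hq] at h1
  have h3 := h.fderiv_tensNorm hq dirS
  have h4 := h.eq_of_orthogonal hE (h.mapsTo hq) (h.unit_speed s hs)
    (by rw [sy, h.inner_tens_velS hs]) (by rw [h.tensNorm_sq hq]; positivity)
    (cov C x (tens C x) dirS (0, s))
  rw [h3, h.tensNorm_sq hq, show G (x (0, s)) (cov C x (tens C x) dirS (0, s)) (velS x (0, s))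
    = -tensNorm G C x (0, s) ^ 2 by linarith] at h4
  rw [h4]
  congr 2
  field_simp

/-- The unit normal field. -/
def nor (G : E → E →L[ℝ] E →L[ℝ] ℝ) (C : E → E →L[ℝ] E →L[ℝ] E) (x : ℝ × ℝ → E) (q : ℝ × ℝ) : E :=
  (tensNorm G C x q)⁻¹ • tens C x q

lemma smooth_nor (h : NormalVariation U G C O x J) : ContDiffOn ℝ ∞ (nor G C x) O :=
  (h.smooth_tensNorm.inv fun _ hq ↦ (h.tensNorm_pos hq).ne').smul h.smooth_tens

lemma tens_eq (h : NormalVariation U G C O x J) (hq : q ∈ O) :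
    tens C x q = tensNorm G C x q • nor G C x q := by
  rw [nor, smul_smul, mul_inv_cancel₀ (h.tensNorm_pos hq).ne', one_smul]

/-- Frenet's equation for `∇_s N`. -/
lemma cov_nor_line (hE : Module.finrank ℝ E = 2) (h : NormalVariation U G C O x J) (hs : s ∈ J) :
    cov C x (nor G C x) dirS (0, s) = (-tensNorm G C x (0, s)) • velS x (0, s) := by
  have hq := h.line_mem s hs
  have hk := (h.tensNorm_pos hq).ne'
  have h1 := h.cov_congr_on hq (fun r hr ↦ h.tens_eq hr) dirS
  have h2 := cov_smul (C := C) (x := x) (h.da h.smooth_tensNorm hq) (h.da h.smooth_nor hq) dirS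
  rw [h.cov_tens_line hE hs, h2] at h1
  have h3 : tensNorm G C x (0, s) • cov C x (nor G C x) dirS (0, s)
      = tensNorm G C x (0, s) • ((-tensNorm G C x (0, s)) • velS x (0, s)) := by
    rw [h.tens_eq hq] at h1
    have h4 := congrArg (fun z ↦ z - fderiv ℝ (tensNorm G C x) (0, s) dirS • nor G C x (0, s)) h1
    simp only [add_sub_cancel_left] at h4
    rw [← h4]
    simp only [smul_smul]
    rw [show (tensNorm G C x (0, s))⁻¹ * fderiv ℝ (tensNorm G C x) (0, s) dirS
      * tensNorm G C x (0, s) = fderiv ℝ (tensNorm G C x) (0, s) dirS by field_simp]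
    module
  exact smul_right_injective E hk h3

/-- Covariant derivatives along the middle curve in the Frenet frame. -/
lemma cov_frame (hE : Module.finrank ℝ E = 2) (h : NormalVariation U G C O x J)
    {f f' : ℝ × ℝ → ℝ} (hf : ContDiffOn ℝ ∞ f O) (hf' : ContDiffOn ℝ ∞ f' O) (hs : s ∈ J) :
    cov C x (fun q ↦ f q • velS x q + f' q • nor G C x q) dirS (0, s)
      = (fderiv ℝ f (0, s) dirS - f' (0, s) * tensNorm G C x (0, s)) • velS x (0, s)
        + (fderiv ℝ f' (0, s) dirS + f (0, s) * tensNorm G C x (0, s)) • nor G C x (0, s) := by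
  have hq := h.line_mem s hs
  have h1 := cov_add (C := C) (x := x) (h.da (hf.smul h.smooth_velS) hq)
    (h.da (hf'.smul h.smooth_nor) hq) dirS
  have h2 := cov_smul (C := C) (x := x) (h.da hf hq) (h.da h.smooth_velS hq) dirS
  have h3 := cov_smul (C := C) (x := x) (h.da hf' hq) (h.da h.smooth_nor hq) dirS
  have h4 : cov C x (velS x) dirS (0, s) = tens C x (0, s) := rfl
  rw [h4, h.tens_eq hq] at h2
  rw [h.cov_nor_line hE hs] at h3
  refine h1.trans ((congrArg₂ (· + ·) h2 h3).trans ?_)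
  module

lemma inner_nor_nor (h : NormalVariation U G C O x J) (hq : q ∈ O) :
    G (x q) (nor G C x q) (nor G C x q) = 1 := by
  have hk := (h.tensNorm_pos hq).ne'
  simp only [nor, map_smul, smul_apply, smul_eq_mul, h.tensNorm_sq hq]
  field_simp

lemma inner_nor_velS (h : NormalVariation U G C O x J) (hs : s ∈ J) :
    G (x (0, s)) (nor G C x (0, s)) (velS x (0, s)) = 0 := by
  simp [nor, h.inner_tens_velS hs]

lemma inner_velS_nor (h : NormalVariation U G C O x J) (hs : s ∈ J) :
    G (x (0, s)) (velS x (0, s)) (nor G C x (0, s)) = 0 := by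
  rw [h.metric_symm _ (h.mapsTo (h.line_mem s hs)), h.inner_nor_velS hs]

/-- The field `|τ|^{p-2} τ`. -/
def wfield (G : E → E →L[ℝ] E →L[ℝ] ℝ) (C : E → E →L[ℝ] E →L[ℝ] E) (x : ℝ × ℝ → E) (p : ℝ)
    (q : ℝ × ℝ) : E := tensNorm G C x q ^ (p - 2) • tens C x q

lemma smooth_wfield (h : NormalVariation U G C O x J) : ContDiffOn ℝ ∞ (wfield G C x p) O :=
  (h.smooth_rpow _).smul h.smooth_tens

lemma wfield_eq (h : NormalVariation U G C O x J) (hq : q ∈ O) :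
    wfield G C x p q = tensNorm G C x q ^ (p - 1) • nor G C x q := by
  have hk := h.tensNorm_pos hq
  rw [wfield, h.tens_eq hq, smul_smul, ← Real.rpow_add_one hk.ne']
  congr 2
  ring

/-- The tangential component of the equation for `p`-biharmonic curves. -/
lemma fderiv_tensNorm_eq_zero (hE : Module.finrank ℝ E = 2) (h : NormalVariation U G C O x J)
    (hp : p ≠ 1 / 2) (hs : s ∈ J)
    (heq : cov C x (cov C x (wfield G C x p) dirS) dirS (0, s)
      = tensNorm G C x (0, s) ^ (p - 2) • K •
        (G (x (0, s)) (tens C x (0, s)) (velS x (0, s)) • velS x (0, s)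
          - G (x (0, s)) (velS x (0, s)) (velS x (0, s)) • tens C x (0, s))) :
    fderiv ℝ (tensNorm G C x) (0, s) dirS = 0 := by
  have hq := h.line_mem s hs
  have hk := h.tensNorm_pos hq
  have su : ContDiffOn ℝ ∞ (fun q ↦ tensNorm G C x q ^ (p - 1)) O := h.smooth_rpow _
  have sus : ContDiffOn ℝ ∞ (fun q ↦ fderiv ℝ (fun q ↦ tensNorm G C x q ^ (p - 1)) q dirS) O :=
    contDiffOn_fderiv_apply h.isOpen_dom su dirS
  have suk : ContDiffOn ℝ ∞ (fun q ↦ -(tensNorm G C x q ^ p)) O := (h.smooth_rpow p).neg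
  -- `∇_s (k^{p-1} N) = -k^p T + (k^{p-1})' N`
  have first : ∀ r ∈ J, cov C x (wfield G C x p) dirS (0, r)
      = (-(tensNorm G C x (0, r) ^ p)) • velS x (0, r)
        + fderiv ℝ (fun q ↦ tensNorm G C x q ^ (p - 1)) (0, r) dirS • nor G C x (0, r) := by
    intro r hr
    have hk := h.tensNorm_pos (h.line_mem r hr)
    have h1 := h.cov_frame hE (f := fun _ ↦ 0) contDiffOn_const su hr
    rw [h.cov_congr_on (h.line_mem r hr) (ζ := fun q ↦ (0 : ℝ) • velS x q
      + tensNorm G C x q ^ (p - 1) • nor G C x q) (fun q hq ↦ by rw [h.wfield_eq hq]; simp), h1]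
    rw [← Real.rpow_add_one hk.ne', sub_add_cancel]
    simp
  have second := h.cov_congr_line (h.smooth_cov h.smooth_wfield dirS)
    ((suk.smul h.smooth_velS).add (sus.smul h.smooth_nor)) first hs
  have third := h.cov_frame hE suk sus hs
  -- the tangential component of the second derivative is `-(2p-1) k^{p-1} k'`
  have e := congrArg (fun z ↦ G (x (0, s)) z (velS x (0, s))) (heq.symm.trans (second.trans third))
  simp only [map_add, map_sub, map_smul, add_apply, sub_apply, smul_apply, smul_eq_mul,
    h.inner_nor_velS hs, h.inner_tens_velS hs, h.unit_speed s hs] at e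
  rw [h.fderiv_rpow hq] at e
  have h5 : fderiv ℝ (fun q ↦ -(tensNorm G C x q ^ p)) (0, s) dirS
      = -(p * tensNorm G C x (0, s) ^ (p - 1) * fderiv ℝ (tensNorm G C x) (0, s) dirS) := by
    rw [fderiv_fun_neg, neg_apply, h.fderiv_rpow hq]
  have h6 : tensNorm G C x (0, s) ^ (p - 1) = tensNorm G C x (0, s) ^ (p - 1 - 1)
      * tensNorm G C x (0, s) := by
    rw [← Real.rpow_add_one hk.ne', sub_add_cancel]
  have h7 : (2 * p - 1) * tensNorm G C x (0, s) ^ (p - 1)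
      * fderiv ℝ (tensNorm G C x) (0, s) dirS = 0 := by
    rw [h5, h6] at e
    rw [h6]
    linarith
  have h8 : (2 * p - 1) ≠ 0 := fun h ↦ hp (by linarith)
  have h9 := (Real.rpow_pos_of_pos hk (p - 1)).ne'
  simpa [h8, h9] using h7

/-- The curvature of a `p`-biharmonic curve with constant `k` is `k² = K`. -/
lemma sq_tensNorm_eq (hE : Module.finrank ℝ E = 2) (h : NormalVariation U G C O x J)
    (hs : s ∈ J) {k : ℝ} (hk : ∀ r ∈ J, tensNorm G C x (0, r) = k)
    (heq : cov C x (cov C x (wfield G C x p) dirS) dirS (0, s)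
      = tensNorm G C x (0, s) ^ (p - 2) • K •
        (G (x (0, s)) (tens C x (0, s)) (velS x (0, s)) • velS x (0, s)
          - G (x (0, s)) (velS x (0, s)) (velS x (0, s)) • tens C x (0, s))) :
    k ^ 2 = K := by
  have hq := h.line_mem s hs
  have hk0 : 0 < k := hk s hs ▸ h.tensNorm_pos hq
  have first : ∀ r ∈ J, cov C x (wfield G C x p) dirS (0, r)
      = (-(k ^ (p - 1) * k)) • velS x (0, r) + (0 : ℝ) • nor G C x (0, r) := by
    intro r hr
    have h1 := h.cov_frame hE (f := fun _ ↦ 0) (f' := fun _ ↦ k ^ (p - 1)) contDiffOn_const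
      contDiffOn_const hr
    have h0 := h.cov_congr_line (h.smooth_wfield (p := p))
      (ζ := fun q ↦ (0 : ℝ) • velS x q + k ^ (p - 1) • nor G C x q)
      ((contDiffOn_const.smul h.smooth_velS).add (contDiffOn_const.smul h.smooth_nor))
      (fun r hr ↦ by rw [h.wfield_eq (h.line_mem r hr), hk r hr]; simp) hr
    rw [h0, h1, hk r hr]
    simp
  have second := h.cov_congr_line (h.smooth_cov h.smooth_wfield dirS)
    ((contDiffOn_const.smul h.smooth_velS).add (contDiffOn_const.smul h.smooth_nor)) first hs
  have third := h.cov_frame hE (f := fun _ ↦ -(k ^ (p - 1) * k)) (f' := fun _ ↦ 0)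
    contDiffOn_const contDiffOn_const hs
  -- the normal component of the second derivative is `-k^{p+1}`, that of the curvature term
  -- is `-K k^{p-1}`
  have e := congrArg (fun z ↦ G (x (0, s)) z (nor G C x (0, s)))
    (heq.symm.trans (second.trans third))
  simp only [map_add, map_sub, map_smul, add_apply, sub_apply, smul_apply, smul_eq_mul,
    h.inner_velS_nor hs, h.unit_speed s hs, h.tens_eq hq, h.inner_nor_nor hq, hk s hs] at e
  simp only [fderiv_fun_const, Pi.zero_apply, zero_apply, h.inner_nor_velS hs] at e
  have h6 : k ^ (p - 1) = k ^ (p - 2) * k := by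
    rw [← Real.rpow_add_one hk0.ne']
    congr 1
    ring
  rw [h6] at e
  have h9 := (Real.rpow_pos_of_pos hk0 (p - 2)).ne'
  have : k ^ (p - 2) * k * (k ^ 2 - K) = 0 := by linarith
  have h10 : k ^ 2 - K = 0 := by simpa [h9, hk0.ne'] using this
  linarith

/-- The boundary term of the second variation. -/
def bdry (G : E → E →L[ℝ] E →L[ℝ] ℝ) (C : E → E →L[ℝ] E →L[ℝ] E) (x : ℝ × ℝ → E) (p : ℝ)
    (q : ℝ × ℝ) : ℝ :=
  G (x q) (cov C x (accel C x) dirS q) (wfield G C x p q)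
    - G (x q) (accel C x q) (cov C x (wfield G C x p) dirS q)

lemma smooth_bdry (h : NormalVariation U G C O x J) : ContDiffOn ℝ ∞ (bdry G C x p) O :=
  (h.smooth_inner (h.smooth_cov h.smooth_accel _) h.smooth_wfield).sub
    (h.smooth_inner h.smooth_accel (h.smooth_cov h.smooth_wfield _))

lemma fderiv_bdry (h : NormalVariation U G C O x J) (hq : q ∈ O) :
    fderiv ℝ (bdry G C x p) q dirS
      = G (x q) (cov C x (cov C x (accel C x) dirS) dirS q) (wfield G C x p q)
        - G (x q) (accel C x q) (cov C x (cov C x (wfield G C x p) dirS) dirS q) := by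
  have sA := h.smooth_accel
  have sW := h.smooth_wfield (p := p)
  have h1 := h.fderiv_inner' (h.smooth_cov sA dirS) sW hq dirS
  have h2 := h.fderiv_inner' sA (h.smooth_cov sW dirS) hq dirS
  have h3 := fderiv_fun_sub (h.da (h.smooth_inner (h.smooth_cov sA dirS) sW) hq)
    (h.da (h.smooth_inner sA (h.smooth_cov sW dirS)) hq)
  have h4 : fderiv ℝ (bdry G C x p) q = _ := h3
  rw [h4, sub_apply, h1, h2]
  ring

/-- The second variation of the energy density, for the unit normal as variational field. -/
lemma second_variation (hE : Module.finrank ℝ E = 2) (h : NormalVariation U G C O x J)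
    (hK : ConstCurvOn U G C K) (hp : p ≠ 0) (hs : s ∈ J)
    (heq : cov C x (cov C x (wfield G C x p) dirS) dirS (0, s)
      = tensNorm G C x (0, s) ^ (p - 2) • K •
        (G (x (0, s)) (tens C x (0, s)) (velS x (0, s)) • velS x (0, s)
          - G (x (0, s)) (velS x (0, s)) (velS x (0, s)) • tens C x (0, s))) :
    1 / p * fderiv ℝ (fun q ↦ fderiv ℝ (fun q ↦ tensNorm G C x q ^ p) q dirT) (0, s) dirT
      = (p - 1) * tensNorm G C x (0, s) ^ (p + 2)
          + fderiv ℝ (tensNorm G C x) (0, s) dirS ^ 2 * tensNorm G C x (0, s) ^ (p - 2)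
          + (p - 1) * K ^ 2 * tensNorm G C x (0, s) ^ (p - 2)
          - (2 * p + 2) * K * tensNorm G C x (0, s) ^ p
          + fderiv ℝ (bdry G C x p) (0, s) dirS := by
  have hq := h.line_mem s hs
  have hk := h.tensNorm_pos hq
  have sτ := h.smooth_tens
  have sDτ : ContDiffOn ℝ ∞ (cov C x (tens C x) dirT) O := h.smooth_cov sτ _
  have first : ∀ q ∈ O, fderiv ℝ (fun q ↦ tensNorm G C x q ^ p) q dirT
      = p * (tensNorm G C x q ^ (p - 2)
        * G (x q) (cov C x (tens C x) dirT q) (tens C x q)) := by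
    intro q hq
    rw [h.fderiv_rpow hq, h.fderiv_tensNorm hq]
    have : tensNorm G C x q ^ (p - 1) = tensNorm G C x q ^ (p - 2) * tensNorm G C x q := by
      rw [← Real.rpow_add_one (h.tensNorm_pos hq).ne']
      congr 1
      ring
    rw [this]
    ring
  have sI := h.smooth_inner sDτ sτ
  have second : fderiv ℝ (fun q ↦ fderiv ℝ (fun q ↦ tensNorm G C x q ^ p) q dirT) (0, s) dirT
      = p * ((p - 2) * tensNorm G C x (0, s) ^ (p - 2 - 1)
            * fderiv ℝ (tensNorm G C x) (0, s) dirT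
            * G (x (0, s)) (cov C x (tens C x) dirT (0, s)) (tens C x (0, s))
          + tensNorm G C x (0, s) ^ (p - 2)
            * (G (x (0, s)) (cov C x (cov C x (tens C x) dirT) dirT (0, s)) (tens C x (0, s))
              + G (x (0, s)) (cov C x (tens C x) dirT (0, s))
                (cov C x (tens C x) dirT (0, s)))) := by
    have e1 : (fun q ↦ fderiv ℝ (fun q ↦ tensNorm G C x q ^ p) q dirT) =ᶠ[𝓝 (0, s)]
        fun q ↦ p * (tensNorm G C x q ^ (p - 2)
          * G (x q) (cov C x (tens C x) dirT q) (tens C x q)) := by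
      filter_upwards [h.isOpen_dom.mem_nhds hq] using first
    rw [e1.fderiv_eq, fderiv_const_mul (h.da ((h.smooth_rpow _).mul sI) hq), smul_apply,
      fderiv_fun_mul (h.da (h.smooth_rpow _) hq) (h.da sI hq), add_apply, smul_apply, smul_apply,
      h.fderiv_rpow hq, h.fderiv_inner' sDτ sτ hq]
    simp only [smul_eq_mul]
    ring
  -- the derivatives of the variational field in the Frenet frame
  have vT : ∀ r ∈ J, velT x (0, r) = nor G C x (0, r) := h.velT_eq
  have dvT : ∀ r ∈ J, cov C x (velT x) dirS (0, r)
      = (-tensNorm G C x (0, r)) • velS x (0, r) + (0 : ℝ) • nor G C x (0, r) := by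
    intro r hr
    rw [h.cov_congr_line h.smooth_velT h.smooth_nor vT hr, h.cov_nor_line hE hr]
    simp
  have ddvT : cov C x (cov C x (velT x) dirS) dirS (0, s)
      = (-fderiv ℝ (tensNorm G C x) (0, s) dirS) • velS x (0, s)
        + (-tensNorm G C x (0, s) ^ 2) • nor G C x (0, s) := by
    rw [h.cov_congr_line (h.smooth_cov h.smooth_velT dirS)
      ((h.smooth_tensNorm.neg.smul h.smooth_velS).add (contDiffOn_const.smul h.smooth_nor))
      dvT hs]
    refine (h.cov_frame hE h.smooth_tensNorm.neg contDiffOn_const hs).trans ?_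
    rw [fderiv_fun_neg]
    simp [sq]
  have iNN := h.inner_nor_nor hq
  have iNT := h.inner_nor_velS hs
  have iTN := h.inner_velS_nor hs
  have iTT := h.unit_speed s hs
  have Dτ : cov C x (tens C x) dirT (0, s)
      = (-fderiv ℝ (tensNorm G C x) (0, s) dirS) • velS x (0, s)
        + (K - tensNorm G C x (0, s) ^ 2) • nor G C x (0, s) := by
    rw [h.cov_tens hK hq, ddvT, vT s hs, iTT, iNT]
    module
  have DDτ := h.cov_cov_tens hK hq
  rw [vT s hs, dvT s hs] at DDτ
  have hb := h.fderiv_bdry (p := p) hq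
  rw [heq, wfield] at hb
  have hkt := h.fderiv_tensNorm hq dirT
  set k := tensNorm G C x (0, s) with hkdef
  set k' := fderiv ℝ (tensNorm G C x) (0, s) dirS with hk'def
  set A := accel C x (0, s) with hA
  have iAτ : G (x (0, s)) A (tens C x (0, s)) = k * G (x (0, s)) A (nor G C x (0, s)) := by
    rw [h.tens_eq hq]; simp [hkdef]
  rw [Dτ] at hkt second
  rw [DDτ] at second
  simp only [h.tens_eq hq, ← hkdef, map_add, map_sub, map_smul, add_apply, sub_apply, smul_apply,
    smul_eq_mul, iNN, iNT, iTN, iTT] at second hkt hb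
  -- the first variation of the curvature
  have hkt' : fderiv ℝ (tensNorm G C x) (0, s) dirT = K - k ^ 2 := by
    have : k * (fderiv ℝ (tensNorm G C x) (0, s) dirT - (K - k ^ 2)) = 0 := by linarith
    have h2 : fderiv ℝ (tensNorm G C x) (0, s) dirT - (K - k ^ 2) = 0 := by
      simpa [hk.ne'] using this
    linarith
  have p1 : k ^ (p - 2) = k ^ (p - 2 - 1) * k := by
    rw [← Real.rpow_add_one hk.ne', sub_add_cancel]
  have p2 : k ^ p = k ^ (p - 2 - 1) * k ^ 3 := by
    rw [← Real.rpow_add_natCast hk.ne']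
    congr 1
    push_cast
    ring
  have p3 : k ^ (p + 2) = k ^ (p - 2 - 1) * k ^ 5 := by
    rw [← Real.rpow_add_natCast hk.ne']
    congr 1
    push_cast
    ring
  rw [second, hb, hkt', p1, p2, p3]
  field_simp
  ring

end NormalVariation
end Frenet

/-! ### The Levi-Civita connection in a chart -/

section Charts

set_option linter.unusedSectionVars false

variable {M : Type*} [TopologicalSpace M] [ChartedSpace Plane M] [IsManifold (𝓡 2) ∞ M]

/-- Tangent spaces and derivatives only need the underlying `C¹` structure. -/
instance isManifold_one_of_smooth : IsManifold (𝓡 2) 1 M := .of_le (n := ∞) (by simp)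

/-- The chart at `x₀`, with values in the model plane. -/
abbrev chartMap (x₀ : M) : PartialEquiv M Plane := extChartAt (𝓡 2) x₀

lemma isInvertible_chart {x₀ y : M} (hy : y ∈ (chartMap x₀).source) :
    (mfderiv (𝓡 2) 𝓘(ℝ, Plane) (chartMap x₀) y).IsInvertible :=
  isInvertible_mfderiv_extChartAt hy

lemma coords_ofCoords {x₀ y : M} (hy : y ∈ (chartMap x₀).source) (w : Plane) :
    coords x₀ y (ofCoords x₀ y w) = w := by
  obtain ⟨e, he⟩ := isInvertible_chart hy
  unfold coords ofCoords
  rw [← he, ContinuousLinearMap.inverse_equiv]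
  exact e.apply_symm_apply w

lemma ofCoords_coords {x₀ y : M} (hy : y ∈ (chartMap x₀).source) (v : TangentSpace (𝓡 2) y) :
    ofCoords x₀ y (coords x₀ y v) = v := by
  obtain ⟨e, he⟩ := isInvertible_chart hy
  unfold coords ofCoords
  rw [← he, ContinuousLinearMap.inverse_equiv]
  exact e.symm_apply_apply v

lemma coords_sub {x₀ y : M} (v w : TangentSpace (𝓡 2) y) :
    coords x₀ y (v - w) = coords x₀ y v - coords x₀ y w :=
  map_sub (mfderiv (𝓡 2) 𝓘(ℝ, Plane) (chartMap x₀) y) v w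

lemma coords_smul {x₀ y : M} (c : ℝ) (v : TangentSpace (𝓡 2) y) :
    coords x₀ y (c • v) = c • coords x₀ y v :=
  map_smul (mfderiv (𝓡 2) 𝓘(ℝ, Plane) (chartMap x₀) y) c v

lemma ofCoords_add {x₀ y : M} (v w : Plane) :
    ofCoords x₀ y (v + w) = ofCoords x₀ y v + ofCoords x₀ y w :=
  map_add (mfderiv (𝓡 2) 𝓘(ℝ, Plane) (chartMap x₀) y).inverse v w

lemma ofCoords_smul {x₀ y : M} (c : ℝ) (v : Plane) :
    ofCoords x₀ y (c • v) = c • ofCoords x₀ y v :=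
  map_smul (mfderiv (𝓡 2) 𝓘(ℝ, Plane) (chartMap x₀) y).inverse c v

lemma coords_zero {x₀ y : M} : coords x₀ y 0 = 0 :=
  map_zero (mfderiv (𝓡 2) 𝓘(ℝ, Plane) (chartMap x₀) y)

lemma coords_inj {x₀ y : M} (hy : y ∈ (chartMap x₀).source) {v w : TangentSpace (𝓡 2) y}
    (h : coords x₀ y v = coords x₀ y w) : v = w := by
  rw [← ofCoords_coords hy v, h, ofCoords_coords hy]

lemma sum_stdVec (v : Plane) : v = ∑ i, v i • stdVec i := by
  ext j
  fin_cases j <;> simp [stdVec, Fin.sum_univ_two]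

/-- The chart representation of the metric, as a bilinear form. -/
def metricMap (g : SmoothMetric M) (x₀ : M) (u : Plane) : Plane →L[ℝ] Plane →L[ℝ] ℝ :=
  ∑ i, ∑ j, metricCoeff g x₀ u i j •
    (EuclideanSpace.proj i : Plane →L[ℝ] ℝ).smulRight (EuclideanSpace.proj j : Plane →L[ℝ] ℝ)

/-- The chart representation of the Levi-Civita connection, as a bilinear map. -/
def christoffelMap (g : SmoothMetric M) (x₀ : M) (u : Plane) : Plane →L[ℝ] Plane →L[ℝ] Plane :=
  ∑ k, ∑ i, ∑ j, christoffel g x₀ k i j u •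
    (EuclideanSpace.proj i : Plane →L[ℝ] ℝ).smulRight
      ((EuclideanSpace.proj j : Plane →L[ℝ] ℝ).smulRight (stdVec k))

variable (g : SmoothMetric M)

lemma metricMap_apply (x₀ : M) (u v w : Plane) :
    metricMap g x₀ u v w = ∑ i, ∑ j, metricCoeff g x₀ u i j * (v i * w j) := by
  simp [metricMap]

lemma christoffelMap_apply (x₀ : M) (u v w : Plane) (k : Fin 2) :
    christoffelMap g x₀ u v w k = ∑ i, ∑ j, christoffel g x₀ k i j u * v i * w j := by
  fin_cases k <;> simp [christoffelMap, Fin.sum_univ_two, stdVec] <;> ring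

lemma metricMap_eq_inner (x₀ : M) (u v w : Plane) :
    metricMap g x₀ u v w = g.inner ((chartMap x₀).symm u)
      (ofCoords x₀ ((chartMap x₀).symm u) v) (ofCoords x₀ ((chartMap x₀).symm u) w) := by
  rw [metricMap_apply]
  conv_rhs => rw [sum_stdVec v, sum_stdVec w]
  simp only [Fin.sum_univ_two, ofCoords_add, ofCoords_smul, map_add, map_smul, add_apply,
    smul_apply, smul_eq_mul]
  simp only [metricCoeff, Matrix.of_apply]
  ring

lemma inner_eq_metricMap {x₀ y : M} (hy : y ∈ (chartMap x₀).source)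
    (v w : TangentSpace (𝓡 2) y) :
    g.inner y v w = metricMap g x₀ (chartMap x₀ y) (coords x₀ y v) (coords x₀ y w) := by
  rw [metricMap_eq_inner, (chartMap x₀).left_inv hy, ofCoords_coords hy, ofCoords_coords hy]

lemma ofCoords_eq_symmL {x₀ y : M} (hy : y ∈ (chartMap x₀).source) (w : Plane) :
    ofCoords x₀ y w = (trivializationAt Plane (TangentSpace (𝓡 2)) x₀).symmL ℝ y w := by
  have hy' : y ∈ (chartAt Plane x₀).source := by simpa using hy
  have hb : y ∈ (trivializationAt Plane (TangentSpace (𝓡 2)) x₀).baseSet := by simpa using hy'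
  apply coords_inj hy
  rw [coords_ofCoords hy]
  have h1 := (trivializationAt Plane (TangentSpace (𝓡 2)) x₀).continuousLinearMapAt_symmL
    (R := ℝ) hb w
  rw [TangentBundle.continuousLinearMapAt_trivializationAt hy'] at h1
  exact h1.symm

lemma isOpen_chart_target (x₀ : M) : IsOpen (chartMap x₀).target := isOpen_extChartAt_target x₀

lemma contDiffOn_metricCoeff (x₀ : M) (i j : Fin 2) :
    ContDiffOn ℝ ∞ (fun u ↦ metricCoeff g x₀ u i j) (chartMap x₀).target := by
  rw [← contMDiffOn_iff_contDiffOn]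
  have hsec : ∀ w : Plane, ContMDiffOn 𝓘(ℝ, Plane) ((𝓡 2).prod 𝓘(ℝ, Plane)) ∞
      (fun u : Plane ↦ Bundle.TotalSpace.mk' Plane (E := fun x : M ↦ TangentSpace (𝓡 2) x)
        ((chartMap x₀).symm u)
        ((trivializationAt Plane (TangentSpace (𝓡 2)) x₀).symmL ℝ ((chartMap x₀).symm u) w))
      (chartMap x₀).target := by
    intro w u hu
    set e := trivializationAt Plane (TangentSpace (𝓡 2) (M := M)) x₀ with he
    have hb : ∀ v ∈ (chartMap x₀).target, (chartMap x₀).symm v ∈ e.baseSet := fun v hv ↦ by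
      have := (chartMap x₀).map_target hv
      simpa [he] using this
    have h1 : ContMDiffWithinAt 𝓘(ℝ, Plane) ((𝓡 2).prod 𝓘(ℝ, Plane)) ∞
        (fun u : Plane ↦ ((chartMap x₀).symm u, w)) (chartMap x₀).target u :=
      (contMDiffOn_extChartAt_symm (n := ∞) x₀ u hu).prodMk contMDiffWithinAt_const
    have h2 := (e.contMDiffOn_symm (IB := 𝓡 2) (n := ∞)).contMDiffAt
      (x := ((chartMap x₀).symm u, w)) (e.open_target.mem_nhds (e.mem_target.2 (hb u hu)))
    refine (h2.comp_contMDiffWithinAt u h1).congr_of_mem (fun v hv ↦ ?_) hu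
    rw [e.symmL_apply (hb v hv)]
    exact e.mk_symm (hb v hv) w
  intro u hu
  have hu' : (chartMap x₀).symm u ∈ (chartMap x₀).source := (chartMap x₀).map_target hu
  have hg : ContMDiffWithinAt 𝓘(ℝ, Plane) ((𝓡 2).prod 𝓘(ℝ, Plane →L[ℝ] Plane →L[ℝ] ℝ)) ∞
      (fun u : Plane ↦ Bundle.TotalSpace.mk' (Plane →L[ℝ] Plane →L[ℝ] ℝ)
        (E := fun x : M ↦ TangentSpace (𝓡 2) x →L[ℝ] TangentSpace (𝓡 2) x →L[ℝ] ℝ)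
        ((chartMap x₀).symm u) (g.inner ((chartMap x₀).symm u))) (chartMap x₀).target u :=
    g.contMDiff.contMDiffAt.comp_contMDiffWithinAt u
      (contMDiffOn_extChartAt_symm (n := ∞) x₀ u hu)
  have h := ContMDiffWithinAt.clm_bundle_apply₂ (F₁ := Plane) (F₂ := Plane) (F₃ := ℝ)
    (E₃ := Bundle.Trivial M ℝ) hg (hsec (stdVec i) u hu) (hsec (stdVec j) u hu)
  rw [Bundle.contMDiffWithinAt_totalSpace] at h
  refine h.2.congr_of_mem (fun v hv ↦ ?_) hu
  have hv' := (chartMap x₀).map_target hv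
  simp only [metricCoeff, Matrix.of_apply, ofCoords_eq_symmL hv']
  rfl

lemma contDiffOn_smul_const {F : Type*} [NormedAddCommGroup F] [NormedSpace ℝ F] {O : Set Plane}
    {f : Plane → ℝ} (hf : ContDiffOn ℝ ∞ f O) (c : F) : ContDiffOn ℝ ∞ (fun u ↦ f u • c) O :=
  hf.smul contDiffOn_const

lemma contDiffOn_metricMap (x₀ : M) : ContDiffOn ℝ ∞ (metricMap g x₀) (chartMap x₀).target :=
  ContDiffOn.sum fun i _ ↦ ContDiffOn.sum fun j _ ↦
    contDiffOn_smul_const (contDiffOn_metricCoeff g x₀ i j) _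

lemma metricMap_symm (x₀ : M) (u v w : Plane) : metricMap g x₀ u v w = metricMap g x₀ u w v := by
  rw [metricMap_eq_inner, metricMap_eq_inner, g.symm]

lemma metricMap_pos {x₀ : M} {u : Plane} (hu : u ∈ (chartMap x₀).target) {v : Plane}
    (hv : v ≠ 0) : 0 < metricMap g x₀ u v v := by
  rw [metricMap_eq_inner]
  refine g.pos _ _ fun h ↦ hv ?_
  rw [← coords_ofCoords ((chartMap x₀).map_target hu) v, h, coords_zero]

lemma metricCoeff_symm (x₀ : M) (u : Plane) (i j : Fin 2) :
    metricCoeff g x₀ u i j = metricCoeff g x₀ u j i := by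
  simp only [metricCoeff, Matrix.of_apply]
  rw [g.symm]

lemma det_metricCoeff_ne_zero {x₀ : M} {u : Plane} (hu : u ∈ (chartMap x₀).target) :
    (metricCoeff g x₀ u).det ≠ 0 := by
  have h1 := metricMap_pos g hu (v := !₂[1, 0]) (fun h ↦ by simpa using congrArg (· 0) h)
  simp only [metricMap_apply, Fin.sum_univ_two] at h1
  simp at h1
  have h2 := metricMap_pos g hu (v := !₂[-metricCoeff g x₀ u 0 1, metricCoeff g x₀ u 0 0])
    (fun h ↦ h1.ne' (by simpa using congrArg (· 1) h))
  simp only [metricMap_apply, Fin.sum_univ_two] at h2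
  simp at h2
  rw [Matrix.det_fin_two]
  intro h
  rw [metricCoeff_symm g x₀ u 1 0] at h h2
  nlinarith

lemma contDiffOn_partialDeriv {O : Set Plane} (hO : IsOpen O) {f : Plane → ℝ}
    (hf : ContDiffOn ℝ ∞ f O) (i : Fin 2) : ContDiffOn ℝ ∞ (partialDeriv i f) O :=
  contDiffOn_fderiv_apply hO hf _

lemma contDiffOn_metricCoeff_inv (x₀ : M) (i j : Fin 2) :
    ContDiffOn ℝ ∞ (fun u ↦ (metricCoeff g x₀ u)⁻¹ i j) (chartMap x₀).target := by
  have hc := contDiffOn_metricCoeff g x₀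
  have hdet : ContDiffOn ℝ ∞ (fun u ↦ ((metricCoeff g x₀ u).det)⁻¹) (chartMap x₀).target := by
    refine ContDiffOn.inv ?_ fun u hu ↦ det_metricCoeff_ne_zero g hu
    simp only [Matrix.det_fin_two]
    exact ((hc 0 0).mul (hc 1 1)).sub ((hc 0 1).mul (hc 1 0))
  have hadj : ContDiffOn ℝ ∞ (fun u ↦ (metricCoeff g x₀ u).adjugate i j)
      (chartMap x₀).target := by
    simp only [Matrix.adjugate_fin_two]
    fin_cases i <;> fin_cases j
    · exact hc 1 1
    · exact (hc 0 1).neg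
    · exact (hc 1 0).neg
    · exact hc 0 0
  simp only [Matrix.inv_def, Ring.inverse_eq_inv', Matrix.smul_apply, smul_eq_mul]
  exact hdet.mul hadj

lemma contDiffOn_christoffel (x₀ : M) (k i j : Fin 2) :
    ContDiffOn ℝ ∞ (christoffel g x₀ k i j) (chartMap x₀).target := by
  have hp : ∀ l m n, ContDiffOn ℝ ∞ (partialDeriv l fun w ↦ metricCoeff g x₀ w m n)
      (chartMap x₀).target := fun l m n ↦
    contDiffOn_partialDeriv (isOpen_chart_target x₀) (contDiffOn_metricCoeff g x₀ m n) l
  exact contDiffOn_const.mul (ContDiffOn.sum fun l _ ↦ (contDiffOn_metricCoeff_inv g x₀ k l).mul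
    (((hp i j l).add (hp j i l)).sub (hp l i j)))

lemma contDiffOn_christoffelMap (x₀ : M) :
    ContDiffOn ℝ ∞ (christoffelMap g x₀) (chartMap x₀).target :=
  ContDiffOn.sum fun k _ ↦ ContDiffOn.sum fun i _ ↦ ContDiffOn.sum fun j _ ↦
    contDiffOn_smul_const (contDiffOn_christoffel g x₀ k i j) _

lemma christoffel_symm (x₀ : M) (k i j : Fin 2) (u : Plane) :
    christoffel g x₀ k i j u = christoffel g x₀ k j i u := by
  simp only [christoffel]
  congr 2
  ext l
  rw [show (fun w ↦ metricCoeff g x₀ w i j) = fun w ↦ metricCoeff g x₀ w j i from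
    funext fun w ↦ metricCoeff_symm g x₀ w i j]
  ring

/-- Lowering the upper index of the Christoffel symbols. -/
lemma sum_metricCoeff_mul_christoffel {x₀ : M} {u : Plane} (hu : u ∈ (chartMap x₀).target)
    (l i j : Fin 2) :
    ∑ m, metricCoeff g x₀ u l m * christoffel g x₀ m i j u
      = (1 / 2 : ℝ) * (partialDeriv i (fun w ↦ metricCoeff g x₀ w j l) u
      + partialDeriv j (fun w ↦ metricCoeff g x₀ w i l) u
      - partialDeriv l (fun w ↦ metricCoeff g x₀ w i j) u) := by
  set b : Fin 2 → ℝ := fun l ↦ partialDeriv i (fun w ↦ metricCoeff g x₀ w j l) u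
      + partialDeriv j (fun w ↦ metricCoeff g x₀ w i l) u
      - partialDeriv l (fun w ↦ metricCoeff g x₀ w i j) u with hb
  have h1 : (metricCoeff g x₀ u).mulVec ((metricCoeff g x₀ u)⁻¹.mulVec b) = b := by
    rw [Matrix.mulVec_mulVec, Matrix.mul_nonsing_inv _
      (isUnit_iff_ne_zero.2 (det_metricCoeff_ne_zero g hu)), Matrix.one_mulVec]
  have h2 := congrFun h1 l
  simp only [Matrix.mulVec, dotProduct] at h2
  change _ = (1 / 2 : ℝ) * b l
  rw [← h2, Finset.mul_sum]
  refine Finset.sum_congr rfl fun m _ ↦ ?_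
  simp only [christoffel, hb]
  ring

lemma fderiv_apply_eq_sum (f : Plane → ℝ) (u X : Plane) :
    fderiv ℝ f u X = ∑ i, X i * partialDeriv i f u := by
  conv_lhs => rw [sum_stdVec X]
  simp [partialDeriv, Fin.sum_univ_two]

lemma fderiv_metricMap {x₀ : M} {u : Plane} (hu : u ∈ (chartMap x₀).target) (X Y Z : Plane) :
    fderiv ℝ (metricMap g x₀) u X Y Z = ∑ k, ∑ i, ∑ j,
      partialDeriv k (fun w ↦ metricCoeff g x₀ w i j) u * (X k * Y i * Z j) := by
  have hd : DifferentiableAt ℝ (metricMap g x₀) u :=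
    differentiableAt_of_contDiffOn (isOpen_chart_target x₀) (contDiffOn_metricMap g x₀) hu
  have hdc : ∀ i j, DifferentiableAt ℝ (fun w ↦ metricCoeff g x₀ w i j) u := fun i j ↦
    differentiableAt_of_contDiffOn (isOpen_chart_target x₀) (contDiffOn_metricCoeff g x₀ i j) hu
  have h1 := ((hd.hasFDerivAt.clm_apply (hasFDerivAt_const Y u)).clm_apply
    (hasFDerivAt_const Z u)).fderiv
  have h2 : fderiv ℝ (fun w ↦ metricMap g x₀ w Y Z) u X
      = fderiv ℝ (metricMap g x₀) u X Y Z := by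
    rw [h1]; simp
  rw [← h2, fderiv_apply_eq_sum]
  refine Finset.sum_congr rfl fun k _ ↦ ?_
  simp only [partialDeriv, metricMap_apply, Fin.sum_univ_two]
  have h3 : HasFDerivAt (fun w ↦ metricCoeff g x₀ w 0 0 * (Y 0 * Z 0)
      + metricCoeff g x₀ w 0 1 * (Y 0 * Z 1) + (metricCoeff g x₀ w 1 0 * (Y 1 * Z 0)
      + metricCoeff g x₀ w 1 1 * (Y 1 * Z 1))) _ u :=
    (((hdc 0 0).hasFDerivAt.mul_const _).add ((hdc 0 1).hasFDerivAt.mul_const _)).add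
    (((hdc 1 0).hasFDerivAt.mul_const _).add ((hdc 1 1).hasFDerivAt.mul_const _))
  rw [h3.fderiv]
  simp
  ring

lemma metricMap_christoffelMap {x₀ : M} {u : Plane} (hu : u ∈ (chartMap x₀).target)
    (X Y Z : Plane) :
    metricMap g x₀ u Z (christoffelMap g x₀ u X Y) = ∑ l, ∑ i, ∑ j,
      (1 / 2 : ℝ) * (partialDeriv i (fun w ↦ metricCoeff g x₀ w j l) u
      + partialDeriv j (fun w ↦ metricCoeff g x₀ w i l) u
      - partialDeriv l (fun w ↦ metricCoeff g x₀ w i j) u) * (Z l * X i * Y j) := by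
  simp only [← sum_metricCoeff_mul_christoffel g hu, metricMap_apply, christoffelMap_apply,
    Fin.sum_univ_two]
  ring

/-- The metric and the Christoffel symbols of a chart form a metric with its Levi-Civita
connection. -/
lemma leviCivitaOn_chart (x₀ : M) :
    LeviCivitaOn (chartMap x₀).target (metricMap g x₀) (christoffelMap g x₀) where
  isOpen := isOpen_chart_target x₀
  contDiffOn_metric := contDiffOn_metricMap g x₀
  contDiffOn_christoffel := contDiffOn_christoffelMap g x₀
  metric_symm u _ := metricMap_symm g x₀ u
  metric_pos _ hu _ := metricMap_pos g hu
  christoffel_symm u _ X Y := by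
    ext k
    simp only [christoffelMap_apply, Fin.sum_univ_two, christoffel_symm g x₀ k 1 0 u]
    ring
  compat u hu X Y Z := by
    rw [metricMap_symm, metricMap_christoffelMap g hu, metricMap_christoffelMap g hu,
      fderiv_metricMap g hu]
    have hs : ∀ i j, (fun w ↦ metricCoeff g x₀ w i j) = fun w ↦ metricCoeff g x₀ w j i :=
      fun i j ↦ funext fun w ↦ metricCoeff_symm g x₀ w i j
    simp only [Fin.sum_univ_two, hs 1 0]
    ring
end Charts

/-! ### Invariance of the curvature under isometries -/

section Transform

variable {E F P : Type*} [NormedAddCommGroup E] [NormedSpace ℝ E] [NormedAddCommGroup F]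
  [NormedSpace ℝ F] [NormedAddCommGroup P] [NormedSpace ℝ P]
  {U : Set E} {G : E → E →L[ℝ] E →L[ℝ] ℝ} {C : E → E →L[ℝ] E →L[ℝ] E}
  {U' : Set F} {G' : F → F →L[ℝ] F →L[ℝ] ℝ} {C' : F → F →L[ℝ] F →L[ℝ] F}

/-- The curvature is tensorial under isometries: both sides are commutators of covariant
derivatives along a parametrized plane. -/
lemma LeviCivitaOn.curv_transform
    (h : LeviCivitaOn U G C) (h' : LeviCivitaOn U' G' C') {V : Set E} (hV : IsOpen V) (hVU : V ⊆ U)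
    {ψ : E → F} (hψ : ContDiffOn ℝ ∞ ψ V) (hmap : MapsTo ψ V U')
    (hiso : ∀ u ∈ V, ∀ X Y, G u X Y = G' (ψ u) (fderiv ℝ ψ u X) (fderiv ℝ ψ u Y))
    (hsurj : ∀ u ∈ V, Function.Surjective (fderiv ℝ ψ u)) {u : E} (hu : u ∈ V) (X Y Z : E) :
    fderiv ℝ ψ u (curv C u X Y Z)
      = curv C' (ψ u) (fderiv ℝ ψ u X) (fderiv ℝ ψ u Y) (fderiv ℝ ψ u Z) := by
  set x : ℝ × ℝ → E := fun q ↦ u + q.1 • X + q.2 • Y with hx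
  set O : Set (ℝ × ℝ) := x ⁻¹' V with hO
  have sx' : ContDiff ℝ ∞ x := by fun_prop
  have sx : ContDiffOn ℝ ∞ x O := sx'.contDiffOn
  have hOo : IsOpen O := hV.preimage sx'.continuous
  have hxV : MapsTo x O V := fun _ hq ↦ hq
  have hxU : MapsTo x O U := hxV.mono_right hVU
  have x0 : x 0 = u := by simp [hx]
  have h0 : (0 : ℝ × ℝ) ∈ O := by rw [hO, mem_preimage, x0]; exact hu
  have dψ : ContDiffOn ℝ ∞ (fderiv ℝ ψ) V := hψ.fderiv_of_isOpen hV (by simp)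
  have tr : ∀ {ξ : ℝ × ℝ → E}, ContDiffOn ℝ ∞ ξ O → ∀ v, ∀ q ∈ O,
      cov C' (fun q ↦ ψ (x q)) (fun q ↦ fderiv ℝ ψ (x q) (ξ q)) v q
        = fderiv ℝ ψ (x q) (cov C x ξ v q) := fun hξ v q hq ↦
    cov_transform (differentiableAt_of_contDiffOn hV hψ (hxV hq))
      (differentiableAt_of_contDiffOn hV dψ (hxV hq))
      (h.christoffel_transform h' hV hVU hψ hmap hiso (hxV hq) (hsurj _ (hxV hq)))
      (differentiableAt_of_contDiffOn hOo sx hq) (differentiableAt_of_contDiffOn hOo hξ hq) v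
  have tr2 : ∀ v w, cov C' (fun q ↦ ψ (x q))
      (cov C' (fun q ↦ ψ (x q)) (fun q ↦ fderiv ℝ ψ (x q) Z) v) w 0
      = fderiv ℝ ψ (x 0) (cov C x (cov C x (fun _ ↦ Z) v) w 0) := by
    intro v w
    rw [← tr (h.contDiffOn_cov hOo sx hxU contDiffOn_const v) w 0 h0]
    refine cov_congr ?_ w
    filter_upwards [hOo.mem_nhds h0] with q hq using tr contDiffOn_const v q hq
  have c1 := h.cov_cov_sub hOo h0 sx hxU (ξ := fun _ ↦ Z) contDiffOn_const (1, 0) (0, 1)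
  have c2 := h'.cov_cov_sub hOo h0 (hψ.comp sx hxV) (hmap.comp hxV)
    (dψ.comp sx hxV |>.clm_apply (contDiffOn_const (c := Z))) (1, 0) (0, 1)
  have c3 : ∀ v : ℝ × ℝ, fderiv ℝ x 0 v = v.1 • X + v.2 • Y := by
    intro v
    have h1 : HasFDerivAt x (((ContinuousLinearMap.fst ℝ ℝ ℝ).smulRight X)
        + (ContinuousLinearMap.snd ℝ ℝ ℝ).smulRight Y) 0 :=
      (hasFDerivAt_const_add_iff u).2 ((ContinuousLinearMap.fst ℝ ℝ ℝ).smulRight X).hasFDerivAt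
        |>.add ((ContinuousLinearMap.snd ℝ ℝ ℝ).smulRight Y).hasFDerivAt
    rw [h1.fderiv]
    simp
  have c4 : ∀ v : ℝ × ℝ, fderiv ℝ (ψ ∘ x) 0 v = fderiv ℝ ψ (x 0) (fderiv ℝ x 0 v) := by
    intro v
    rw [fderiv_comp _ (differentiableAt_of_contDiffOn hV hψ (hxV h0))
      (differentiableAt_of_contDiffOn hOo sx h0)]
    rfl
  simp only [c4] at c2
  simp only [c3, x0] at c1 c2
  have e1 : ∀ v w, cov C' (ψ ∘ x) (cov C' (ψ ∘ x)
      (fun q ↦ (fderiv ℝ ψ ∘ x) q Z) v) w 0 = _ := fun v w ↦ tr2 v w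
  rw [e1, e1, ← map_sub, c1] at c2
  simpa [x0] using c2

lemma cov_congr_map {C : E → E →L[ℝ] E →L[ℝ] E} {x x' ξ ξ' : P → E} {q : P} (hx : x =ᶠ[𝓝 q] x')
    (h : ξ =ᶠ[𝓝 q] ξ') (v : P) : cov C x ξ v q = cov C x' ξ' v q := by
  simp only [cov, h.fderiv_eq, h.eq_of_nhds, hx.fderiv_eq, hx.eq_of_nhds]

end Transform

/-! ### Change of charts -/

section ChartChange

set_option linter.unusedSectionVars false

variable {M : Type*} [TopologicalSpace M] [ChartedSpace Plane M] [IsManifold (𝓡 2) ∞ M]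
  (g : SmoothMetric M)

/-- The transition map from the chart at `y` to the chart at `x₀`. -/
def transition (y x₀ : M) (u : Plane) : Plane := chartMap x₀ ((chartMap y).symm u)

/-- The domain of the transition map from the chart at `y` to the chart at `x₀`. -/
def transitionDom (y x₀ : M) : Set Plane :=
  (chartMap y).target ∩ (chartMap y).symm ⁻¹' (chartMap x₀).source

lemma isOpen_transitionDom (y x₀ : M) : IsOpen (transitionDom y x₀) :=
  (continuousOn_extChartAt_symm y).isOpen_inter_preimage (isOpen_chart_target y)
    (isOpen_extChartAt_source x₀)

lemma mem_transitionDom {x₀ y z : M} (hy : z ∈ (chartMap y).source)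
    (hx : z ∈ (chartMap x₀).source) : chartMap y z ∈ transitionDom y x₀ :=
  ⟨(chartMap y).map_source hy, by rwa [mem_preimage, (chartMap y).left_inv hy]⟩

lemma mapsTo_transition (y x₀ : M) :
    MapsTo (transition y x₀) (transitionDom y x₀) (chartMap x₀).target :=
  fun _ hu ↦ (chartMap x₀).map_source hu.2

lemma contDiffOn_transition (y x₀ : M) :
    ContDiffOn ℝ ∞ (transition y x₀) (transitionDom y x₀) := by
  rw [← contMDiffOn_iff_contDiffOn]
  refine (contMDiffOn_extChartAt (I := 𝓡 2) (n := ∞) (x := x₀)).comp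
    ((contMDiffOn_extChartAt_symm (n := ∞) y).mono inter_subset_left) fun u hu ↦ ?_
  simpa using hu.2

lemma eventually_transition {x₀ y z : M} (hy : z ∈ (chartMap y).source) :
    chartMap x₀ =ᶠ[𝓝 z] transition y x₀ ∘ chartMap y := by
  filter_upwards [(isOpen_extChartAt_source (I := 𝓡 2) y).mem_nhds hy] with w hw
  simp only [transition, Function.comp, (chartMap y).left_inv hw]

lemma mdifferentiableAt_chart {x₀ z : M} (hx : z ∈ (chartMap x₀).source) :
    MDifferentiableAt (𝓡 2) 𝓘(ℝ, Plane) (chartMap x₀) z :=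
  mdifferentiableAt_extChartAt (by simpa using hx)

/-- The derivative of a transition map changes the coordinates of tangent vectors. -/
lemma fderiv_transition_coords {x₀ y z : M} (hy : z ∈ (chartMap y).source)
    (hx : z ∈ (chartMap x₀).source) (v : TangentSpace (𝓡 2) z) :
    fderiv ℝ (transition y x₀) (chartMap y z) (coords y z v) = coords x₀ z v := by
  have hd : DifferentiableAt ℝ (transition y x₀) (chartMap y z) :=
    differentiableAt_of_contDiffOn (isOpen_transitionDom y x₀) (contDiffOn_transition y x₀)
      (mem_transitionDom hy hx)
  have h1 := ((hd.hasFDerivAt.hasMFDerivAt).comp z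
    (mdifferentiableAt_chart hy).hasMFDerivAt).congr_of_eventuallyEq
      (eventually_transition (x₀ := x₀) hy)
  unfold coords
  rw [h1.mfderiv]
  rfl

lemma surjective_fderiv_transition {x₀ y : M} {u : Plane} (hu : u ∈ transitionDom y x₀) :
    Function.Surjective (fderiv ℝ (transition y x₀) u) := by
  intro w
  have hz := (chartMap y).map_target hu.1
  have h1 := fderiv_transition_coords hz hu.2 (ofCoords x₀ ((chartMap y).symm u) w)
  rw [(chartMap y).right_inv hu.1, coords_ofCoords hu.2] at h1
  exact ⟨_, h1⟩

lemma metricMap_transition {x₀ y : M} {u : Plane} (hu : u ∈ transitionDom y x₀) (X Y : Plane) :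
    metricMap g y u X Y = metricMap g x₀ (transition y x₀ u)
      (fderiv ℝ (transition y x₀) u X) (fderiv ℝ (transition y x₀) u Y) := by
  have hz := (chartMap y).map_target hu.1
  have h1 : ∀ X, fderiv ℝ (transition y x₀) u X
      = coords x₀ ((chartMap y).symm u) (ofCoords y ((chartMap y).symm u) X) := by
    intro X
    rw [← fderiv_transition_coords hz hu.2, (chartMap y).right_inv hu.1, coords_ofCoords hz]
  rw [metricMap_eq_inner, inner_eq_metricMap g hu.2, h1, h1]
  rfl

lemma christoffelMap_transition {x₀ y : M} {u : Plane} (hu : u ∈ transitionDom y x₀)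
    (X Y : Plane) :
    fderiv ℝ (transition y x₀) u (christoffelMap g y u X Y)
      = fderiv ℝ (fderiv ℝ (transition y x₀)) u X Y
        + christoffelMap g x₀ (transition y x₀ u) (fderiv ℝ (transition y x₀) u X)
          (fderiv ℝ (transition y x₀) u Y) :=
  (leviCivitaOn_chart g y).christoffel_transform (leviCivitaOn_chart g x₀)
    (isOpen_transitionDom y x₀) inter_subset_left (contDiffOn_transition y x₀)
    (mapsTo_transition y x₀) (fun _ hu ↦ metricMap_transition g hu) hu
    (surjective_fderiv_transition hu) X Y

lemma curv_transition {x₀ y : M} {u : Plane} (hu : u ∈ transitionDom y x₀) (X Y Z : Plane) :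
    fderiv ℝ (transition y x₀) u (curv (christoffelMap g y) u X Y Z)
      = curv (christoffelMap g x₀) (transition y x₀ u) (fderiv ℝ (transition y x₀) u X)
          (fderiv ℝ (transition y x₀) u Y) (fderiv ℝ (transition y x₀) u Z) :=
  (leviCivitaOn_chart g y).curv_transform (leviCivitaOn_chart g x₀)
    (isOpen_transitionDom y x₀) inter_subset_left (contDiffOn_transition y x₀)
    (mapsTo_transition y x₀) (fun _ hu ↦ metricMap_transition g hu)
    (fun _ hu ↦ surjective_fderiv_transition hu) hu X Y Z

lemma mem_chart_self (x : M) : x ∈ (chartMap x).source := mem_extChartAt_source x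

lemma eventually_mem_chart {P : Type*} [TopologicalSpace P] {γ : P → M} {s : P} {x₀ : M}
    (hγ : ContinuousAt γ s) (hs : γ s ∈ (chartMap x₀).source) :
    ∀ᶠ r in 𝓝 s, γ r ∈ (chartMap x₀).source :=
  hγ ((isOpen_extChartAt_source (I := 𝓡 2) x₀).mem_nhds hs)

/-- The coordinates of a vector field along a map in two charts. -/
lemma eventually_coords_transition {P : Type*} [TopologicalSpace P] {γ : P → M} {s : P} {x₀ y : M}
    (hγ : ContinuousAt γ s) (hx : γ s ∈ (chartMap x₀).source) (hy : γ s ∈ (chartMap y).source)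
    (V : (s : P) → TangentSpace (𝓡 2) (γ s)) :
    (fun r ↦ coords x₀ (γ r) (V r)) =ᶠ[𝓝 s] fun r ↦
      fderiv ℝ (transition y x₀) (chartMap y (γ r)) (coords y (γ r) (V r)) := by
  filter_upwards [eventually_mem_chart hγ hx, eventually_mem_chart hγ hy] with r h1 h2
  exact (fderiv_transition_coords h2 h1 (V r)).symm

lemma differentiableAt_chart_comp {γ : ℝ → M} {s : ℝ} {x₀ : M}
    (hγ : MDifferentiableAt 𝓘(ℝ, ℝ) (𝓡 2) γ s) (hx : γ s ∈ (chartMap x₀).source) :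
    DifferentiableAt ℝ (fun r ↦ chartMap x₀ (γ r)) s :=
  ((mdifferentiableAt_chart hx).comp s hγ).differentiableAt

lemma coords_velocity {γ : ℝ → M} {s : ℝ} {x₀ : M}
    (hγ : MDifferentiableAt 𝓘(ℝ, ℝ) (𝓡 2) γ s) (hx : γ s ∈ (chartMap x₀).source) :
    coords x₀ (γ s) (velocity γ s) = deriv (fun r ↦ chartMap x₀ (γ r)) s := by
  have h1 := mfderiv_comp s (mdifferentiableAt_chart hx) hγ
  have h2 : mfderiv 𝓘(ℝ, ℝ) 𝓘(ℝ, Plane) (fun r ↦ chartMap x₀ (γ r)) s = _ := h1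
  rw [mfderiv_eq_fderiv] at h2
  rw [← fderiv_apply_one_eq_deriv, h2]
  rfl

lemma differentiableAt_coords_of_chart {γ : ℝ → M} {s : ℝ} {x₀ y : M}
    (hγ : MDifferentiableAt 𝓘(ℝ, ℝ) (𝓡 2) γ s) (hx : γ s ∈ (chartMap x₀).source)
    (hy : γ s ∈ (chartMap y).source) {V : (s : ℝ) → TangentSpace (𝓡 2) (γ s)}
    (hV : DifferentiableAt ℝ (fun r ↦ coords y (γ r) (V r)) s) :
    DifferentiableAt ℝ (fun r ↦ coords x₀ (γ r) (V r)) s := by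
  refine DifferentiableAt.congr_of_eventuallyEq ?_
    (eventually_coords_transition hγ.continuousAt hx hy V)
  have h1 : DifferentiableAt ℝ (fderiv ℝ (transition y x₀)) (chartMap y (γ s)) :=
    differentiableAt_of_contDiffOn (isOpen_transitionDom y x₀)
      ((contDiffOn_transition y x₀).fderiv_of_isOpen (isOpen_transitionDom y x₀) (by simp))
      (mem_transitionDom hy hx)
  exact (h1.comp s (differentiableAt_chart_comp hγ hy)).clm_apply hV

/-- The covariant derivative along a curve can be computed in every chart. -/
lemma coords_covDeriv {γ : ℝ → M} {s : ℝ} {x₀ : M}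
    (hγ : MDifferentiableAt 𝓘(ℝ, ℝ) (𝓡 2) γ s) (hx : γ s ∈ (chartMap x₀).source)
    {V : (s : ℝ) → TangentSpace (𝓡 2) (γ s)}
    (hV : DifferentiableAt ℝ (fun r ↦ coords x₀ (γ r) (V r)) s) :
    coords x₀ (γ s) (covDeriv g γ V s) = cov (christoffelMap g x₀) (fun r ↦ chartMap x₀ (γ r))
      (fun r ↦ coords x₀ (γ r) (V r)) 1 s := by
  set y := γ s with hy
  have hyy : γ s ∈ (chartMap y).source := mem_chart_self y
  have hVy : DifferentiableAt ℝ (fun r ↦ coords y (γ r) (V r)) s :=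
    differentiableAt_coords_of_chart hγ hyy hx hV
  have hγy := differentiableAt_chart_comp hγ hyy
  have def_eq : covDeriv g γ V s = ofCoords y y (cov (christoffelMap g y)
      (fun r ↦ chartMap y (γ r)) (fun r ↦ coords y (γ r) (V r)) 1 s) := by
    unfold covDeriv
    congr 1
    ext k
    rw [cov]
    simp only [PiLp.add_apply, christoffelMap_apply, fderiv_apply_one_eq_deriv]
    have e1 : ∀ (f : ℝ → Plane), DifferentiableAt ℝ f s → ∀ k, deriv (fun r ↦ f r k) s
        = deriv f s k := fun f hf k ↦
      ((EuclideanSpace.proj k : Plane →L[ℝ] ℝ).hasFDerivAt.comp_hasDerivAt s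
        hf.hasDerivAt).deriv
    rw [e1 _ hVy k]
    congr 1
    refine Finset.sum_congr rfl fun i _ ↦ Finset.sum_congr rfl fun j _ ↦ ?_
    rw [e1 _ hγy i]
  have hmem := mem_transitionDom hyy hx
  have hψ' : DifferentiableAt ℝ (fderiv ℝ (transition y x₀)) (chartMap y (γ s)) :=
    differentiableAt_of_contDiffOn (isOpen_transitionDom y x₀)
      ((contDiffOn_transition y x₀).fderiv_of_isOpen (isOpen_transitionDom y x₀) (by simp)) hmem
  have hψ : DifferentiableAt ℝ (transition y x₀) (chartMap y (γ s)) :=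
    differentiableAt_of_contDiffOn (isOpen_transitionDom y x₀) (contDiffOn_transition y x₀) hmem
  rw [def_eq, ← fderiv_transition_coords hyy hx, coords_ofCoords hyy,
    ← cov_transform (x := fun r ↦ chartMap y (γ r)) hψ hψ'
      (fun X Y ↦ christoffelMap_transition g hmem X Y) hγy hVy]
  refine cov_congr_map ?_ (eventually_coords_transition hγ.continuousAt hx hyy V).symm 1
  exact (hγ.continuousAt.eventually (eventually_transition (x₀ := x₀) hyy)).mono
    fun r hr ↦ hr.symm

lemma fderiv_christoffelMap_apply {x₀ : M} {u : Plane} (hu : u ∈ (chartMap x₀).target)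
    (X Y Z : Plane) (l : Fin 2) :
    fderiv ℝ (christoffelMap g x₀) u X Y Z l = ∑ k, ∑ i, ∑ j,
      partialDeriv k (christoffel g x₀ l i j) u * (X k * Y i * Z j) := by
  have hd : DifferentiableAt ℝ (christoffelMap g x₀) u :=
    (leviCivitaOn_chart g x₀).differentiableAt_christoffel hu
  have hdc : ∀ i j, DifferentiableAt ℝ (christoffel g x₀ l i j) u := fun i j ↦
    differentiableAt_of_contDiffOn (isOpen_chart_target x₀) (contDiffOn_christoffel g x₀ l i j) hu
  have h1 := (((hd.hasFDerivAt.clm_apply (hasFDerivAt_const Y u)).clm_apply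
    (hasFDerivAt_const Z u)))
  have h1' := ((EuclideanSpace.proj l : Plane →L[ℝ] ℝ).hasFDerivAt.comp u h1).fderiv
  have h2 : fderiv ℝ (fun w ↦ christoffelMap g x₀ w Y Z l) u X
      = fderiv ℝ (christoffelMap g x₀) u X Y Z l := by
    have : fderiv ℝ (fun w ↦ christoffelMap g x₀ w Y Z l) u = _ := h1'
    rw [this]; simp
  rw [← h2, fderiv_apply_eq_sum]
  refine Finset.sum_congr rfl fun k _ ↦ ?_
  simp only [partialDeriv, christoffelMap_apply, Fin.sum_univ_two]
  have h3 : HasFDerivAt (fun w ↦ christoffel g x₀ l 0 0 w * Y 0 * Z 0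
      + christoffel g x₀ l 0 1 w * Y 0 * Z 1 + (christoffel g x₀ l 1 0 w * Y 1 * Z 0
      + christoffel g x₀ l 1 1 w * Y 1 * Z 1)) _ u :=
    ((((hdc 0 0).hasFDerivAt.mul_const _).mul_const _).add
      (((hdc 0 1).hasFDerivAt.mul_const _).mul_const _)).add
    ((((hdc 1 0).hasFDerivAt.mul_const _).mul_const _).add
      (((hdc 1 1).hasFDerivAt.mul_const _).mul_const _))
  rw [h3.fderiv]
  simp
  ring

/-- The curvature tensor is that of the Christoffel symbols in the chart centred at the point. -/
lemma curvatureTensor_eq {x : M} (X Y Z : TangentSpace (𝓡 2) x) :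
    curvatureTensor g X Y Z = ofCoords x x (curv (christoffelMap g x) (chartMap x x)
      (coords x x X) (coords x x Y) (coords x x Z)) := by
  have hu : chartMap x x ∈ (chartMap x).target := mem_extChartAt_target x
  unfold curvatureTensor
  congr 1
  ext l
  simp only [curv, PiLp.add_apply, PiLp.sub_apply, fderiv_christoffelMap_apply g hu,
    christoffelMap_apply, curvatureCoeff, Fin.sum_univ_two]
  ring

/-- In every chart, the Christoffel symbols of a metric of constant curvature have constant
curvature. -/
lemma constCurvOn_chart {K : ℝ} (hK : HasConstantCurvature g K) (x₀ : M) :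
    ConstCurvOn (chartMap x₀).target (metricMap g x₀) (christoffelMap g x₀) K := by
  have center : ∀ (z : M) (X Y Z : Plane), curv (christoffelMap g z) (chartMap z z) X Y Z
      = K • (metricMap g z (chartMap z z) Y Z • X - metricMap g z (chartMap z z) X Z • Y) := by
    intro z
    have hz := mem_chart_self z
    refine (leviCivitaOn_chart g z).curv_eq_of_sectional (by simp) ((chartMap z).map_source hz)
      fun X Y ↦ ?_
    have h1 := hK z (ofCoords z z X) (ofCoords z z Y)
    rw [curvatureTensor_eq] at h1
    simpa only [inner_eq_metricMap g hz, coords_ofCoords hz] using h1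
  intro u hu X Y Z
  set z := (chartMap x₀).symm u with hz
  have hzx : z ∈ (chartMap x₀).source := (chartMap x₀).map_target hu
  have hmem := mem_transitionDom (mem_chart_self z) hzx
  have hval : transition z x₀ (chartMap z z) = u := by
    rw [transition, (chartMap z).left_inv (mem_chart_self z), hz, (chartMap x₀).right_inv hu]
  obtain ⟨X, rfl⟩ := surjective_fderiv_transition hmem X
  obtain ⟨Y, rfl⟩ := surjective_fderiv_transition hmem Y
  obtain ⟨Z, rfl⟩ := surjective_fderiv_transition hmem Z
  rw [← hval, ← curv_transition g hmem, center, ← metricMap_transition g hmem,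
    ← metricMap_transition g hmem]
  simp only [map_smul, map_sub]

end ChartChange

/-! ### Families of curves on the surface -/

section TwoParameter

set_option linter.unusedSectionVars false

variable {M : Type*} [TopologicalSpace M] [ChartedSpace Plane M] [IsManifold (𝓡 2) ∞ M]
  (g : SmoothMetric M) {Γ : ℝ → ℝ → M} {ε : ℝ} {x₀ : M} {t s : ℝ}

/-- A family of curves `Γ t` which is jointly smooth for `|t| < ε`. -/
def SmoothFamily (ε : ℝ) (Γ : ℝ → ℝ → M) : Prop :=
  ContMDiffOn 𝓘(ℝ, ℝ × ℝ) (𝓡 2) ∞ (fun q : ℝ × ℝ ↦ Γ q.1 q.2) (Ioo (-ε) ε ×ˢ univ)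

/-- The parameters at which a family of curves takes values in the domain of the chart at `x₀`. -/
def varDom (ε : ℝ) (Γ : ℝ → ℝ → M) (x₀ : M) : Set (ℝ × ℝ) :=
  (Ioo (-ε) ε ×ˢ univ) ∩ (fun q : ℝ × ℝ ↦ Γ q.1 q.2) ⁻¹' (chartMap x₀).source

/-- A family of curves in the chart at `x₀`. -/
def varMap (Γ : ℝ → ℝ → M) (x₀ : M) (q : ℝ × ℝ) : Plane := chartMap x₀ (Γ q.1 q.2)

lemma isOpen_strip (ε : ℝ) : IsOpen (Ioo (-ε) ε ×ˢ (univ : Set ℝ)) := isOpen_Ioo.prod isOpen_univ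

lemma SmoothFamily.contMDiffAt (h : SmoothFamily ε Γ) (ht : t ∈ Ioo (-ε) ε) (s : ℝ) :
    ContMDiffAt 𝓘(ℝ, ℝ × ℝ) (𝓡 2) ∞ (fun q : ℝ × ℝ ↦ Γ q.1 q.2) (t, s) :=
  ContMDiffOn.contMDiffAt h ((isOpen_strip ε).mem_nhds ⟨ht, mem_univ s⟩)

lemma SmoothFamily.isOpen_varDom (h : SmoothFamily ε Γ) (x₀ : M) : IsOpen (varDom ε Γ x₀) :=
  (ContMDiffOn.continuousOn h).isOpen_inter_preimage (isOpen_strip ε) (isOpen_extChartAt_source x₀)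

lemma SmoothFamily.contDiffOn_varMap (h : SmoothFamily ε Γ) (x₀ : M) :
    ContDiffOn ℝ ∞ (varMap Γ x₀) (varDom ε Γ x₀) := by
  rw [← contMDiffOn_iff_contDiffOn]
  refine (contMDiffOn_extChartAt (I := 𝓡 2) (n := ∞) (x := x₀)).comp
    (ContMDiffOn.mono h inter_subset_left) fun u hu ↦ ?_
  simpa using hu.2

lemma SmoothFamily.planarVariation (h : SmoothFamily ε Γ) (x₀ : M) :
    PlanarVariation (chartMap x₀).target (metricMap g x₀) (christoffelMap g x₀)
      (varDom ε Γ x₀) (varMap Γ x₀) where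
  toLeviCivitaOn := leviCivitaOn_chart g x₀
  isOpen_dom := h.isOpen_varDom x₀
  smooth := h.contDiffOn_varMap x₀
  mapsTo _ hq := (chartMap x₀).map_source hq.2

lemma SmoothFamily.mdifferentiableAt_curve (h : SmoothFamily ε Γ) (ht : t ∈ Ioo (-ε) ε) (s : ℝ) :
    MDifferentiableAt 𝓘(ℝ, ℝ) (𝓡 2) (Γ t) s := by
  have h1 : MDifferentiableAt 𝓘(ℝ, ℝ) 𝓘(ℝ, ℝ × ℝ) (fun r : ℝ ↦ (t, r)) s :=
    DifferentiableAt.mdifferentiableAt (by fun_prop)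
  exact ((h.contMDiffAt ht s).mdifferentiableAt (by simp)).comp s h1

lemma SmoothFamily.mdifferentiableAt_path (h : SmoothFamily ε Γ) (ht : t ∈ Ioo (-ε) ε) (s : ℝ) :
    MDifferentiableAt 𝓘(ℝ, ℝ) (𝓡 2) (fun r ↦ Γ r s) t := by
  have h1 : MDifferentiableAt 𝓘(ℝ, ℝ) 𝓘(ℝ, ℝ × ℝ) (fun r : ℝ ↦ (r, s)) t :=
    DifferentiableAt.mdifferentiableAt (by fun_prop)
  exact ((h.contMDiffAt ht s).mdifferentiableAt (by simp)).comp t h1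

lemma SmoothFamily.coords_velocity_curve (h : SmoothFamily ε Γ) (hq : (t, s) ∈ varDom ε Γ x₀) :
    coords x₀ (Γ t s) (velocity (Γ t) s) = velS (varMap Γ x₀) (t, s) := by
  rw [coords_velocity (h.mdifferentiableAt_curve hq.1.1 s) hq.2]
  exact (hasDerivAt_line (differentiableAt_of_contDiffOn (h.isOpen_varDom x₀)
    (h.contDiffOn_varMap x₀) hq)).deriv

lemma SmoothFamily.coords_velocity_path (h : SmoothFamily ε Γ) (hq : (t, s) ∈ varDom ε Γ x₀) :
    coords x₀ (Γ t s) (velocity (fun r ↦ Γ r s) t) = velT (varMap Γ x₀) (t, s) := by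
  rw [coords_velocity (h.mdifferentiableAt_path hq.1.1 s) hq.2]
  exact (hasDerivAt_column (differentiableAt_of_contDiffOn (h.isOpen_varDom x₀)
    (h.contDiffOn_varMap x₀) hq)).deriv

lemma SmoothFamily.coords_covDeriv_curve (h : SmoothFamily ε Γ) {O : Set (ℝ × ℝ)}
    (hO : IsOpen O) (hsub : O ⊆ varDom ε Γ x₀) (hq' : (t, s) ∈ O)
    {V : (r : ℝ) → TangentSpace (𝓡 2) (Γ t r)} {ξ : ℝ × ℝ → Plane}
    (hξ : ContDiffOn ℝ ∞ ξ O)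
    (hV : ∀ r, (t, r) ∈ O → coords x₀ (Γ t r) (V r) = ξ (t, r)) :
    coords x₀ (Γ t s) (covDeriv g (Γ t) V s)
      = cov (christoffelMap g x₀) (varMap Γ x₀) ξ dirS (t, s) := by
  have hp := h.planarVariation g x₀
  have hq := hsub hq'
  have hdξ := differentiableAt_of_contDiffOn hO hξ hq'
  have hι : ContinuousAt (fun r : ℝ ↦ (t, r)) s := by fun_prop
  have hev : (fun r ↦ coords x₀ (Γ t r) (V r)) =ᶠ[𝓝 s] fun r ↦ ξ (t, r) := by
    filter_upwards [hι.eventually (hO.mem_nhds hq')] with r hr using hV r hr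
  have hd : DifferentiableAt ℝ (fun r ↦ ξ (t, r)) s := (hasDerivAt_line hdξ).differentiableAt
  rw [coords_covDeriv g (h.mdifferentiableAt_curve hq.1.1 s) hq.2 (hd.congr_of_eventuallyEq hev),
    cov_congr hev]
  have hc := cov_comp (C := christoffelMap g x₀) (ι := fun r : ℝ ↦ (t, r)) (r := s) (v := 1)
    (hp.da hp.smooth hq) hdξ (by fun_prop)
  have h1 : fderiv ℝ (fun r : ℝ ↦ (t, r)) s 1 = dirS := by
    rw [fderiv_apply_one_eq_deriv]
    exact ((hasDerivAt_const s t).prodMk (hasDerivAt_id s)).deriv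
  rw [h1] at hc
  exact hc

lemma SmoothFamily.coords_covDeriv_path (h : SmoothFamily ε Γ) {O : Set (ℝ × ℝ)}
    (hO : IsOpen O) (hsub : O ⊆ varDom ε Γ x₀) (hq' : (t, s) ∈ O)
    {V : (r : ℝ) → TangentSpace (𝓡 2) (Γ r s)} {ξ : ℝ × ℝ → Plane}
    (hξ : ContDiffOn ℝ ∞ ξ O)
    (hV : ∀ r, (r, s) ∈ O → coords x₀ (Γ r s) (V r) = ξ (r, s)) :
    coords x₀ (Γ t s) (covDeriv g (fun r ↦ Γ r s) V t)
      = cov (christoffelMap g x₀) (varMap Γ x₀) ξ dirT (t, s) := by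
  have hp := h.planarVariation g x₀
  have hq := hsub hq'
  have hdξ := differentiableAt_of_contDiffOn hO hξ hq'
  have hι : ContinuousAt (fun r : ℝ ↦ (r, s)) t := by fun_prop
  have hev : (fun r ↦ coords x₀ (Γ r s) (V r)) =ᶠ[𝓝 t] fun r ↦ ξ (r, s) := by
    filter_upwards [hι.eventually (hO.mem_nhds hq')] with r hr using hV r hr
  have hd : DifferentiableAt ℝ (fun r ↦ ξ (r, s)) t :=
    (hasDerivAt_column hdξ).differentiableAt
  rw [coords_covDeriv g (γ := fun r ↦ Γ r s) (h.mdifferentiableAt_path hq.1.1 s) hq.2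
    (hd.congr_of_eventuallyEq hev), cov_congr hev]
  have hc := cov_comp (C := christoffelMap g x₀) (ι := fun r : ℝ ↦ (r, s)) (r := t) (v := 1)
    (hp.da hp.smooth hq) hdξ (by fun_prop)
  have h1 : fderiv ℝ (fun r : ℝ ↦ (r, s)) t 1 = dirT := by
    rw [fderiv_apply_one_eq_deriv]
    exact ((hasDerivAt_id t).prodMk (hasDerivAt_const t s)).deriv
  rw [h1] at hc
  exact hc

lemma SmoothFamily.coords_tension (h : SmoothFamily ε Γ) (hq : (t, s) ∈ varDom ε Γ x₀) :
    coords x₀ (Γ t s) (tension g (Γ t) s) = tens (christoffelMap g x₀) (varMap Γ x₀) (t, s) :=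
  h.coords_covDeriv_curve g (h.isOpen_varDom x₀) Subset.rfl hq (h.planarVariation g x₀).smooth_velS
    fun _ hr ↦ h.coords_velocity_curve hr

lemma SmoothFamily.coords_variationAccel (h : SmoothFamily ε Γ) (hq : (0, s) ∈ varDom ε Γ x₀) :
    coords x₀ (Γ 0 s) (variationAccel g Γ s)
      = accel (christoffelMap g x₀) (varMap Γ x₀) (0, s) :=
  h.coords_covDeriv_path g (h.isOpen_varDom x₀) Subset.rfl hq (h.planarVariation g x₀).smooth_velT
    fun _ hr ↦ h.coords_velocity_path hr

lemma SmoothFamily.length_tension (h : SmoothFamily ε Γ) (hq : (t, s) ∈ varDom ε Γ x₀) :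
    length g (tension g (Γ t) s)
      = tensNorm (metricMap g x₀) (christoffelMap g x₀) (varMap Γ x₀) (t, s) := by
  rw [length, inner_eq_metricMap g hq.2, h.coords_tension g hq]
  rfl

lemma smoothFamily_const {γ : ℝ → M} (hγ : ContMDiff 𝓘(ℝ, ℝ) (𝓡 2) ∞ γ) (ε : ℝ) :
    SmoothFamily ε (fun _ : ℝ ↦ γ) := by
  have h1 : ContMDiff 𝓘(ℝ, ℝ × ℝ) 𝓘(ℝ, ℝ) ∞ (fun q : ℝ × ℝ ↦ q.2) :=
    ContDiff.contMDiff contDiff_snd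
  exact (hγ.comp h1).contMDiffOn

/-- A vector field along a curve is smooth at `s` if its coordinates are, in every chart. -/
def SmoothFieldAt (γ : ℝ → M) (V : (s : ℝ) → TangentSpace (𝓡 2) (γ s)) (s : ℝ) : Prop :=
  ∀ x₀ : M, γ s ∈ (chartMap x₀).source → ContDiffAt ℝ ∞ (fun r ↦ coords x₀ (γ r) (V r)) s

lemma contDiffAt_line {F : Type*} [NormedAddCommGroup F] [NormedSpace ℝ F] {f : ℝ × ℝ → F}
    {O : Set (ℝ × ℝ)} (hO : IsOpen O) (hf : ContDiffOn ℝ ∞ f O) (hq : (t, s) ∈ O) :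
    ContDiffAt ℝ ∞ (fun r ↦ f (t, r)) s := by
  have h1 : ContDiffAt ℝ ∞ (fun r : ℝ ↦ (t, r)) s := by fun_prop
  exact (hf.contDiffAt (hO.mem_nhds hq)).comp s h1

lemma eventually_line {O : Set (ℝ × ℝ)} (hO : IsOpen O) (hq : (t, s) ∈ O) :
    ∀ᶠ r in 𝓝 s, (t, r) ∈ O := by
  have h1 : ContinuousAt (fun r : ℝ ↦ (t, r)) s := by fun_prop
  exact h1.eventually (hO.mem_nhds hq)

lemma zero_mem_varDom (hε : 0 < ε) (hs : Γ 0 s ∈ (chartMap x₀).source) :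
    ((0 : ℝ), s) ∈ varDom ε Γ x₀ := ⟨⟨⟨by linarith, hε⟩, mem_univ s⟩, hs⟩

lemma SmoothFamily.smoothFieldAt_variationAccel (h : SmoothFamily ε Γ) (hε : 0 < ε) (s : ℝ) :
    SmoothFieldAt (Γ 0) (variationAccel g Γ) s := by
  intro x₀ hx
  have hq := zero_mem_varDom (Γ := Γ) hε hx
  have hp := h.planarVariation g x₀
  refine (contDiffAt_line hp.isOpen_dom hp.smooth_accel hq).congr_of_eventuallyEq ?_
  filter_upwards [eventually_line hp.isOpen_dom hq] with r hr using h.coords_variationAccel g hr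

lemma smoothFieldAt_tension {γ : ℝ → M} (hγ : ContMDiff 𝓘(ℝ, ℝ) (𝓡 2) ∞ γ) (s : ℝ) :
    SmoothFieldAt γ (tension g γ) s := by
  intro x₀ hx
  have h := smoothFamily_const hγ 1
  have hq := zero_mem_varDom (Γ := fun _ ↦ γ) one_pos hx
  have hp := h.planarVariation g x₀
  refine (contDiffAt_line hp.isOpen_dom hp.smooth_tens hq).congr_of_eventuallyEq ?_
  filter_upwards [eventually_line hp.isOpen_dom hq] with r hr using h.coords_tension g hr

lemma contDiffAt_inner {γ : ℝ → M} (hγ : ContMDiff 𝓘(ℝ, ℝ) (𝓡 2) ∞ γ) {s : ℝ}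
    {V W : (s : ℝ) → TangentSpace (𝓡 2) (γ s)} (hV : SmoothFieldAt γ V s)
    (hW : SmoothFieldAt γ W s) : ContDiffAt ℝ ∞ (fun r ↦ g.inner (γ r) (V r) (W r)) s := by
  have hx := mem_chart_self (γ s)
  have hG := (contDiffOn_metricMap g (γ s)).contDiffAt
    ((isOpen_chart_target (γ s)).mem_nhds ((chartMap (γ s)).map_source hx))
  have hγs : ContDiffAt ℝ ∞ (fun r ↦ chartMap (γ s) (γ r)) s := by
    rw [← contMDiffAt_iff_contDiffAt]
    exact (contMDiffAt_extChartAt (I := 𝓡 2) (n := ∞) (x := γ s)).comp s hγ.contMDiffAt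
  have h1 := ((ContDiffAt.comp (g := metricMap g (γ s)) s hG hγs).clm_apply
    (hV (γ s) hx)).clm_apply (hW (γ s) hx)
  refine h1.congr_of_eventuallyEq ?_
  filter_upwards [eventually_mem_chart hγ.continuous.continuousAt hx] with r hr
  exact inner_eq_metricMap g hr _ _

lemma SmoothFieldAt.smul {γ : ℝ → M} {s : ℝ} {V : (s : ℝ) → TangentSpace (𝓡 2) (γ s)}
    (hV : SmoothFieldAt γ V s) {f : ℝ → ℝ} (hf : ContDiffAt ℝ ∞ f s) :
    SmoothFieldAt γ (fun r ↦ f r • V r) s := by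
  intro x₀ hx
  simp only [coords_smul]
  exact hf.smul (hV x₀ hx)

lemma contDiffAt_geodesicCurvature {γ : ℝ → M} (hγ : ContMDiff 𝓘(ℝ, ℝ) (𝓡 2) ∞ γ) {s : ℝ}
    (hk : 0 < geodesicCurvature g γ s) : ContDiffAt ℝ ∞ (geodesicCurvature g γ) s :=
  (contDiffAt_inner g hγ (smoothFieldAt_tension g hγ s) (smoothFieldAt_tension g hγ s)).sqrt
    (Real.sqrt_pos.1 hk).ne'

lemma continuous_geodesicCurvature {γ : ℝ → M} (hγ : ContMDiff 𝓘(ℝ, ℝ) (𝓡 2) ∞ γ) :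
    Continuous (geodesicCurvature g γ) := by
  refine Real.continuous_sqrt.comp (continuous_iff_continuousAt.2 fun s ↦ ?_)
  exact (contDiffAt_inner g hγ (smoothFieldAt_tension g hγ s)
    (smoothFieldAt_tension g hγ s)).continuousAt

lemma smoothFieldAt_unitNormal {γ : ℝ → M} (hγ : ContMDiff 𝓘(ℝ, ℝ) (𝓡 2) ∞ γ) {s : ℝ}
    (hk : 0 < geodesicCurvature g γ s) : SmoothFieldAt γ (unitNormal g γ) s :=
  (smoothFieldAt_tension g hγ s).smul ((contDiffAt_geodesicCurvature g hγ hk).inv hk.ne')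

end TwoParameter

/-! ### Displacing a family of curves in a chart -/

section Push

set_option linter.unusedSectionVars false

variable {M : Type*} [TopologicalSpace M] [ChartedSpace Plane M] [IsManifold (𝓡 2) ∞ M] [T2Space M]
  (g : SmoothMetric M) {Γ : ℝ → ℝ → M} {ε : ℝ} {x₀ : M} {t s : ℝ}

open Classical in
/-- The point `x` displaced by `ρ(x) v` in the chart at `x₀`, where `ρ` is a bump function supported
in that chart. -/
def push (ρ : SmoothBumpFunction (𝓡 2) x₀) (v : Plane) (x : M) : M :=
  if x ∈ (chartMap x₀).source then (chartMap x₀).symm (chartMap x₀ x + ρ x • v) else x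

lemma push_eq_self {ρ : SmoothBumpFunction (𝓡 2) x₀} {v : Plane} {x : M} (h : ρ x = 0) :
    push ρ v x = x := by
  unfold push
  split_ifs with hx
  · rw [h, zero_smul, add_zero, (chartMap x₀).left_inv hx]
  · rfl

lemma push_zero (ρ : SmoothBumpFunction (𝓡 2) x₀) (x : M) : push ρ 0 x = x := by
  unfold push
  split_ifs with hx
  · rw [smul_zero, add_zero, (chartMap x₀).left_inv hx]
  · rfl

/-- Small displacements stay in the chart. -/
lemma exists_push_radius (ρ : SmoothBumpFunction (𝓡 2) x₀) : ∃ δ > 0, ∀ v : Plane, ‖v‖ < δ →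
    ∀ x ∈ (chartMap x₀).source, chartMap x₀ x + ρ x • v ∈ (chartMap x₀).target := by
  have hsub : tsupport ρ ⊆ (chartMap x₀).source := ρ.tsupport_subset_extChartAt_source
  have hc : IsCompact (chartMap x₀ '' tsupport ρ) :=
    IsCompact.image_of_continuousOn ρ.hasCompactSupport
      ((continuousOn_extChartAt (I := 𝓡 2) x₀).mono hsub)
  obtain ⟨δ, hδ, h⟩ := hc.exists_thickening_subset_open (isOpen_chart_target x₀) (by
    rintro _ ⟨x, hx, rfl⟩
    exact (chartMap x₀).map_source (hsub hx))
  refine ⟨δ, hδ, fun v hv x hx ↦ ?_⟩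
  by_cases hxs : x ∈ tsupport ρ
  · refine h (Metric.mem_thickening_iff.2 ⟨_, ⟨x, hxs, rfl⟩, ?_⟩)
    rw [dist_self_add_left, norm_smul, Real.norm_of_nonneg ρ.nonneg]
    exact (mul_le_of_le_one_left (norm_nonneg v) ρ.le_one).trans_lt hv
  · rw [image_eq_zero_of_notMem_tsupport hxs, zero_smul, add_zero]
    exact (chartMap x₀).map_source hx

lemma chartMap_push {ρ : SmoothBumpFunction (𝓡 2) x₀} {v : Plane} {x : M}
    (hx : x ∈ (chartMap x₀).source) (h : chartMap x₀ x + ρ x • v ∈ (chartMap x₀).target) :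
    chartMap x₀ (push ρ v x) = chartMap x₀ x + ρ x • v := by
  rw [push, if_pos hx, (chartMap x₀).right_inv h]

lemma contMDiffAt_push {P : Type*} [NormedAddCommGroup P] [NormedSpace ℝ P] {F : P → M}
    {v : P → Plane} {q : P} {ρ : SmoothBumpFunction (𝓡 2) x₀}
    (hF : ContMDiffAt 𝓘(ℝ, P) (𝓡 2) ∞ F q) (hv : ContDiffAt ℝ ∞ v q)
    (h : F q ∈ (chartMap x₀).source →
      chartMap x₀ (F q) + ρ (F q) • v q ∈ (chartMap x₀).target) :
    ContMDiffAt 𝓘(ℝ, P) (𝓡 2) ∞ (fun r ↦ push ρ (v r) (F r)) q := by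
  by_cases hx : F q ∈ (chartMap x₀).source
  · have hc : ContMDiffAt 𝓘(ℝ, P) 𝓘(ℝ, Plane) ∞ (fun r ↦ chartMap x₀ (F r)) q :=
      (contMDiffAt_extChartAt' (I := 𝓡 2) (n := ∞) (by simpa using hx)).comp q hF
    have hρ : ContMDiffAt 𝓘(ℝ, P) 𝓘(ℝ, ℝ) ∞ (fun r ↦ ρ (F r)) q :=
      (ρ.contMDiff (F q)).comp q hF
    have hsum : ContMDiffAt 𝓘(ℝ, P) 𝓘(ℝ, Plane) ∞
        (fun r ↦ chartMap x₀ (F r) + ρ (F r) • v r) q :=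
      (contMDiffAt_iff_contDiffAt.2 (hc.contDiffAt.add (hρ.contDiffAt.smul hv)))
    have hs : ContMDiffAt 𝓘(ℝ, Plane) (𝓡 2) ∞ (chartMap x₀).symm
        (chartMap x₀ (F q) + ρ (F q) • v q) :=
      (contMDiffOn_extChartAt_symm (n := ∞) x₀).contMDiffAt
        ((isOpen_chart_target x₀).mem_nhds (h hx))
    refine (hs.comp q hsum).congr_of_eventuallyEq ?_
    filter_upwards [eventually_mem_chart hF.continuousAt hx] with r hr
    exact if_pos hr
  · have hnot : F q ∉ tsupport ρ := fun hmem ↦ hx (ρ.tsupport_subset_extChartAt_source hmem)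
    refine hF.congr_of_eventuallyEq ?_
    filter_upwards [hF.continuousAt.eventually
      ((isClosed_tsupport ρ).isOpen_compl.mem_nhds hnot)] with r hr
    exact push_eq_self (image_eq_zero_of_notMem_tsupport hr)

/-- The family `Γ` displaced by `t^m w(s)` in the chart at `x₀`. -/
def pushFamily (ρ : SmoothBumpFunction (𝓡 2) x₀) (m : ℕ) (w : ℝ → Plane) (Γ : ℝ → ℝ → M) :
    ℝ → ℝ → M := fun t s ↦ push ρ (t ^ m • w s) (Γ t s)

lemma pushFamily_zero (ρ : SmoothBumpFunction (𝓡 2) x₀) {m : ℕ} (hm : m ≠ 0) (w : ℝ → Plane)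
    (Γ : ℝ → ℝ → M) : pushFamily ρ m w Γ 0 = Γ 0 := by
  ext s
  simp [pushFamily, hm, push_zero]

lemma exists_smoothFamily_pushFamily (hε : 0 < ε) (h : SmoothFamily ε Γ)
    (ρ : SmoothBumpFunction (𝓡 2) x₀) {m : ℕ} (hm : m ≠ 0) {w : ℝ → Plane}
    (hw : ContDiff ℝ ∞ w) (hb : ∃ B, ∀ s, ‖w s‖ ≤ B) :
    ∃ ε' > 0, SmoothFamily ε' (pushFamily ρ m w Γ) := by
  obtain ⟨δ, hδ, hr⟩ := exists_push_radius ρ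
  obtain ⟨B, hB⟩ := hb
  have hB0 : 0 ≤ B := (norm_nonneg _).trans (hB 0)
  refine ⟨min ε (min 1 (δ / (B + 1))), lt_min hε (lt_min one_pos (by positivity)), ?_⟩
  rintro ⟨t, s⟩ ⟨ht, -⟩
  refine ContMDiffAt.contMDiffWithinAt ?_
  obtain ⟨h1, h2, h3⟩ : |t| < ε ∧ |t| < 1 ∧ |t| < δ / (B + 1) := by
    simpa only [lt_min_iff] using abs_lt.2 ht
  have hw' : ContDiffAt ℝ ∞ (fun q : ℝ × ℝ ↦ q.1 ^ m • w q.2) (t, s) :=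
    ContDiff.contDiffAt (by fun_prop)
  refine contMDiffAt_push (v := fun q : ℝ × ℝ ↦ q.1 ^ m • w q.2) (h.contMDiffAt (abs_lt.1 h1) s)
    hw' fun hx ↦ hr _ ?_ _ hx
  rw [lt_div_iff₀ (by positivity)] at h3
  have h4 : |t| ^ m ≤ |t| := pow_le_of_le_one (abs_nonneg t) h2.le hm
  calc ‖t ^ m • w s‖ = |t| ^ m * ‖w s‖ := by rw [norm_smul, Real.norm_eq_abs, abs_pow]
    _ ≤ |t| * (B + 1) := mul_le_mul h4 ((hB s).trans (by linarith)) (norm_nonneg _) (abs_nonneg t)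
    _ < δ := h3

/-- The effect of a displacement in the chart at `x₀`, near `t = 0`. -/
lemma eventually_chartMap_pushFamily (hε : 0 < ε) (h : SmoothFamily ε Γ)
    (ρ : SmoothBumpFunction (𝓡 2) x₀) {m : ℕ} (hm : m ≠ 0) (w : ℝ → Plane)
    (hx : Γ 0 s ∈ (chartMap x₀).source) :
    (fun t ↦ chartMap x₀ (pushFamily ρ m w Γ t s)) =ᶠ[𝓝 0]
      fun t ↦ chartMap x₀ (Γ t s) + t ^ m • (ρ (Γ t s) • w s) := by
  obtain ⟨δ, hδ, hr⟩ := exists_push_radius ρ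
  have hc : ContinuousAt (fun t ↦ Γ t s) 0 :=
    (h.mdifferentiableAt_path ⟨by linarith, hε⟩ s).continuousAt
  have h1 : ∀ᶠ t in 𝓝 (0 : ℝ), ‖t ^ m • w s‖ < δ := by
    have : Tendsto (fun t : ℝ ↦ ‖t ^ m • w s‖) (𝓝 0) (𝓝 ‖(0 : ℝ) ^ m • w s‖) :=
      Continuous.tendsto (by fun_prop) 0
    rw [zero_pow hm, zero_smul, norm_zero] at this
    exact this.eventually (gt_mem_nhds hδ)
  filter_upwards [eventually_mem_chart hc hx, h1] with t ht h1
  rw [pushFamily, chartMap_push ht (hr _ h1 _ ht), smul_comm]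

lemma eventually_pushFamily_eq_self (hε : 0 < ε) (h : SmoothFamily ε Γ)
    (ρ : SmoothBumpFunction (𝓡 2) x₀) (m : ℕ) (w : ℝ → Plane)
    (hx : Γ 0 s ∉ (chartMap x₀).source) :
    (fun t ↦ pushFamily ρ m w Γ t s) =ᶠ[𝓝 0] fun t ↦ Γ t s := by
  have hc : ContinuousAt (fun t ↦ Γ t s) 0 :=
    (h.mdifferentiableAt_path ⟨by linarith, hε⟩ s).continuousAt
  have hnot : Γ 0 s ∉ tsupport ρ := fun hmem ↦ hx (ρ.tsupport_subset_extChartAt_source hmem)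
  filter_upwards [hc.eventually ((isClosed_tsupport ρ).isOpen_compl.mem_nhds hnot)] with r hr
  exact push_eq_self (image_eq_zero_of_notMem_tsupport hr)

/-- The initial velocity of `t ↦ Γ t s`, in the chart at `x₀`. -/
def velAt (x₀ : M) (Γ : ℝ → ℝ → M) (s : ℝ) : Plane := deriv (fun t ↦ chartMap x₀ (Γ t s)) 0

/-- The initial acceleration of `t ↦ Γ t s`, in the chart at `x₀`. -/
def accAt (x₀ : M) (Γ : ℝ → ℝ → M) (s : ℝ) : Plane :=
  cov (christoffelMap g x₀) (fun t ↦ chartMap x₀ (Γ t s))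
    (fun t ↦ deriv (fun r ↦ chartMap x₀ (Γ r s)) t) 1 0

lemma SmoothFamily.contDiffAt_path (hε : 0 < ε) (h : SmoothFamily ε Γ)
    (hx : Γ 0 s ∈ (chartMap x₀).source) :
    ContDiffAt ℝ ∞ (fun t ↦ chartMap x₀ (Γ t s)) 0 := by
  have h1 := (h.contDiffOn_varMap x₀).contDiffAt
    ((h.isOpen_varDom x₀).mem_nhds (zero_mem_varDom hε hx))
  have h2 : ContDiffAt ℝ ∞ (fun t : ℝ ↦ (t, s)) 0 := by fun_prop
  have h3 : ContDiffAt ℝ ∞ (varMap Γ x₀ ∘ fun t : ℝ ↦ (t, s)) 0 := h1.comp (0 : ℝ) h2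
  exact h3

lemma contDiffAt_deriv_of_infty {F : Type*} [NormedAddCommGroup F] [NormedSpace ℝ F] {f : ℝ → F}
    {t : ℝ} (hf : ContDiffAt ℝ ∞ f t) : ContDiffAt ℝ ∞ (deriv f) t := by
  have h1 : ContDiffAt ℝ ∞ (fderiv ℝ f) t := hf.fderiv_right (by simp)
  have h2 : ContDiffAt ℝ ∞ (fun r ↦ fderiv ℝ f r 1) t := h1.clm_apply contDiffAt_const
  exact h2

/-- Velocities transform by the derivative of the transition map. -/
lemma velAt_eq (hε : 0 < ε) (h : SmoothFamily ε Γ) {y : M} (hy : Γ 0 s ∈ (chartMap y).source)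
    (hx : Γ 0 s ∈ (chartMap x₀).source) :
    velAt x₀ Γ s = fderiv ℝ (transition y x₀) (chartMap y (Γ 0 s)) (velAt y Γ s) := by
  have h0 : (0 : ℝ) ∈ Ioo (-ε) ε := ⟨by linarith, hε⟩
  have h1 := h.mdifferentiableAt_path h0 s
  unfold velAt
  rw [← coords_velocity h1 hx, ← coords_velocity h1 hy, fderiv_transition_coords hy hx]

lemma coords_variationField (hε : 0 < ε) (h : SmoothFamily ε Γ)
    (hx : Γ 0 s ∈ (chartMap x₀).source) :
    coords x₀ (Γ 0 s) (variationField Γ s) = velAt x₀ Γ s :=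
  coords_velocity (h.mdifferentiableAt_path ⟨by linarith, hε⟩ s) hx

lemma coords_variationAccel_eq (hε : 0 < ε) (h : SmoothFamily ε Γ)
    (hx : Γ 0 s ∈ (chartMap x₀).source) :
    coords x₀ (Γ 0 s) (variationAccel g Γ s) = accAt g x₀ Γ s := by
  have h0 : (0 : ℝ) ∈ Ioo (-ε) ε := ⟨by linarith, hε⟩
  have hev : (fun t ↦ coords x₀ (Γ t s) (velocity (fun r ↦ Γ r s) t)) =ᶠ[𝓝 0]
      fun t ↦ deriv (fun r ↦ chartMap x₀ (Γ r s)) t := by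
    filter_upwards [eventually_mem_chart (γ := fun t ↦ Γ t s)
      (h.mdifferentiableAt_path h0 s).continuousAt hx, isOpen_Ioo.mem_nhds h0] with t ht h1
    exact coords_velocity (h.mdifferentiableAt_path h1 s) ht
  have hd : DifferentiableAt ℝ (fun t ↦ deriv (fun r ↦ chartMap x₀ (Γ r s)) t) 0 :=
    (contDiffAt_deriv_of_infty (h.contDiffAt_path hε hx)).differentiableAt (by simp)
  have h1 := coords_covDeriv g (γ := fun t ↦ Γ t s) (h.mdifferentiableAt_path h0 s) hx
    (hd.congr_of_eventuallyEq hev)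
  rw [cov_congr hev] at h1
  exact h1

/-- Accelerations transform by the derivative of the transition map. -/
lemma accAt_eq (hε : 0 < ε) (h : SmoothFamily ε Γ) {y : M} (hy : Γ 0 s ∈ (chartMap y).source)
    (hx : Γ 0 s ∈ (chartMap x₀).source) :
    accAt g x₀ Γ s = fderiv ℝ (transition y x₀) (chartMap y (Γ 0 s)) (accAt g y Γ s) := by
  rw [← coords_variationAccel_eq g hε h hx, ← coords_variationAccel_eq g hε h hy,
    fderiv_transition_coords hy hx]

lemma contDiffAt_smul_path (hε : 0 < ε) (h : SmoothFamily ε Γ)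
    (ρ : SmoothBumpFunction (𝓡 2) x₀) (w : ℝ → Plane) (s : ℝ) :
    ContDiffAt ℝ ∞ (fun t ↦ ρ (Γ t s) • w s) 0 := by
  have h2 : ContDiffAt ℝ ∞ (fun t : ℝ ↦ (t, s)) 0 := by fun_prop
  have h3 : ContMDiffAt 𝓘(ℝ, ℝ) 𝓘(ℝ, ℝ) ∞ (fun t ↦ ρ (Γ t s)) 0 :=
    (ρ.contMDiff (Γ 0 s)).comp (0 : ℝ)
      (((h.contMDiffAt ⟨by linarith, hε⟩ s)).comp (0 : ℝ) h2.contMDiffAt)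
  exact h3.contDiffAt.smul contDiffAt_const

/-- The velocity after a first order displacement. -/
lemma velAt_pushFamily_one (hε : 0 < ε) (h : SmoothFamily ε Γ)
    (ρ : SmoothBumpFunction (𝓡 2) x₀) {w : ℝ → Plane} (hw : ContDiff ℝ ∞ w)
    (hb : ∃ B, ∀ s, ‖w s‖ ≤ B) (s : ℝ) :
    velAt (Γ 0 s) (pushFamily ρ 1 w Γ) s = velAt (Γ 0 s) Γ s
      + ρ (Γ 0 s) • coords (Γ 0 s) (Γ 0 s) (ofCoords x₀ (Γ 0 s) (w s)) := by
  obtain ⟨ε', hε', h'⟩ := exists_smoothFamily_pushFamily hε h ρ one_ne_zero hw hb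
  have hyy := mem_chart_self (Γ 0 s)
  by_cases hx : Γ 0 s ∈ (chartMap x₀).source
  · have hz : pushFamily ρ 1 w Γ 0 s = Γ 0 s := by rw [pushFamily_zero ρ one_ne_zero]
    have e1 : velAt x₀ (pushFamily ρ 1 w Γ) s = velAt x₀ Γ s + ρ (Γ 0 s) • w s := by
      have hd : HasDerivAt (fun t ↦ chartMap x₀ (Γ t s)) (velAt x₀ Γ s) 0 :=
        ((h.contDiffAt_path hε hx).differentiableAt (by simp)).hasDerivAt
      have hd2 := ((contDiffAt_smul_path hε h ρ w s).differentiableAt (by simp)).hasDerivAt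
      have hd3 := hd.add (((hasDerivAt_id (0 : ℝ)).pow 1).smul hd2)
      rw [velAt, (eventually_chartMap_pushFamily hε h ρ one_ne_zero w hx).deriv_eq]
      refine hd3.deriv.trans ?_
      simp
    have e2 := velAt_eq hε' h' (s := s) (x₀ := Γ 0 s) (y := x₀) (by rwa [hz]) (by rwa [hz])
    have e3 := velAt_eq hε h (s := s) (x₀ := Γ 0 s) (y := x₀) hx hyy
    have e4 := fderiv_transition_coords hx hyy (ofCoords x₀ (Γ 0 s) (w s))
    rw [coords_ofCoords hx] at e4
    rw [e2, hz, e1, map_add, map_smul, e4, ← e3]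
  · have hρ : ρ (Γ 0 s) = 0 := image_eq_zero_of_notMem_tsupport fun hmem ↦
      hx (ρ.tsupport_subset_extChartAt_source hmem)
    rw [hρ, zero_smul, add_zero, velAt, velAt]
    exact ((eventually_pushFamily_eq_self hε h ρ 1 w hx).fun_comp (chartMap (Γ 0 s))).deriv_eq

/-- A second order displacement does not change the velocity. -/
lemma velAt_pushFamily_two (hε : 0 < ε) (h : SmoothFamily ε Γ)
    (ρ : SmoothBumpFunction (𝓡 2) x₀) {w : ℝ → Plane} (hw : ContDiff ℝ ∞ w)
    (hb : ∃ B, ∀ s, ‖w s‖ ≤ B) (s : ℝ) :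
    velAt (Γ 0 s) (pushFamily ρ 2 w Γ) s = velAt (Γ 0 s) Γ s := by
  obtain ⟨ε', hε', h'⟩ := exists_smoothFamily_pushFamily hε h ρ two_ne_zero hw hb
  have hyy := mem_chart_self (Γ 0 s)
  by_cases hx : Γ 0 s ∈ (chartMap x₀).source
  · have hz : pushFamily ρ 2 w Γ 0 s = Γ 0 s := by rw [pushFamily_zero ρ two_ne_zero]
    have e1 : velAt x₀ (pushFamily ρ 2 w Γ) s = velAt x₀ Γ s := by
      have hd : HasDerivAt (fun t ↦ chartMap x₀ (Γ t s)) (velAt x₀ Γ s) 0 :=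
        ((h.contDiffAt_path hε hx).differentiableAt (by simp)).hasDerivAt
      have hd2 := ((contDiffAt_smul_path hε h ρ w s).differentiableAt (by simp)).hasDerivAt
      have hd3 := hd.add (((hasDerivAt_id (0 : ℝ)).pow 2).smul hd2)
      rw [velAt, (eventually_chartMap_pushFamily hε h ρ two_ne_zero w hx).deriv_eq]
      refine hd3.deriv.trans ?_
      simp
    have e2 := velAt_eq hε' h' (s := s) (x₀ := Γ 0 s) (y := x₀) (by rwa [hz]) (by rwa [hz])
    have e3 := velAt_eq hε h (s := s) (x₀ := Γ 0 s) (y := x₀) hx hyy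
    rw [e2, hz, e1, ← e3]
  · rw [velAt, velAt]
    exact ((eventually_pushFamily_eq_self hε h ρ 2 w hx).fun_comp (chartMap (Γ 0 s))).deriv_eq

/-- The acceleration after a second order displacement. -/
lemma accAt_pushFamily_two (hε : 0 < ε) (h : SmoothFamily ε Γ)
    (ρ : SmoothBumpFunction (𝓡 2) x₀) {w : ℝ → Plane} (hw : ContDiff ℝ ∞ w)
    (hb : ∃ B, ∀ s, ‖w s‖ ≤ B) (s : ℝ) :
    accAt g (Γ 0 s) (pushFamily ρ 2 w Γ) s = accAt g (Γ 0 s) Γ s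
      + (2 : ℝ) • ρ (Γ 0 s) • coords (Γ 0 s) (Γ 0 s) (ofCoords x₀ (Γ 0 s) (w s)) := by
  obtain ⟨ε', hε', h'⟩ := exists_smoothFamily_pushFamily hε h ρ two_ne_zero hw hb
  have hyy := mem_chart_self (Γ 0 s)
  by_cases hx : Γ 0 s ∈ (chartMap x₀).source
  · have hz : pushFamily ρ 2 w Γ 0 s = Γ 0 s := by rw [pushFamily_zero ρ two_ne_zero]
    have e1 : accAt g x₀ (pushFamily ρ 2 w Γ) s
        = accAt g x₀ Γ s + (2 : ℝ) • ρ (Γ 0 s) • w s := by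
      set f : ℝ → Plane := fun t ↦ chartMap x₀ (Γ t s) with hf
      set u : ℝ → Plane := fun t ↦ ρ (Γ t s) • w s with hu
      have sf : ContDiffAt ℝ ∞ f 0 := h.contDiffAt_path hε hx
      have su : ContDiffAt ℝ ∞ u 0 := contDiffAt_smul_path hε h ρ w s
      have df : HasDerivAt (deriv f) (deriv (deriv f) 0) 0 :=
        ((contDiffAt_deriv_of_infty sf).differentiableAt (by simp)).hasDerivAt
      have du : HasDerivAt (deriv u) (deriv (deriv u) 0) 0 :=
        ((contDiffAt_deriv_of_infty su).differentiableAt (by simp)).hasDerivAt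
      have du1 : HasDerivAt u (deriv u 0) 0 := (su.differentiableAt (by simp)).hasDerivAt
      have ev := eventually_chartMap_pushFamily hε h ρ two_ne_zero w hx
      have ev1 : deriv (fun t ↦ chartMap x₀ (pushFamily ρ 2 w Γ t s)) =ᶠ[𝓝 0]
          fun t ↦ deriv f t + (t ^ 2 • deriv u t + (2 * t) • u t) := by
        have c1 : ∀ᶠ t in 𝓝 (0 : ℝ), DifferentiableAt ℝ f t :=
          (sf.of_le (m := 1) (by simp)).eventually (by simp) |>.mono
            fun t ht ↦ ht.differentiableAt (by simp)
        have c2 : ∀ᶠ t in 𝓝 (0 : ℝ), DifferentiableAt ℝ u t :=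
          (su.of_le (m := 1) (by simp)).eventually (by simp) |>.mono
            fun t ht ↦ ht.differentiableAt (by simp)
        filter_upwards [ev.eventuallyEq_nhds, c1, c2] with t h1 h2 h3
        rw [h1.deriv_eq]
        have := (h2.hasDerivAt.add (((hasDerivAt_id t).pow 2).smul h3.hasDerivAt)).deriv
        refine this.trans ?_
        simp
      have d2 : HasDerivAt (fun t ↦ deriv f t + (t ^ 2 • deriv u t + (2 * t) • u t))
          (deriv (deriv f) 0 + (2 : ℝ) • u 0) 0 := by
        have c3 := ((hasDerivAt_id (0 : ℝ)).pow 2).smul du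
        have c4 := ((hasDerivAt_id (0 : ℝ)).const_mul 2).smul du1
        refine (df.add (c3.add c4)).congr_deriv ?_
        simp
      have z1 : chartMap x₀ (pushFamily ρ 2 w Γ 0 s) = f 0 := by rw [hz]
      have z2 : deriv (fun t ↦ chartMap x₀ (pushFamily ρ 2 w Γ t s)) 0 = deriv f 0 := by
        rw [ev1.eq_of_nhds]; simp
      simp only [accAt, cov, fderiv_apply_one_eq_deriv]
      rw [z1, z2]
      have z3 : deriv (fun t ↦ deriv (fun r ↦ chartMap x₀ (pushFamily ρ 2 w Γ r s)) t) 0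
          = deriv (deriv f) 0 + (2 : ℝ) • u 0 := by
        rw [ev1.deriv_eq, d2.deriv]
      rw [z3]
      simp only [hf, hu]
      abel
    have e2 := accAt_eq g hε' h' (s := s) (x₀ := Γ 0 s) (y := x₀) (by rwa [hz]) (by rwa [hz])
    have e3 := accAt_eq g hε h (s := s) (x₀ := Γ 0 s) (y := x₀) hx hyy
    have e4 := fderiv_transition_coords hx hyy (ofCoords x₀ (Γ 0 s) (w s))
    rw [coords_ofCoords hx] at e4
    rw [e2, hz, e1, map_add, map_smul, map_smul, e4, ← e3]
  · have hρ : ρ (Γ 0 s) = 0 := image_eq_zero_of_notMem_tsupport fun hmem ↦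
      hx (ρ.tsupport_subset_extChartAt_source hmem)
    rw [hρ, zero_smul, smul_zero, add_zero, accAt, accAt]
    have ev := (eventually_pushFamily_eq_self hε h ρ 2 w hx).fun_comp (chartMap (Γ 0 s))
    refine cov_congr_map ev ?_ 1
    filter_upwards [ev.eventuallyEq_nhds] with t ht using ht.deriv_eq

end Push

/-! ### Variations with prescribed variational field -/

section Existence

set_option linter.unusedSectionVars false

variable {M : Type*} [TopologicalSpace M] [ChartedSpace Plane M] [IsManifold (𝓡 2) ∞ M] [T2Space M]
  (g : SmoothMetric M) {Γ : ℝ → ℝ → M} {ε : ℝ} {t s : ℝ}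

/-- The curves of a family are periodic. -/
def PeriodicFamily (L : ℝ) (Γ : ℝ → ℝ → M) : Prop := ∀ t, Function.Periodic (Γ t) L

lemma periodicFamily_pushFamily {L : ℝ} {x₀ : M} (ρ : SmoothBumpFunction (𝓡 2) x₀) (m : ℕ)
    {w : ℝ → Plane} (hΓ : PeriodicFamily L Γ) (hw : Function.Periodic w L) :
    PeriodicFamily L (pushFamily ρ m w Γ) := fun t s ↦ by
  simp only [pushFamily, hΓ t s, hw s]

/-- Successive first order displacements in finitely many charts add up their velocities. -/
lemma exists_family_velAt (hε : 0 < ε) (h : SmoothFamily ε Γ)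
    (ρ : (c : M) → SmoothBumpFunction (𝓡 2) c) (w : M → ℝ → Plane)
    (hw : ∀ c, ContDiff ℝ ∞ (w c)) (hb : ∀ c, ∃ B, ∀ s, ‖w c s‖ ≤ B) (S : Finset M) :
    ∃ ε' > 0, ∃ Γ', SmoothFamily ε' Γ' ∧ Γ' 0 = Γ 0 ∧
      (∀ L, PeriodicFamily L Γ → (∀ c, Function.Periodic (w c) L) → PeriodicFamily L Γ') ∧
      ∀ s, velAt (Γ 0 s) Γ' s = velAt (Γ 0 s) Γ s
        + ∑ c ∈ S, ρ c (Γ 0 s) • coords (Γ 0 s) (Γ 0 s) (ofCoords c (Γ 0 s) (w c s)) := by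
  classical
  induction S using Finset.induction_on with
  | empty => exact ⟨ε, hε, Γ, h, rfl, fun _ h _ ↦ h, by simp⟩
  | insert c S hc ih =>
    obtain ⟨ε₁, hε₁, Γ₁, h₁, h0, hper, hv⟩ := ih
    obtain ⟨ε₂, hε₂, h₂⟩ := exists_smoothFamily_pushFamily hε₁ h₁ (ρ c) one_ne_zero (hw c) (hb c)
    refine ⟨ε₂, hε₂, _, h₂, (pushFamily_zero _ one_ne_zero _ _).trans h0, fun L hL hwL ↦
      periodicFamily_pushFamily _ _ (hper L hL hwL) (hwL c), fun s ↦ ?_⟩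
    have h3 := velAt_pushFamily_one hε₁ h₁ (ρ c) (hw c) (hb c) s
    rw [h0] at h3
    rw [h3, hv, Finset.sum_insert hc]
    abel

/-- Successive second order displacements in finitely many charts add up their accelerations. -/
lemma exists_family_accAt (hε : 0 < ε) (h : SmoothFamily ε Γ)
    (ρ : (c : M) → SmoothBumpFunction (𝓡 2) c) (w : M → ℝ → Plane)
    (hw : ∀ c, ContDiff ℝ ∞ (w c)) (hb : ∀ c, ∃ B, ∀ s, ‖w c s‖ ≤ B) (S : Finset M) :
    ∃ ε' > 0, ∃ Γ', SmoothFamily ε' Γ' ∧ Γ' 0 = Γ 0 ∧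
      ∀ s, velAt (Γ 0 s) Γ' s = velAt (Γ 0 s) Γ s ∧
        accAt g (Γ 0 s) Γ' s = accAt g (Γ 0 s) Γ s + (2 : ℝ) •
        ∑ c ∈ S, ρ c (Γ 0 s) • coords (Γ 0 s) (Γ 0 s) (ofCoords c (Γ 0 s) (w c s)) := by
  classical
  induction S using Finset.induction_on with
  | empty => exact ⟨ε, hε, Γ, h, rfl, by simp⟩
  | insert c S hc ih =>
    obtain ⟨ε₁, hε₁, Γ₁, h₁, h0, hv⟩ := ih
    obtain ⟨ε₂, hε₂, h₂⟩ := exists_smoothFamily_pushFamily hε₁ h₁ (ρ c) two_ne_zero (hw c) (hb c)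
    refine ⟨ε₂, hε₂, _, h₂, (pushFamily_zero _ two_ne_zero _ _).trans h0, fun s ↦ ?_⟩
    have h2 := velAt_pushFamily_two hε₁ h₁ (ρ c) (hw c) (hb c) s
    have h3 := accAt_pushFamily_two g hε₁ h₁ (ρ c) (hw c) (hb c) s
    rw [h0] at h2 h3
    refine ⟨h2.trans (hv s).1, ?_⟩
    rw [h3, (hv s).2, Finset.sum_insert hc, smul_add]
    abel

/-- Finitely many bump functions, each in a chart, without common zeros. -/
lemma exists_bump_cover [CompactSpace M] : ∃ (ρ : (c : M) → SmoothBumpFunction (𝓡 2) c)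
    (S : Finset M), ∀ x, 0 < ∑ c ∈ S, ρ c x ^ 2 := by
  let ρ : (c : M) → SmoothBumpFunction (𝓡 2) c := fun c ↦ Classical.choice inferInstance
  obtain ⟨S, hS⟩ := CompactSpace.elim_nhds_subcover (fun c : M ↦ Function.support (ρ c))
    fun c ↦ (ρ c).support_mem_nhds
  refine ⟨ρ, S, fun x ↦ ?_⟩
  have hx : x ∈ ⋃ c ∈ S, Function.support (ρ c) := hS ▸ mem_univ x
  simp only [mem_iUnion] at hx
  obtain ⟨c, hc, hcx⟩ := hx
  exact Finset.sum_pos' (fun _ _ ↦ sq_nonneg _) ⟨c, hc, pow_pos ((ρ c).nonneg.lt_of_ne'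
    hcx) 2⟩

/-- A smooth vector field along a curve is a combination of smooth coordinate fields, cut off by
bump functions, which inherit its zeros and its periods. -/
lemma exists_coordinate_fields {γ : ℝ → M} (hγ : ContMDiff 𝓘(ℝ, ℝ) (𝓡 2) ∞ γ)
    {V : (s : ℝ) → TangentSpace (𝓡 2) (γ s)} (hV : ∀ s, SmoothFieldAt γ V s)
    (ρ : (c : M) → SmoothBumpFunction (𝓡 2) c) (S : Finset M)
    (hρ : ∀ x, 0 < ∑ c ∈ S, ρ c x ^ 2) :
    ∃ w : M → ℝ → Plane, (∀ c, ContDiff ℝ ∞ (w c)) ∧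
      (∀ s, V s = 0 → ∀ c, w c s = 0) ∧
      (∀ L, (∀ c s, γ s ∈ (chartMap c).source →
          coords c (γ (s + L)) (V (s + L)) = coords c (γ s) (V s)) → Function.Periodic γ L →
        ∀ c, Function.Periodic (w c) L) ∧
      ∀ s, ∑ c ∈ S, ρ c (γ s) • coords (γ s) (γ s) (ofCoords c (γ s) (w c s))
        = coords (γ s) (γ s) (V s) := by
  -- one factor `ρ c` is left for the displacement, whence the sum of squares
  refine ⟨fun c s ↦ (ρ c (γ s) / ∑ c ∈ S, ρ c (γ s) ^ 2) • coords c (γ s) (V s), fun c ↦ ?_,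
    fun s hs c ↦ ?_, fun L hVL hL c s ↦ ?_, fun s ↦ ?_⟩
  · have hρs : ∀ c, ContDiff ℝ ∞ fun s ↦ ρ c (γ s) := fun c ↦
      ((ρ c).contMDiff.comp hγ).contDiff
    have hf : ContDiff ℝ ∞ fun s ↦ ρ c (γ s) / ∑ c ∈ S, ρ c (γ s) ^ 2 :=
      (hρs c).div (ContDiff.sum fun c _ ↦ (hρs c).pow 2) fun s ↦ (hρ (γ s)).ne'
    rw [contDiff_iff_contDiffAt]
    intro s
    by_cases hs : γ s ∈ (chartMap c).source
    · exact hf.contDiffAt.smul (hV s c hs)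
    · have hnot : γ s ∉ tsupport (ρ c) := fun hmem ↦
        hs ((ρ c).tsupport_subset_extChartAt_source hmem)
      refine (contDiffAt_const (c := (0 : Plane))).congr_of_eventuallyEq ?_
      filter_upwards [hγ.continuous.continuousAt.eventually
        ((isClosed_tsupport (ρ c)).isOpen_compl.mem_nhds hnot)] with r hr
      rw [image_eq_zero_of_notMem_tsupport hr, zero_div, zero_smul]
  · simp only [hs, coords_zero, smul_zero]
  · by_cases hs : γ s ∈ (chartMap c).source
    · simp only [hVL c s hs, hL s]
    · have h0 : ρ c (γ s) = 0 := image_eq_zero_of_notMem_tsupport fun hmem ↦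
        hs ((ρ c).tsupport_subset_extChartAt_source hmem)
      simp only [hL s, h0, zero_div, zero_smul]
  · have h1 : ∀ c ∈ S, ρ c (γ s) • coords (γ s) (γ s) (ofCoords c (γ s)
        ((ρ c (γ s) / ∑ c ∈ S, ρ c (γ s) ^ 2) • coords c (γ s) (V s)))
        = (ρ c (γ s) ^ 2 * (∑ c ∈ S, ρ c (γ s) ^ 2)⁻¹) • coords (γ s) (γ s) (V s) := by
      intro c _
      by_cases hs : γ s ∈ (chartMap c).source
      · rw [ofCoords_smul, coords_smul, ofCoords_coords hs, smul_smul]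
        congr 1
        ring
      · have h0 : ρ c (γ s) = 0 := image_eq_zero_of_notMem_tsupport fun hmem ↦
          hs ((ρ c).tsupport_subset_extChartAt_source hmem)
        simp [h0]
    rw [Finset.sum_congr rfl h1, ← Finset.sum_smul, ← Finset.sum_mul,
      mul_inv_cancel₀ (hρ (γ s)).ne', one_smul]

lemma exists_bound_of_zero_off_compact {w : ℝ → Plane} (hw : Continuous w) {K : Set ℝ}
    (hK : IsCompact K) (h0 : ∀ s ∉ K, w s = 0) : ∃ B, ∀ s, ‖w s‖ ≤ B := by
  obtain ⟨B, hB⟩ := hK.exists_bound_of_continuousOn hw.continuousOn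
  refine ⟨max B 0, fun s ↦ ?_⟩
  by_cases hs : s ∈ K
  · exact (hB s hs).trans (le_max_left _ _)
  · rw [h0 s hs, norm_zero]
    exact le_max_right _ _

lemma exists_bound_of_periodic {w : ℝ → Plane} (hw : Continuous w) {L : ℝ} (hL : L ≠ 0)
    (hp : Function.Periodic w L) : ∃ B, ∀ s, ‖w s‖ ≤ B := by
  obtain ⟨B, hB⟩ := (hp.isBounded_of_continuous hL hw).exists_norm_le
  exact ⟨B, fun s ↦ hB _ (mem_range_self s)⟩

lemma velAt_const (γ : ℝ → M) (x₀ : M) (s : ℝ) : velAt x₀ (fun _ : ℝ ↦ γ) s = 0 := by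
  simp [velAt]

/-- Every smooth periodic field along a periodic curve is the variational field of a variation
through periodic curves. -/
lemma exists_family_of_periodic [CompactSpace M] {γ : ℝ → M}
    (hγ : ContMDiff 𝓘(ℝ, ℝ) (𝓡 2) ∞ γ) {V : (s : ℝ) → TangentSpace (𝓡 2) (γ s)}
    (hV : ∀ s, SmoothFieldAt γ V s) {L : ℝ} (hL : L ≠ 0) (hγL : Function.Periodic γ L)
    (hVL : ∀ c s, γ s ∈ (chartMap c).source →
      coords c (γ (s + L)) (V (s + L)) = coords c (γ s) (V s)) :
    ∃ ε > 0, ∃ Γ, SmoothFamily ε Γ ∧ Γ 0 = γ ∧ PeriodicFamily L Γ ∧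
      ∀ s, velAt (γ s) Γ s = coords (γ s) (γ s) (V s) := by
  obtain ⟨ρ, S, hρ⟩ := exists_bump_cover (M := M)
  obtain ⟨w, hw, -, hper, hsum⟩ := exists_coordinate_fields hγ hV ρ S hρ
  obtain ⟨ε, hε, Γ, h1, h2, h3, h4⟩ := exists_family_velAt one_pos (smoothFamily_const hγ 1) ρ w hw
    (fun c ↦ exists_bound_of_periodic (hw c).continuous hL (hper L hVL hγL c)) S
  refine ⟨ε, hε, Γ, h1, h2, h3 L (fun _ ↦ hγL) (hper L hVL hγL), fun s ↦ ?_⟩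
  rw [h4, hsum, velAt_const, zero_add]

/-- Every smooth field along a curve which vanishes outside a compact set is the variational field
of a variation; the acceleration of the variation can be made to vanish wherever the cutoff function
`χ` equals `1`. -/
lemma exists_family_of_compact [CompactSpace M] {γ : ℝ → M}
    (hγ : ContMDiff 𝓘(ℝ, ℝ) (𝓡 2) ∞ γ) {V : (s : ℝ) → TangentSpace (𝓡 2) (γ s)}
    (hV : ∀ s, SmoothFieldAt γ V s) {χ : ℝ → ℝ} (hχ : ContDiff ℝ ∞ χ) {K : Set ℝ}
    (hK : IsCompact K) (hV0 : ∀ s ∉ K, V s = 0) (hχ0 : ∀ s ∉ K, χ s = 0) :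
    ∃ ε > 0, ∃ Γ, SmoothFamily ε Γ ∧ Γ 0 = γ ∧
      (∀ s, velAt (γ s) Γ s = coords (γ s) (γ s) (V s)) ∧
      ∀ s, χ s = 1 → accAt g (γ s) Γ s = 0 := by
  obtain ⟨ρ, S, hρ⟩ := exists_bump_cover (M := M)
  obtain ⟨w, hw, hw0, -, hsum⟩ := exists_coordinate_fields hγ hV ρ S hρ
  obtain ⟨ε, hε, Γ, h1, rfl, -, h4⟩ := exists_family_velAt one_pos (smoothFamily_const hγ 1) ρ w hw
    (fun c ↦ exists_bound_of_zero_off_compact (hw c).continuous hK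
      fun s hs ↦ hw0 s (hV0 s hs) c) S
  -- a second order displacement by `w` adds `2 w` to the acceleration `A`: take `w = -χ A / 2`
  have hA : ∀ s, SmoothFieldAt (Γ 0) (fun r ↦ (-(1 / 2) * χ r) • variationAccel g Γ r) s :=
    fun s ↦ (h1.smoothFieldAt_variationAccel g hε s).smul
      (contDiff_const.mul hχ).contDiffAt
  obtain ⟨z, hz, hz0, -, hzsum⟩ := exists_coordinate_fields hγ hA ρ S hρ
  obtain ⟨ε', hε', Γ', h1', h2', h3'⟩ := exists_family_accAt g hε h1 ρ z hz
    (fun c ↦ exists_bound_of_zero_off_compact (hz c).continuous hK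
      fun s hs ↦ hz0 s (by simp [hχ0 s hs]) c) S
  refine ⟨ε', hε', Γ', h1', h2', fun s ↦ ?_, fun s hs ↦ ?_⟩
  · rw [(h3' s).1, h4, hsum, velAt_const, zero_add]
  · rw [(h3' s).2, hzsum, coords_smul, hs,
      coords_variationAccel_eq g hε h1 (mem_chart_self _)]
    module

end Existence

/-! ### Translation of the parameters -/

section Shift

variable {E P : Type*} [NormedAddCommGroup E] [NormedSpace ℝ E] [NormedAddCommGroup P]
  [NormedSpace ℝ P] {G : E → E →L[ℝ] E →L[ℝ] ℝ} {C : E → E →L[ℝ] E →L[ℝ] E}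

lemma cov_shift (x ξ : P → E) (v w : P) :
    cov C (fun q ↦ x (q + w)) (fun q ↦ ξ (q + w)) v = fun q ↦ cov C x ξ v (q + w) := by
  ext1 q
  simp only [cov, fderiv_comp_add_right]

lemma velS_shift (x : ℝ × ℝ → E) (w : ℝ × ℝ) :
    velS (fun q ↦ x (q + w)) = fun q ↦ velS x (q + w) := by
  ext1 q
  simp only [velS, fderiv_comp_add_right]

lemma velT_shift (x : ℝ × ℝ → E) (w : ℝ × ℝ) :
    velT (fun q ↦ x (q + w)) = fun q ↦ velT x (q + w) := by
  ext1 q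
  simp only [velT, fderiv_comp_add_right]

lemma tens_shift (x : ℝ × ℝ → E) (w : ℝ × ℝ) :
    tens C (fun q ↦ x (q + w)) = fun q ↦ tens C x (q + w) := by
  rw [tens, velS_shift, cov_shift, tens]

lemma accel_shift (x : ℝ × ℝ → E) (w : ℝ × ℝ) :
    accel C (fun q ↦ x (q + w)) = fun q ↦ accel C x (q + w) := by
  rw [accel, velT_shift, cov_shift, accel]

lemma tensNorm_shift (x : ℝ × ℝ → E) (w : ℝ × ℝ) :
    tensNorm G C (fun q ↦ x (q + w)) = fun q ↦ tensNorm G C x (q + w) := by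
  ext1 q
  simp only [tensNorm, tens_shift]

lemma bdry_shift (x : ℝ × ℝ → E) (w : ℝ × ℝ) (p : ℝ) :
    NormalVariation.bdry G C (fun q ↦ x (q + w)) p
      = fun q ↦ NormalVariation.bdry G C x p (q + w) := by
  have h : NormalVariation.wfield G C (fun q ↦ x (q + w)) p
      = fun q ↦ NormalVariation.wfield G C x p (q + w) := by
    ext1 q
    simp only [NormalVariation.wfield, tens_shift, tensNorm_shift]
  ext1 q
  simp only [NormalVariation.bdry, h, accel_shift, cov_shift]

lemma cov_eventuallyEq {x y ξ ζ : P → E} {q : P} (hx : x =ᶠ[𝓝 q] y) (hξ : ξ =ᶠ[𝓝 q] ζ) (v : P) :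
    cov C x ξ v =ᶠ[𝓝 q] cov C y ζ v := by
  filter_upwards [hx, hξ, hx.fderiv (𝕜 := ℝ), hξ.fderiv (𝕜 := ℝ)] with r h1 h2 h3 h4
  simp only [cov, h1, h2, h3, h4]

/-- The boundary term depends only on the germ of the variation. -/
lemma bdry_eventuallyEq {x y : ℝ × ℝ → E} {q : ℝ × ℝ} (h : x =ᶠ[𝓝 q] y) (p : ℝ) :
    NormalVariation.bdry G C x p =ᶠ[𝓝 q] NormalVariation.bdry G C y p := by
  have hS : velS x =ᶠ[𝓝 q] velS y := by
    filter_upwards [h.fderiv (𝕜 := ℝ)] with r hr using by simp only [velS, hr]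
  have hT : velT x =ᶠ[𝓝 q] velT y := by
    filter_upwards [h.fderiv (𝕜 := ℝ)] with r hr using by simp only [velT, hr]
  have ht : tens C x =ᶠ[𝓝 q] tens C y := cov_eventuallyEq h hS dirS
  have ha : accel C x =ᶠ[𝓝 q] accel C y := cov_eventuallyEq h hT dirT
  have hw : NormalVariation.wfield G C x p =ᶠ[𝓝 q] NormalVariation.wfield G C y p := by
    filter_upwards [h, ht] with r h1 h2
    simp only [NormalVariation.wfield, tensNorm, h1, h2]
  filter_upwards [h, ha, hw, cov_eventuallyEq (C := C) h ha dirS,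
    cov_eventuallyEq (C := C) h hw dirS] with r h1 h2 h3 h4 h5
  simp only [NormalVariation.bdry, h1, h2, h3, h4, h5]

end Shift

/-! ### The boundary term of the second variation -/

section Boundary

set_option linter.unusedSectionVars false

variable {M : Type*} [TopologicalSpace M] [ChartedSpace Plane M] [IsManifold (𝓡 2) ∞ M] [T2Space M]
  (g : SmoothMetric M) {Γ : ℝ → ℝ → M} {γ : ℝ → M} {ε K p L : ℝ} {x₀ : M} {t s : ℝ}

/-- The curvature tensor of a surface of constant curvature. -/
lemma curvatureTensor_eq_of_const (hK : HasConstantCurvature g K) {x : M}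
    (X Y Z : TangentSpace (𝓡 2) x) :
    curvatureTensor g X Y Z = K • (g.inner x Y Z • X - g.inner x X Z • Y) := by
  have hx := mem_chart_self x
  refine coords_inj hx ?_
  rw [curvatureTensor_eq, coords_ofCoords hx,
    constCurvOn_chart g hK x _ ((chartMap x).map_source hx), coords_smul, coords_sub,
    coords_smul, coords_smul,
    inner_eq_metricMap g hx, inner_eq_metricMap g hx]

/-- The part of the domain of a variation in a chart where the tension field does not vanish. -/
def posDom (ε : ℝ) (Γ : ℝ → ℝ → M) (x₀ : M) : Set (ℝ × ℝ) :=
  varDom ε Γ x₀ ∩ (fun q ↦ metricMap g x₀ (varMap Γ x₀ q)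
    (tens (christoffelMap g x₀) (varMap Γ x₀) q)
    (tens (christoffelMap g x₀) (varMap Γ x₀) q)) ⁻¹' Ioi 0

lemma SmoothFamily.isOpen_posDom (h : SmoothFamily ε Γ) (x₀ : M) : IsOpen (posDom g ε Γ x₀) := by
  have hp := h.planarVariation g x₀
  exact (hp.smooth_inner hp.smooth_tens hp.smooth_tens).continuousOn.isOpen_inter_preimage
    hp.isOpen_dom isOpen_Ioi

lemma posDom_subset : posDom g ε Γ x₀ ⊆ varDom ε Γ x₀ := inter_subset_left

lemma SmoothFamily.mem_posDom (h : SmoothFamily ε Γ) (ht : t ∈ Ioo (-ε) ε)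
    (hx : Γ t s ∈ (chartMap x₀).source) (hk : 0 < length g (tension g (Γ t) s)) :
    (t, s) ∈ posDom g ε Γ x₀ := by
  have hq : (t, s) ∈ varDom ε Γ x₀ := ⟨⟨ht, mem_univ s⟩, hx⟩
  rw [h.length_tension g hq] at hk
  exact ⟨hq, Real.sqrt_pos.1 hk⟩

/-- Where its tension field does not vanish, a family of curves is a normal variation in a chart;
the conditions on the middle curve are void on the empty interval. -/
lemma SmoothFamily.normalVariation_empty (h : SmoothFamily ε Γ) (x₀ : M) :
    NormalVariation (chartMap x₀).target (metricMap g x₀) (christoffelMap g x₀)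
      (posDom g ε Γ x₀) (varMap Γ x₀) ∅ where
  toLeviCivitaOn := leviCivitaOn_chart g x₀
  isOpen_dom := h.isOpen_posDom g x₀
  smooth := (h.contDiffOn_varMap x₀).mono (posDom_subset g)
  mapsTo := (h.planarVariation g x₀).mapsTo.mono_left (posDom_subset g)
  isOpen_line := isOpen_empty
  line_mem := by simp
  tens_pos _ hq := hq.2
  unit_speed := by simp
  velT_eq := by simp

/-- The field `|τ|^{p-2} τ` along a curve. -/
def powTension (p : ℝ) (γ : ℝ → M) (s : ℝ) : TangentSpace (𝓡 2) (γ s) :=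
  (length g (tension g γ s) ^ (p - 2)) • tension g γ s

lemma SmoothFamily.coords_powTension (h : SmoothFamily ε Γ) (hq : (t, s) ∈ varDom ε Γ x₀) :
    coords x₀ (Γ t s) (powTension g p (Γ t) s)
      = NormalVariation.wfield (metricMap g x₀) (christoffelMap g x₀) (varMap Γ x₀) p (t, s) := by
  rw [powTension, coords_smul, h.coords_tension g hq, h.length_tension g hq,
    NormalVariation.wfield]

/-- The boundary term in the second variation of the energy,
`⟨∇_s A, |τ|^{p-2} τ⟩ - ⟨A, ∇_s (|τ|^{p-2} τ)⟩` with the acceleration field `A`. -/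
def boundaryTerm (p : ℝ) (Γ : ℝ → ℝ → M) (s : ℝ) : ℝ :=
  g.inner (Γ 0 s) (covDeriv g (Γ 0) (variationAccel g Γ) s) (powTension g p (Γ 0) s)
    - g.inner (Γ 0 s) (variationAccel g Γ s) (covDeriv g (Γ 0) (powTension g p (Γ 0)) s)

lemma SmoothFamily.boundaryTerm_eq (h : SmoothFamily ε Γ) (hq : (0, s) ∈ posDom g ε Γ x₀) :
    boundaryTerm g p Γ s
      = NormalVariation.bdry (metricMap g x₀) (christoffelMap g x₀) (varMap Γ x₀) p (0, s) := by
  have hn := h.normalVariation_empty g x₀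
  have hx : Γ 0 s ∈ (chartMap x₀).source := hq.1.2
  rw [boundaryTerm, inner_eq_metricMap g hx, inner_eq_metricMap g hx,
    h.coords_covDeriv_curve g hn.isOpen_dom (posDom_subset g) hq hn.smooth_accel
      fun r hr ↦ h.coords_variationAccel g hr.1,
    h.coords_covDeriv_curve g hn.isOpen_dom (posDom_subset g) hq (hn.smooth_wfield (p := p))
      fun r hr ↦ h.coords_powTension g hr.1,
    h.coords_powTension g hq.1, h.coords_variationAccel g hq.1]
  rfl

/-- The boundary term is periodic for variations through closed curves. -/
lemma SmoothFamily.boundaryTerm_add_period (h : SmoothFamily ε Γ) (hε : 0 < ε)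
    (hk : 0 < length g (tension g (Γ 0) s)) (hk' : 0 < length g (tension g (Γ 0) (s + L)))
    (hL : ∀ᶠ t in 𝓝 (0 : ℝ), Function.Periodic (Γ t) L) :
    boundaryTerm g p Γ (s + L) = boundaryTerm g p Γ s := by
  have h0 : (0 : ℝ) ∈ Ioo (-ε) ε := ⟨by linarith, hε⟩
  have hx := mem_chart_self (Γ 0 s)
  have hx' : Γ 0 (s + L) ∈ (chartMap (Γ 0 s)).source := by rwa [hL.self_of_nhds s]
  rw [h.boundaryTerm_eq g (h.mem_posDom g h0 hx hk),
    h.boundaryTerm_eq g (h.mem_posDom g h0 hx' hk')]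
  have he : (fun q : ℝ × ℝ ↦ varMap Γ (Γ 0 s) (q + (0, L))) =ᶠ[𝓝 (0, s)] varMap Γ (Γ 0 s) := by
    have h1 : Tendsto Prod.fst (𝓝 ((0 : ℝ), s)) (𝓝 0) := continuous_fst.tendsto' _ _ rfl
    filter_upwards [h1.eventually hL] with q hq
    simp only [varMap, Prod.fst_add, Prod.snd_add, add_zero, hq q.2]
  have h2 := (bdry_eventuallyEq (G := metricMap g (Γ 0 s)) (C := christoffelMap g (Γ 0 s)) he
    p).self_of_nhds
  rw [bdry_shift] at h2
  simpa using h2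

/-- The equation for `p`-biharmonic curves in a chart of a surface of constant curvature. -/
lemma SmoothFamily.equation_chart (h : SmoothFamily ε Γ) (hK : HasConstantCurvature g K)
    (hq : (0, s) ∈ posDom g ε Γ x₀) (heq : PBiharmonicEquationAt g p (Γ 0) s) :
    cov (christoffelMap g x₀) (varMap Γ x₀) (cov (christoffelMap g x₀) (varMap Γ x₀)
        (NormalVariation.wfield (metricMap g x₀) (christoffelMap g x₀) (varMap Γ x₀) p) dirS)
        dirS (0, s)
      = tensNorm (metricMap g x₀) (christoffelMap g x₀) (varMap Γ x₀) (0, s) ^ (p - 2) • K •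
        (metricMap g x₀ (varMap Γ x₀ (0, s)) (tens (christoffelMap g x₀) (varMap Γ x₀) (0, s))
            (velS (varMap Γ x₀) (0, s)) • velS (varMap Γ x₀) (0, s)
          - metricMap g x₀ (varMap Γ x₀ (0, s)) (velS (varMap Γ x₀) (0, s))
            (velS (varMap Γ x₀) (0, s)) • tens (christoffelMap g x₀) (varMap Γ x₀) (0, s)) := by
  have hn := h.normalVariation_empty g x₀
  have hx : Γ 0 s ∈ (chartMap x₀).source := hq.1.2
  have h1 := congrArg (coords x₀ (Γ 0 s)) heq
  have h2 : coords x₀ (Γ 0 s) (covDeriv g (Γ 0) (covDeriv g (Γ 0) (powTension g p (Γ 0))) s) = _ :=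
    h.coords_covDeriv_curve g hn.isOpen_dom (posDom_subset g) hq
      (hn.smooth_cov (hn.smooth_wfield (p := p)) dirS) fun r hr ↦
        h.coords_covDeriv_curve g hn.isOpen_dom (posDom_subset g) hr (hn.smooth_wfield (p := p))
          fun r hr ↦ h.coords_powTension g hr.1
  refine h2.symm.trans (h1.trans ?_)
  rw [curvatureTensor_eq_of_const g hK, coords_smul, coords_smul, coords_sub, coords_smul,
    coords_smul, inner_eq_metricMap g hx,
    inner_eq_metricMap g hx, h.length_tension g hq.1, h.coords_tension g hq.1,
    h.coords_velocity_curve hq.1]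
  rfl

end Boundary

/-! ### Variations in the direction of the unit normal -/

section ExistenceOfVariations

set_option linter.unusedSectionVars false

variable {M : Type*} [TopologicalSpace M] [ChartedSpace Plane M] [IsManifold (𝓡 2) ∞ M] [T2Space M]
  (g : SmoothMetric M) {Γ : ℝ → ℝ → M} {γ : ℝ → M} {ε K p a b L : ℝ} {x₀ : M} {t s : ℝ}

/-- The coordinates of the tension field and its length are periodic along a periodic curve. -/
lemma tension_add_period (hγ : ContMDiff 𝓘(ℝ, ℝ) (𝓡 2) ∞ γ) (hL : Function.Periodic γ L)
    (hx : γ s ∈ (chartMap x₀).source) :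
    coords x₀ (γ (s + L)) (tension g γ (s + L)) = coords x₀ (γ s) (tension g γ s) ∧
      geodesicCurvature g γ (s + L) = geodesicCurvature g γ s := by
  have h := smoothFamily_const hγ 1
  have hq := zero_mem_varDom (Γ := fun _ ↦ γ) one_pos hx
  have hq' := zero_mem_varDom (Γ := fun _ ↦ γ) (s := s + L) one_pos (by rwa [← hL s] at hx)
  have he : (fun q : ℝ × ℝ ↦ varMap (fun _ ↦ γ) x₀ (q + (0, L))) = varMap (fun _ ↦ γ) x₀ := by
    ext1 q
    simp only [varMap, Prod.snd_add, hL q.2]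
  have h1 := congrFun (tens_shift (C := christoffelMap g x₀) (varMap (fun _ ↦ γ) x₀) (0, L)) (0, s)
  have h2 := congrFun (tensNorm_shift (G := metricMap g x₀) (C := christoffelMap g x₀)
    (varMap (fun _ ↦ γ) x₀) (0, L)) (0, s)
  rw [he] at h1 h2
  simp only [Prod.mk_add_mk, add_zero] at h1 h2
  exact ⟨(h.coords_tension g hq').trans (h1.symm.trans (h.coords_tension g hq).symm),
    (h.length_tension g hq').trans (h2.symm.trans (h.length_tension g hq).symm)⟩

/-- A field along the middle curve whose coordinates are the initial velocity is the variational
field. -/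
lemma SmoothFamily.variationField_eq (hε : 0 < ε) (h : SmoothFamily ε Γ) (h0 : Γ 0 = γ)
    {V : (s : ℝ) → TangentSpace (𝓡 2) (γ s)}
    (hV : velAt (γ s) Γ s = coords (γ s) (γ s) (V s)) :
    (⟨Γ 0 s, variationField Γ s⟩ : TangentBundle (𝓡 2) M) = ⟨γ s, V s⟩ := by
  subst h0
  have hx := mem_chart_self (Γ 0 s)
  rw [coords_inj hx ((coords_variationField hε h hx).trans hV)]

lemma IsPBiharmonicCurve.exists_isVariation_closed [CompactSpace M] (hab : a < b)
    (hγ : IsPBiharmonicCurve g .closed p a b γ) :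
    ∃ Γ, IsVariation g .closed a b γ (unitNormal g γ) Γ := by
  have hL := hγ.closed rfl
  have hper : ∀ s, geodesicCurvature g γ (s + (b - a)) = geodesicCurvature g γ s := fun s ↦
    (tension_add_period g hγ.smooth hL (mem_chart_self (γ s))).2
  have hpos : ∀ s, 0 < geodesicCurvature g γ s := fun s ↦ by
    obtain ⟨r, hr, hsr⟩ := Function.Periodic.exists_mem_Ico hper (sub_pos.2 hab) s a
    rw [hsr]
    exact hγ.curvature_pos r ⟨hr.1, by linarith [hr.2]⟩
  obtain ⟨ε, hε, Γ, h1, h2, h3, h4⟩ := exists_family_of_periodic hγ.smooth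
    (fun s ↦ smoothFieldAt_unitNormal g hγ.smooth (hpos s)) (sub_pos.2 hab).ne' hL
    fun c s hs ↦ by
      simp only [unitNormal, coords_smul, hper, (tension_add_period g hγ.smooth hL hs).1]
  exact ⟨Γ, ⟨ε, hε, h1⟩, h2, fun s _ ↦ h1.variationField_eq hε h2 (h4 s),
    fun _ ↦ Eventually.of_forall h3, nofun⟩

lemma SmoothFamily.variationAccel_eq_zero (hε : 0 < ε) (h : SmoothFamily ε Γ)
    (hs : accAt g (Γ 0 s) Γ s = 0) : variationAccel g Γ s = 0 := by
  have hx := mem_chart_self (Γ 0 s)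
  refine coords_inj hx ?_
  rw [coords_variationAccel_eq g hε h hx, hs, coords_zero]

lemma covDeriv_eq_zero (hγ : MDifferentiableAt 𝓘(ℝ, ℝ) (𝓡 2) γ s)
    {V : (s : ℝ) → TangentSpace (𝓡 2) (γ s)} (hV : ∀ᶠ r in 𝓝 s, V r = 0) :
    covDeriv g γ V s = 0 := by
  have hx := mem_chart_self (γ s)
  have he : (fun r ↦ coords (γ s) (γ r) (V r)) =ᶠ[𝓝 s] fun _ ↦ 0 := by
    filter_upwards [hV] with r hr
    rw [hr, coords_zero]
  refine coords_inj hx ?_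
  rw [coords_covDeriv g hγ hx ((differentiableAt_const _).congr_of_eventuallyEq he),
    cov_congr he, coords_zero]
  simp [cov]

lemma IsPBiharmonicCurve.exists_isVariation_arc [CompactSpace M] (hab : a < b)
    (hγ : IsPBiharmonicCurve g .arc p a b γ) :
    ∃ Γ, IsVariation g .arc a b γ (unitNormal g γ) Γ := by
  have hU : IsOpen {s | 0 < geodesicCurvature g γ s} :=
    isOpen_lt continuous_const (continuous_geodesicCurvature g hγ.smooth)
  obtain ⟨δ, hδ, hδU⟩ := (isCompact_Icc (a := a) (b := b)).exists_cthickening_subset_open hU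
    hγ.curvature_pos
  have hr : 0 < (b - a) / 2 := by linarith
  rw [Real.Icc_eq_closedBall, cthickening_closedBall hδ.le hr.le] at hδU
  -- a cutoff function which is `1` near `[a, b]` and supported where the curvature is positive
  let χ : ContDiffBump ((a + b) / 2) := ⟨(b - a) / 2 + δ / 2, δ + (b - a) / 2, by positivity,
    by linarith⟩
  have hχ0 : ∀ s ∉ Metric.closedBall ((a + b) / 2) (δ + (b - a) / 2), χ s = 0 := fun s hs ↦
    χ.zero_of_le_dist (not_le.1 fun h ↦ hs (Metric.mem_closedBall.2 h)).le
  have hχ1 : ∀ s ∈ Icc a b, ∀ᶠ r in 𝓝 s, χ r = 1 := by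
    intro s hs
    rw [Real.Icc_eq_closedBall] at hs
    have h1 : s ∈ Metric.ball ((a + b) / 2) ((b - a) / 2 + δ / 2) :=
      Metric.closedBall_subset_ball (by linarith) hs
    filter_upwards [Metric.isOpen_ball.mem_nhds h1] with r hr
    exact χ.one_of_mem_closedBall (Metric.ball_subset_closedBall hr)
  have hV : ∀ s, SmoothFieldAt γ (fun r ↦ χ r • unitNormal g γ r) s := by
    intro s
    by_cases hs : 0 < geodesicCurvature g γ s
    · exact (smoothFieldAt_unitNormal g hγ.smooth hs).smul χ.contDiff.contDiffAt
    · intro x₀ _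
      refine (contDiffAt_const (c := (0 : Plane))).congr_of_eventuallyEq ?_
      filter_upwards [Metric.isClosed_closedBall.isOpen_compl.mem_nhds fun h ↦ hs (hδU h)] with r hr
      rw [hχ0 r hr, zero_smul, coords_zero]
  obtain ⟨ε, hε, Γ, h1, h2, h3, h4⟩ := exists_family_of_compact g hγ.smooth hV χ.contDiff
    (isCompact_closedBall _ _) (fun s hs ↦ by rw [hχ0 s hs, zero_smul]) hχ0
  have hA : ∀ s ∈ Icc a b, ∀ᶠ r in 𝓝 s, variationAccel g Γ r = 0 := fun s hs ↦ by
    filter_upwards [hχ1 s hs] with r hr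
    exact h1.variationAccel_eq_zero g hε (by rw [h2]; exact h4 r hr)
  refine ⟨Γ, ⟨ε, hε, h1⟩, h2, fun s hs ↦ ?_, nofun, fun _ s hs ↦ ?_⟩
  · refine h1.variationField_eq hε h2 ((h3 s).trans ?_)
    rw [(hχ1 s hs).self_of_nhds, one_smul]
  · have hs' : s ∈ Icc a b := by
      rcases hs with rfl | rfl
      exacts [left_mem_Icc.2 hab.le, right_mem_Icc.2 hab.le]
    exact ⟨(hA s hs').self_of_nhds, covDeriv_eq_zero g
      (h1.mdifferentiableAt_curve ⟨by linarith, hε⟩ s) (hA s hs')⟩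

/-- The unit normal is the variational field of a variation. -/
lemma IsPBiharmonicCurve.exists_isVariation [CompactSpace M] (hab : a < b) {c : CurveKind}
    (hγ : IsPBiharmonicCurve g c p a b γ) : ∃ Γ, IsVariation g c a b γ (unitNormal g γ) Γ := by
  cases c with
  | closed => exact hγ.exists_isVariation_closed g hab
  | arc => exact hγ.exists_isVariation_arc g hab

end ExistenceOfVariations

/-! ### The second derivative of a parametric integral -/

section ParametricIntegral

variable {f : ℝ × ℝ → ℝ} {Ω : Set (ℝ × ℝ)} {u : Set ℝ} {a b t : ℝ}

/-- Differentiation under the integral sign. -/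
lemma hasDerivAt_integral_column (hab : a ≤ b) (hΩ : IsOpen Ω) (hf : ContDiffOn ℝ ∞ f Ω)
    (hu : IsOpen u) (hsub : u ×ˢ Icc a b ⊆ Ω) (ht : t ∈ u) :
    HasDerivAt (fun r ↦ ∫ s in a..b, f (r, s)) (∫ s in a..b, fderiv ℝ f (t, s) dirT) t := by
  obtain ⟨r, hr, hru⟩ := Metric.nhds_basis_closedBall.mem_iff.1 (hu.mem_nhds ht)
  have hball : Metric.closedBall t r ×ˢ Icc a b ⊆ Ω := (prod_mono hru Subset.rfl).trans hsub
  have hf' : ContDiffOn ℝ ∞ (fun q ↦ fderiv ℝ f q dirT) Ω := contDiffOn_fderiv_apply hΩ hf dirT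
  obtain ⟨B, hB⟩ := ((isCompact_closedBall t r).prod
    isCompact_Icc).exists_bound_of_continuousOn (hf'.continuousOn.mono hball)
  have hcont : ∀ {φ : ℝ × ℝ → ℝ}, ContDiffOn ℝ ∞ φ Ω → ∀ t' ∈ u,
      ContinuousOn (fun s ↦ φ (t', s)) (uIcc a b) := by
    intro φ hφ t' ht'
    rw [uIcc_of_le hab]
    exact hφ.continuousOn.comp (by fun_prop) fun s hs ↦ hsub ⟨ht', hs⟩
  refine (intervalIntegral.hasDerivAt_integral_of_dominated_loc_of_deriv_le
    (F := fun r s ↦ f (r, s)) (F' := fun r s ↦ fderiv ℝ f (r, s) dirT) (bound := fun _ ↦ B)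
    (Metric.closedBall_mem_nhds t hr) ?_ (hcont hf t ht).intervalIntegrable
    (hcont hf' t ht).intervalIntegrable.aestronglyMeasurable_restrict_uIoc ?_
    intervalIntegrable_const ?_).2
  · filter_upwards [hu.mem_nhds ht] with t' ht'
    exact (hcont hf t' ht').intervalIntegrable.aestronglyMeasurable_restrict_uIoc
  · refine Eventually.of_forall fun s hs t' ht' ↦ hB (t', s) ⟨ht', ?_⟩
    rw [uIoc_of_le hab] at hs
    exact Ioc_subset_Icc_self hs
  · refine Eventually.of_forall fun s hs t' ht' ↦ hasDerivAt_column ?_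
    rw [uIoc_of_le hab] at hs
    exact differentiableAt_of_contDiffOn hΩ hf (hball ⟨ht', Ioc_subset_Icc_self hs⟩)

/-- The second derivative of an integral depending smoothly on a parameter. -/
lemma hasSecondDerivAtZero_integral (hab : a ≤ b) (hΩ : IsOpen Ω) (hf : ContDiffOn ℝ ∞ f Ω)
    (h0 : ∀ s ∈ Icc a b, ((0 : ℝ), s) ∈ Ω) (c : ℝ) :
    HasSecondDerivAtZero (fun t ↦ c * ∫ s in a..b, f (t, s))
      (c * ∫ s in a..b, fderiv ℝ (fun q ↦ fderiv ℝ f q dirT) (0, s) dirT) := by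
  obtain ⟨u, v, hu, -, h0u, hv, huv⟩ := generalized_tube_lemma (isCompact_singleton (x := (0 : ℝ)))
    (isCompact_Icc (a := a) (b := b)) hΩ (by rintro ⟨t, s⟩ ⟨rfl, hs⟩; exact h0 s hs)
  have h0u : (0 : ℝ) ∈ u := h0u rfl
  have hsub : u ×ˢ Icc a b ⊆ Ω := (prod_mono Subset.rfl hv).trans huv
  have h1 : ∀ t ∈ u, HasDerivAt (fun t ↦ c * ∫ s in a..b, f (t, s))
      (c * ∫ s in a..b, fderiv ℝ f (t, s) dirT) t := fun t ht ↦
    (hasDerivAt_integral_column hab hΩ hf hu hsub ht).const_mul c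
  refine ⟨?_, ?_⟩
  · filter_upwards [hu.mem_nhds h0u] with t ht using (h1 t ht).differentiableAt
  · refine ((hasDerivAt_integral_column hab hΩ (contDiffOn_fderiv_apply hΩ hf dirT) hu hsub
      h0u).const_mul c).congr_of_eventuallyEq ?_
    filter_upwards [hu.mem_nhds h0u] with t ht using (h1 t ht).deriv

end ParametricIntegral

/-! ### The Hessian of the energy -/

section Hessian

set_option linter.unusedSectionVars false

variable {M : Type*} [TopologicalSpace M] [ChartedSpace Plane M] [IsManifold (𝓡 2) ∞ M] [T2Space M]
  (g : SmoothMetric M) {Γ : ℝ → ℝ → M} {γ : ℝ → M} {ε K p a b : ℝ} {c : CurveKind} {x₀ : M}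
  {t s : ℝ}

/-- The energy density of a family of curves is smooth where the tension field does not vanish. -/
lemma SmoothFamily.energyDensity (h : SmoothFamily ε Γ) (p : ℝ) :
    ∃ Ω : Set (ℝ × ℝ), IsOpen Ω ∧
      ContDiffOn ℝ ∞ (fun q ↦ length g (tension g (Γ q.1) q.2) ^ p) Ω ∧
      ∀ x₀, posDom g ε Γ x₀ ⊆ Ω := by
  refine ⟨⋃ x₀, posDom g ε Γ x₀, isOpen_iUnion (h.isOpen_posDom g), fun q hq ↦ ?_,
    subset_iUnion _⟩
  obtain ⟨x₀, hq⟩ := mem_iUnion.1 hq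
  have hn := h.normalVariation_empty g x₀
  refine (((hn.smooth_rpow p).contDiffAt (hn.isOpen_dom.mem_nhds hq)).congr_of_eventuallyEq
    ?_).contDiffWithinAt
  filter_upwards [hn.isOpen_dom.mem_nhds hq] with r hr
  rw [h.length_tension g hr.1]

/-- The derivatives of the energy density in a chart. -/
lemma SmoothFamily.fderiv_energyDensity (h : SmoothFamily ε Γ) {q : ℝ × ℝ}
    (hq : q ∈ posDom g ε Γ x₀) (v : ℝ × ℝ) :
    fderiv ℝ (fun q ↦ fderiv ℝ (fun q : ℝ × ℝ ↦ length g (tension g (Γ q.1) q.2) ^ p) q v) q v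
      = fderiv ℝ (fun q ↦ fderiv ℝ (fun q ↦ tensNorm (metricMap g x₀) (christoffelMap g x₀)
        (varMap Γ x₀) q ^ p) q v) q v := by
  have he : (fun q : ℝ × ℝ ↦ length g (tension g (Γ q.1) q.2) ^ p) =ᶠ[𝓝 q]
      fun q ↦ tensNorm (metricMap g x₀) (christoffelMap g x₀) (varMap Γ x₀) q ^ p := by
    filter_upwards [(h.isOpen_posDom g x₀).mem_nhds hq] with r hr
    rw [h.length_tension g hr.1]
  have he' : (fun q ↦ fderiv ℝ (fun q : ℝ × ℝ ↦ length g (tension g (Γ q.1) q.2) ^ p) q v)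
      =ᶠ[𝓝 q] fun q ↦ fderiv ℝ (fun q ↦ tensNorm (metricMap g x₀) (christoffelMap g x₀)
        (varMap Γ x₀) q ^ p) q v := by
    filter_upwards [he.fderiv (𝕜 := ℝ)] with r hr
    rw [hr]
  rw [he'.fderiv_eq]

lemma SmoothFamily.deriv_geodesicCurvature (h : SmoothFamily ε Γ)
    (hq : (0, s) ∈ posDom g ε Γ x₀) :
    deriv (geodesicCurvature g (Γ 0)) s
      = fderiv ℝ (tensNorm (metricMap g x₀) (christoffelMap g x₀) (varMap Γ x₀)) (0, s) dirS := by
  have hn := h.normalVariation_empty g x₀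
  have h1 := hasDerivAt_line (hn.da hn.smooth_tensNorm hq)
  refine (h1.congr_of_eventuallyEq ?_).deriv
  filter_upwards [eventually_line hn.isOpen_dom hq] with r hr
  exact h.length_tension g hr.1

lemma SmoothFamily.contDiffAt_boundaryTerm (h : SmoothFamily ε Γ)
    (hq : (0, s) ∈ posDom g ε Γ x₀) : ContDiffAt ℝ ∞ (boundaryTerm g p Γ) s := by
  have hn := h.normalVariation_empty g x₀
  refine (contDiffAt_line hn.isOpen_dom (hn.smooth_bdry (p := p)) hq).congr_of_eventuallyEq ?_
  filter_upwards [eventually_line hn.isOpen_dom hq] with r hr using h.boundaryTerm_eq g hr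

lemma SmoothFamily.deriv_boundaryTerm (h : SmoothFamily ε Γ)
    (hq : (0, s) ∈ posDom g ε Γ x₀) : deriv (boundaryTerm g p Γ) s
      = fderiv ℝ (NormalVariation.bdry (metricMap g x₀) (christoffelMap g x₀) (varMap Γ x₀) p)
        (0, s) dirS := by
  have hn := h.normalVariation_empty g x₀
  have h1 := hasDerivAt_line (hn.da (hn.smooth_bdry (p := p)) hq)
  refine (h1.congr_of_eventuallyEq ?_).deriv
  filter_upwards [eventually_line hn.isOpen_dom hq] with r hr using h.boundaryTerm_eq g hr

/-- In a chart, a variation of an arclength parametrized curve in the direction of its unit normal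
is a normal variation. -/
lemma SmoothFamily.normalVariation (h : SmoothFamily ε Γ) (hε : 0 < ε) (x₀ : M)
    (hγ : IsPBiharmonicCurve g c p a b (Γ 0))
    (hη : ∀ s ∈ Icc a b, variationField Γ s = unitNormal g (Γ 0) s) :
    NormalVariation (chartMap x₀).target (metricMap g x₀) (christoffelMap g x₀)
      (posDom g ε Γ x₀) (varMap Γ x₀) (Ioo a b ∩ {s | Γ 0 s ∈ (chartMap x₀).source}) := by
  have h0 : (0 : ℝ) ∈ Ioo (-ε) ε := ⟨by linarith, hε⟩
  have hn := h.normalVariation_empty g x₀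
  have hmem : ∀ s ∈ Ioo a b ∩ {s | Γ 0 s ∈ (chartMap x₀).source},
      ((0 : ℝ), s) ∈ posDom g ε Γ x₀ := fun s hs ↦
    h.mem_posDom g h0 hs.2 (hγ.curvature_pos s (Ioo_subset_Icc_self hs.1))
  refine { hn with
    isOpen_line := isOpen_Ioo.inter
      ((isOpen_extChartAt_source x₀).preimage hγ.smooth.continuous)
    line_mem := hmem
    unit_speed := fun s hs ↦ ?_
    velT_eq := fun s hs ↦ ?_ }
  · have hq := (hmem s hs).1
    have h1 := hγ.arclength s (Ioo_subset_Icc_self hs.1)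
    rwa [inner_eq_metricMap g hs.2, h.coords_velocity_curve hq] at h1
  · have hq := (hmem s hs).1
    have h1 := congrArg (coords x₀ (Γ 0 s)) (hη s (Ioo_subset_Icc_self hs.1))
    rw [unitNormal, coords_smul, h.coords_tension g hq, geodesicCurvature,
      h.length_tension g hq] at h1
    rw [← h1]
    exact (h.coords_velocity_path hq).symm

/-- The integrand of the Hessian in the direction of the unit normal. -/
def hessianDensity (K p : ℝ) (γ : ℝ → M) (s : ℝ) : ℝ :=
  (p - 1) * geodesicCurvature g γ s ^ (p + 2)
    + deriv (geodesicCurvature g γ) s ^ 2 * geodesicCurvature g γ s ^ (p - 2)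
    + (p - 1) * K ^ 2 * geodesicCurvature g γ s ^ (p - 2)
    - (2 * p + 2) * K * geodesicCurvature g γ s ^ p

lemma IsPBiharmonicCurve.continuousOn_hessianDensity (hγ : IsPBiharmonicCurve g c p a b γ) :
    ContinuousOn (hessianDensity g K p γ) (Icc a b) := by
  have hk : ContinuousOn (geodesicCurvature g γ) (Icc a b) :=
    (continuous_geodesicCurvature g hγ.smooth).continuousOn
  have hk' : ContinuousOn (deriv (geodesicCurvature g γ)) (Icc a b) := fun s hs ↦
    (contDiffAt_deriv_of_infty (contDiffAt_geodesicCurvature g hγ.smooth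
      (hγ.curvature_pos s hs))).continuousAt.continuousWithinAt
  have hr : ∀ m : ℝ, ContinuousOn (fun s ↦ geodesicCurvature g γ s ^ m) (Icc a b) := fun m ↦
    hk.rpow_const fun s hs ↦ Or.inl (hγ.curvature_pos s hs).ne'
  exact (((continuousOn_const.mul (hr _)).add ((hk'.pow 2).mul (hr _))).add
    (continuousOn_const.mul (hr _))).sub (continuousOn_const.mul (hr _))

/-- The second derivative of the energy along a variation in the direction of the unit normal:
pointwise it is the integrand of the Hessian plus the derivative of the boundary term. -/
lemma IsPBiharmonicCurve.hasSecondDerivAtZero (hK : HasConstantCurvature g K) (hp : p ≠ 0)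
    (hab : a < b) (hγ : IsPBiharmonicCurve g c p a b γ)
    (hΓ : IsVariation g c a b γ (unitNormal g γ) Γ) :
    HasSecondDerivAtZero (fun t ↦ energy g p a b (Γ t))
      (∫ s in a..b, hessianDensity g K p γ s) := by
  obtain ⟨ε, hε, h⟩ := hΓ.smooth
  change SmoothFamily ε Γ at h
  obtain rfl := hΓ.zero
  have h0 : (0 : ℝ) ∈ Ioo (-ε) ε := ⟨by linarith, hε⟩
  have hη : ∀ s ∈ Icc a b, variationField Γ s = unitNormal g (Γ 0) s := fun s hs ↦ by
    simpa using hΓ.field s hs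
  have hmem : ∀ s ∈ Icc a b, ((0 : ℝ), s) ∈ posDom g ε Γ (Γ 0 s) := fun s hs ↦
    h.mem_posDom g h0 (mem_chart_self _) (hγ.curvature_pos s hs)
  obtain ⟨Ω, hΩ, hf, hsub⟩ := h.energyDensity g p
  have h2 := hasSecondDerivAtZero_integral hab.le hΩ hf (fun s hs ↦ hsub _ (hmem s hs)) (1 / p)
  have hbd : ∀ s ∈ Icc a b, ContDiffAt ℝ ∞ (boundaryTerm g p Γ) s := fun s hs ↦
    h.contDiffAt_boundaryTerm g (hmem s hs)
  have hdb : ContinuousOn (deriv (boundaryTerm g p Γ)) (Icc a b) := fun s hs ↦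
    (contDiffAt_deriv_of_infty (hbd s hs)).continuousAt.continuousWithinAt
  have hint : ∫ s in a..b, deriv (boundaryTerm g p Γ) s = 0 := by
    rw [intervalIntegral.integral_deriv_eq_sub
      (fun s hs ↦ (hbd s (uIcc_of_le hab.le ▸ hs)).differentiableAt (by simp))
      (by rw [← uIcc_of_le hab.le] at hdb; exact hdb.intervalIntegrable), sub_eq_zero]
    cases c with
    | closed =>
      have h3 := h.boundaryTerm_add_period g (p := p) (s := a) hε
        (hγ.curvature_pos a (left_mem_Icc.2 hab.le))
        (by rw [add_sub_cancel]; exact hγ.curvature_pos b (right_mem_Icc.2 hab.le)) (hΓ.closed rfl)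
      rwa [add_sub_cancel] at h3
    | arc =>
      have h3 := hΓ.arc rfl
      simp [boundaryTerm, (h3 a (by simp)).1, (h3 a (by simp)).2, (h3 b (by simp)).1,
        (h3 b (by simp)).2]
  have hpt : ∀ s ∈ Ioo a b, 1 / p * fderiv ℝ (fun q ↦ fderiv ℝ
      (fun q : ℝ × ℝ ↦ length g (tension g (Γ q.1) q.2) ^ p) q dirT) (0, s) dirT
      = hessianDensity g K p (Γ 0) s + deriv (boundaryTerm g p Γ) s := by
    intro s hs
    have hq := hmem s (Ioo_subset_Icc_self hs)
    have h3 := (h.normalVariation g hε (Γ 0 s) hγ hη).second_variation (p := p)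
      (by simp) (constCurvOn_chart g hK (Γ 0 s)) hp
      ⟨hs, mem_chart_self _⟩ (h.equation_chart g hK hq (hγ.equation s (Ioo_subset_Icc_self hs)))
    rw [h.fderiv_energyDensity g hq, h3, h.deriv_boundaryTerm g hq, hessianDensity,
      h.deriv_geodesicCurvature g hq, geodesicCurvature, h.length_tension g hq.1]
  have hval : 1 / p * ∫ s in a..b, fderiv ℝ (fun q ↦ fderiv ℝ
      (fun q : ℝ × ℝ ↦ length g (tension g (Γ q.1) q.2) ^ p) q dirT) (0, s) dirT
      = ∫ s in a..b, hessianDensity g K p (Γ 0) s := by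
    -- the pointwise identity holds in the open interval, which has full measure
    rw [← intervalIntegral.integral_const_mul, intervalIntegral.integral_of_le hab.le,
      integral_Ioc_eq_integral_Ioo, setIntegral_congr_fun measurableSet_Ioo hpt,
      ← integral_Ioc_eq_integral_Ioo, ← intervalIntegral.integral_of_le hab.le,
      intervalIntegral.integral_add, hint, add_zero]
    · have h4 := hγ.continuousOn_hessianDensity g (K := K)
      rw [← uIcc_of_le hab.le] at h4
      exact h4.intervalIntegrable
    · rw [← uIcc_of_le hab.le] at hdb
      exact hdb.intervalIntegrable
  rw [← hval]
  exact h2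

/-- For `p ≠ 1/2` the geodesic curvature is constant, and its square is the curvature of the
surface. -/
lemma IsPBiharmonicCurve.exists_curvature_eq [CompactSpace M] (hK : HasConstantCurvature g K)
    (hp : p ≠ 1 / 2) (hab : a < b) (hγ : IsPBiharmonicCurve g c p a b γ) :
    ∃ k : ℝ, 0 < k ∧ k ^ 2 = K ∧ (∀ s ∈ Icc a b, geodesicCurvature g γ s = k) ∧
      ∀ s ∈ Ioo a b, deriv (geodesicCurvature g γ) s = 0 := by
  obtain ⟨Γ, hΓ⟩ := hγ.exists_isVariation g hab
  obtain ⟨ε, hε, h⟩ := hΓ.smooth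
  change SmoothFamily ε Γ at h
  obtain rfl := hΓ.zero
  have h0 : (0 : ℝ) ∈ Ioo (-ε) ε := ⟨by linarith, hε⟩
  have hη : ∀ s ∈ Icc a b, variationField Γ s = unitNormal g (Γ 0) s := fun s hs ↦ by
    simpa using hΓ.field s hs
  have hmem : ∀ s ∈ Icc a b, ((0 : ℝ), s) ∈ posDom g ε Γ (Γ 0 s) := fun s hs ↦
    h.mem_posDom g h0 (mem_chart_self _) (hγ.curvature_pos s hs)
  have hderiv : ∀ s ∈ Ioo a b, deriv (geodesicCurvature g (Γ 0)) s = 0 := fun s hs ↦ by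
    have hq := hmem s (Ioo_subset_Icc_self hs)
    rw [h.deriv_geodesicCurvature g hq]
    exact (h.normalVariation g hε (Γ 0 s) hγ hη).fderiv_tensNorm_eq_zero (p := p) (by simp) hp
      ⟨hs, mem_chart_self _⟩ (h.equation_chart g hK hq (hγ.equation s (Ioo_subset_Icc_self hs)))
  have hconst : ∀ s ∈ Icc a b, geodesicCurvature g (Γ 0) s = geodesicCurvature g (Γ 0) a := by
    refine constant_of_has_deriv_right_zero
      (continuous_geodesicCurvature g hγ.smooth).continuousOn fun s hs ↦ ?_
    have hs' := Ico_subset_Icc_self hs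
    have hd := contDiffAt_geodesicCurvature g hγ.smooth (hγ.curvature_pos s hs')
    have h1 : deriv (geodesicCurvature g (Γ 0)) s = 0 := by
      -- the derivative vanishes inside the interval, hence at its left endpoint by continuity
      have h2 : Tendsto (deriv (geodesicCurvature g (Γ 0))) (𝓝[>] s)
          (𝓝 (deriv (geodesicCurvature g (Γ 0)) s)) :=
        (contDiffAt_deriv_of_infty hd).continuousAt.tendsto.mono_left nhdsWithin_le_nhds
      refine tendsto_nhds_unique h2 (tendsto_const_nhds.congr' ?_)
      filter_upwards [Ioo_mem_nhdsGT hs.2] with r hr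
      exact (hderiv r ⟨hs.1.trans_lt hr.1, hr.2⟩).symm
    have h3 := (hd.differentiableAt (by simp)).hasDerivAt
    rw [h1] at h3
    exact h3.hasDerivWithinAt
  refine ⟨_, hγ.curvature_pos a (left_mem_Icc.2 hab.le), ?_, hconst, hderiv⟩
  obtain ⟨s, hs⟩ := nonempty_Ioo.2 hab
  have hq := hmem s (Ioo_subset_Icc_self hs)
  refine (h.normalVariation g hε (Γ 0 s) hγ hη).sq_tensNorm_eq (p := p) (by simp)
    ⟨hs, mem_chart_self _⟩ (fun r hr ↦ ?_)
    (h.equation_chart g hK hq (hγ.equation s (Ioo_subset_Icc_self hs)))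
  have hr' := Ioo_subset_Icc_self hr.1
  rw [← h.length_tension g ⟨⟨h0, mem_univ r⟩, hr.2⟩]
  exact hconst r hr'

end Hessian

/-! ### Curves of constant geodesic curvature -/

section ConstantCurvatureCurve

variable {M : Type*} [TopologicalSpace M] [ChartedSpace Plane M] [IsManifold (𝓡 2) ∞ M]
  (g : SmoothMetric M) {γ : ℝ → M} {p a b k : ℝ}

lemma integral_hessianDensity_of_const (hk : 0 < k) (hab : a < b)
    (hkc : ∀ s ∈ Icc a b, geodesicCurvature g γ s = k)
    (hk' : ∀ s ∈ Ioo a b, deriv (geodesicCurvature g γ) s = 0) :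
    ∫ s in a..b, hessianDensity g (k ^ 2) p γ s = -4 * k ^ 2 * (b - a) * k ^ p := by
  have h1 : ∀ s ∈ Ioo a b, hessianDensity g (k ^ 2) p γ s = -4 * k ^ 2 * k ^ p := by
    intro s hs
    have p1 : k ^ (p + 2) = k ^ p * k ^ 2 := by
      rw [← Real.rpow_add_natCast hk.ne']
      norm_num
    have p2 : k ^ p = k ^ (p - 2) * k ^ 2 := by
      rw [← Real.rpow_add_natCast hk.ne']
      norm_num
    rw [hessianDensity, hkc s (Ioo_subset_Icc_self hs), hk' s hs, p1, p2]
    ring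
  rw [intervalIntegral.integral_of_le hab.le, integral_Ioc_eq_integral_Ioo,
    setIntegral_congr_fun measurableSet_Ioo h1, ← integral_Ioc_eq_integral_Ioo,
    ← intervalIntegral.integral_of_le hab.le, intervalIntegral.integral_const, smul_eq_mul]
  ring

end ConstantCurvatureCurve

end PBiharmonic

end

open PBiharmonic
theorem mainTheorem8 {M : Type*} [TopologicalSpace M] [ChartedSpace Plane M]
    [IsManifold (𝓡 2) ∞ M] [T2Space M] [CompactSpace M]
    (g : SmoothMetric M) (K : ℝ) (hK : HasConstantCurvature g K)
    (c : CurveKind) (p a b : ℝ) (hp : 0 < p) (hab : a < b)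
    (γ : ℝ → M) (hγ : IsPBiharmonicCurve g c p a b γ) :
    HasHessian g c p a b γ (unitNormal g γ)
        (∫ s in a..b, ((p - 1) * geodesicCurvature g γ s ^ (p + 2)
          + deriv (geodesicCurvature g γ) s ^ 2 * geodesicCurvature g γ s ^ (p - 2)
          + (p - 1) * K ^ 2 * geodesicCurvature g γ s ^ (p - 2)
          - (2 * p + 2) * K * geodesicCurvature g γ s ^ p)) ∧
      (p ≠ 1 / 2 → ∃ k : ℝ, (∀ s ∈ Icc a b, geodesicCurvature g γ s = k) ∧
        HasHessian g c p a b γ (unitNormal g γ) (-4 * K * (b - a) * k ^ p)) ∧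
      (p ≠ 1 / 2 → 0 < K → IsUnstable g c p a b γ) ∧
      (p = 1 / 2 → HasHessian g c p a b γ (unitNormal g γ)
        (∫ s in a..b, (-(1 / 2) * geodesicCurvature g γ s ^ (5 / 2 : ℝ)
          + deriv (geodesicCurvature g γ) s ^ 2 * geodesicCurvature g γ s ^ (-(3 / 2) : ℝ)
          - (1 / 2) * K ^ 2 * geodesicCurvature g γ s ^ (-(3 / 2) : ℝ)
          - 3 * K * geodesicCurvature g γ s ^ (1 / 2 : ℝ)))) := by
  have hp0 : p ≠ 0 := hp.ne'
  have hex := hγ.exists_isVariation g hab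
  have hess : HasHessian g c p a b γ (unitNormal g γ) (∫ s in a..b, hessianDensity g K p γ s) :=
    ⟨hex, fun Γ hΓ ↦ hγ.hasSecondDerivAtZero g hK hp0 hab hΓ⟩
  have hconst : p ≠ 1 / 2 → ∃ k : ℝ, 0 < k ∧ (∀ s ∈ Icc a b, geodesicCurvature g γ s = k) ∧
      HasHessian g c p a b γ (unitNormal g γ) (-4 * K * (b - a) * k ^ p) := by
    intro hp2
    obtain ⟨k, hk, rfl, hkc, hk'⟩ := hγ.exists_curvature_eq g hK hp2 hab
    exact ⟨k, hk, hkc, integral_hessianDensity_of_const g hk hab hkc hk' ▸ hess⟩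
  refine ⟨hess, fun hp2 ↦ ?_, fun hp2 hKpos ↦ ?_, fun hp2 ↦ ?_⟩
  · obtain ⟨k, -, hkc, hk⟩ := hconst hp2
    exact ⟨k, hkc, hk⟩
  · obtain ⟨k, hk0, -, hk⟩ := hconst hp2
    refine ⟨_, _, hk, ?_⟩
    have h1 : 0 < K * (b - a) * k ^ p :=
      mul_pos (mul_pos hKpos (sub_pos.2 hab)) (Real.rpow_pos_of_pos hk0 p)
    linarith
  · subst hp2
    convert hess using 3 with s
    rw [hessianDensity]
    norm_num
    ring
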